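/- Let $(N,g)$ be a time-oriented Lorentzian manifold of signature $(n,1)$ (dimension $n+1$) and of constant sectional curvature $-\kappa<0$, and let $M$ be a closed $n$-dimensional manifold. For a smooth spacelike immersion $M\to N$ with future directed timelike unit normal $\nu$ (so $g(\nu,\nu)=-1$), let the principal curvatures $\lambda_1\le\dots\le\lambda_n$ be the eigenvalues, with multiplicity, of the Weingarten map $\mathscr W:T_pM\to T_pM$, $\mathscr W(V)=\nabla_V\nu$ (with $T_pM$ identified with its image in the tangent space of $N$, and $\nabla$ induced by the Levi-Civita connection of $g$), and define the Lagrangian angle $$\phi=\frac1{\sqrt\kappa}\sum_{i=1}^n\arctan\frac{\lambda_i}{\sqrt\kappa}.$$ Let $0<T\le\infty$ and let $F:M\times[0,T)\to N$ be a smooth family of spacelike immersions $F(\cdot,t)$ with $$\frac{\partial}{\partial t}F(p,t)=\phi(p,t)\,\nu(p,t)\qquad\text{for all }(p,t)\in M\times[0,T),$$ where $\nu(\cdot,t)$ and $\phi(\cdot,t)$ are the future directed timelike unit normal and the Lagrangian angle of $F(\cdot,t)$. Then $$\inf_{q\in M}\phi(q,0)\le\phi(p,t)\,e^{nt}\le\sup_{q\in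 M}\phi(q,0)\qquad\text{for all }(p,t)\in M\times[0,T).$$ -/

import Mathlib

open scoped Manifold ContDiff
open Set

noncomputable section

namespace AdSFlow

/-- Tangent spaces of an `m`-dimensional manifold are finite dimensional. -/
instance instFiniteDimensionalTangentSpace {m : ℕ} {X : Type*} [TopologicalSpace X]
    [ChartedSpace (EuclideanSpace ℝ (Fin m)) X] (x : X) :
    FiniteDimensional ℝ (TangentSpace (𝓡 m) x) :=
  inferInstanceAs (FiniteDimensional ℝ (EuclideanSpace ℝ (Fin m)))

section Lorentz

/-- A smooth Lorentzian metric of signature `(n,1)` on an `(n+1)`-dimensional manifold `N`: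
a smooth section of symmetric bilinear forms on the tangent bundle such that each tangent space
has an orthonormal basis with `n` spacelike vectors and one timelike vector. -/
structure LorentzMetric (n : ℕ) (N : Type*) [TopologicalSpace N]
    [ChartedSpace (EuclideanSpace ℝ (Fin (n + 1))) N] [IsManifold (𝓡 (n + 1)) ∞ N] where
  /-- The scalar product on each tangent space. -/
  val (q : N) : TangentSpace (𝓡 (n + 1)) q →L[ℝ] TangentSpace (𝓡 (n + 1)) q →L[ℝ] ℝ
  symm (q : N) (v w : TangentSpace (𝓡 (n + 1)) q) : val q v w = val q w v
  signature (q : N) : ∃ b : Module.Basis (Fin (n + 1)) ℝ (TangentSpace (𝓡 (n + 1)) q),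
    ∀ i j, val q (b i) (b j) = if i = j then (if i = Fin.last n then -1 else 1) else 0
  contMDiff : ContMDiff (𝓡 (n + 1))
    ((𝓡 (n + 1)).prod 𝓘(ℝ, EuclideanSpace ℝ (Fin (n + 1)) →L[ℝ]
      EuclideanSpace ℝ (Fin (n + 1)) →L[ℝ] ℝ)) ∞
    (fun q : N ↦ Bundle.TotalSpace.mk' (EuclideanSpace ℝ (Fin (n + 1)) →L[ℝ]
      EuclideanSpace ℝ (Fin (n + 1)) →L[ℝ] ℝ)
      (E := fun q : N ↦ TangentSpace (𝓡 (n + 1)) q →L[ℝ] TangentSpace (𝓡 (n + 1)) q →L[ℝ] ℝ)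
      q (val q))

variable {n : ℕ} {N : Type*} [TopologicalSpace N]
  [ChartedSpace (EuclideanSpace ℝ (Fin (n + 1))) N] [IsManifold (𝓡 (n + 1)) ∞ N]

/-- A time orientation: a smooth vector field which is timelike at every point. A timelike vector
`v` is future directed when it lies in the same half of the light cone as the vector field. -/
structure TimeOrientation (g : LorentzMetric n N) where
  /-- The timelike vector field. -/
  field (q : N) : TangentSpace (𝓡 (n + 1)) q
  timelike (q : N) : g.val q (field q) (field q) < 0
  contMDiff : ContMDiff (𝓡 (n + 1)) (𝓡 (n + 1)).tangent ∞
    (fun q : N ↦ (⟨q, field q⟩ : TangentBundle (𝓡 (n + 1)) N))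

/-- A timelike vector `v` is future directed. -/
def IsFutureDirected {g : LorentzMetric n N} (τ : TimeOrientation g) {q : N}
    (v : TangentSpace (𝓡 (n + 1)) q) : Prop :=
  g.val q v v < 0 ∧ g.val q v (τ.field q) < 0

/-- The coordinate vector `∂/∂y^α` of the chart `e` of `N`, at the point with coordinates `y`. -/
def coordVector (e : OpenPartialHomeomorph N (EuclideanSpace ℝ (Fin (n + 1))))
    (y : EuclideanSpace ℝ (Fin (n + 1))) (α : Fin (n + 1)) :
    TangentSpace (𝓡 (n + 1)) (e.symm y) :=
  mfderiv 𝓘(ℝ, EuclideanSpace ℝ (Fin (n + 1))) (𝓡 (n + 1)) e.symm y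
    (EuclideanSpace.single α (1 : ℝ))

/-- The components `v^α` in the chart `e` of a tangent vector `v` at `q`. -/
def components (e : OpenPartialHomeomorph N (EuclideanSpace ℝ (Fin (n + 1)))) (q : N)
    (v : TangentSpace (𝓡 (n + 1)) q) : EuclideanSpace ℝ (Fin (n + 1)) :=
  mfderiv (𝓡 (n + 1)) 𝓘(ℝ, EuclideanSpace ℝ (Fin (n + 1))) e q v

/-- The matrix `g_{αβ}` of the metric in the chart `e`, as a function of the coordinates. -/
def metricMatrix (g : LorentzMetric n N)
    (e : OpenPartialHomeomorph N (EuclideanSpace ℝ (Fin (n + 1))))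
    (y : EuclideanSpace ℝ (Fin (n + 1))) : Matrix (Fin (n + 1)) (Fin (n + 1)) ℝ :=
  Matrix.of fun α β ↦ g.val (e.symm y) (coordVector e y α) (coordVector e y β)

/-- The partial derivative `∂f/∂y^α`. -/
def partialDeriv (α : Fin (n + 1)) (f : EuclideanSpace ℝ (Fin (n + 1)) → ℝ)
    (y : EuclideanSpace ℝ (Fin (n + 1))) : ℝ :=
  fderiv ℝ f y (EuclideanSpace.single α (1 : ℝ))

/-- The Christoffel symbol `Γ^α_{βγ}` of the Levi-Civita connection in the chart `e`. -/
def christoffel (g : LorentzMetric n N)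
    (e : OpenPartialHomeomorph N (EuclideanSpace ℝ (Fin (n + 1))))
    (α β γ : Fin (n + 1)) (y : EuclideanSpace ℝ (Fin (n + 1))) : ℝ :=
  (1 / 2) * ∑ δ, (metricMatrix g e y)⁻¹ α δ *
    (partialDeriv β (fun z ↦ metricMatrix g e z γ δ) y
      + partialDeriv γ (fun z ↦ metricMatrix g e z β δ) y
      - partialDeriv δ (fun z ↦ metricMatrix g e z β γ) y)

/-- The components `R^α_{βγδ}` of the curvature tensor in the chart `e`, with the convention
`R(∂_γ, ∂_δ) ∂_β = ∇_γ ∇_δ ∂_β - ∇_δ ∇_γ ∂_β = R^α_{βγδ} ∂_α`. -/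
def riemann (g : LorentzMetric n N)
    (e : OpenPartialHomeomorph N (EuclideanSpace ℝ (Fin (n + 1))))
    (α β γ δ : Fin (n + 1)) (y : EuclideanSpace ℝ (Fin (n + 1))) : ℝ :=
  partialDeriv γ (christoffel g e α δ β) y - partialDeriv δ (christoffel g e α γ β) y
    + ∑ μ, (christoffel g e α γ μ y * christoffel g e μ δ β y
      - christoffel g e α δ μ y * christoffel g e μ γ β y)

/-- The scalar product of two vectors given by their components in the chart `e`. -/
def innerCoord (g : LorentzMetric n N)
    (e : OpenPartialHomeomorph N (EuclideanSpace ℝ (Fin (n + 1))))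
    (y : EuclideanSpace ℝ (Fin (n + 1))) (v w : Fin (n + 1) → ℝ) : ℝ :=
  ∑ α, ∑ β, metricMatrix g e y α β * v α * w β

/-- The components of `R(v, w) w` in the chart `e`. -/
def curvatureVector (g : LorentzMetric n N)
    (e : OpenPartialHomeomorph N (EuclideanSpace ℝ (Fin (n + 1))))
    (y : EuclideanSpace ℝ (Fin (n + 1))) (v w : Fin (n + 1) → ℝ) : Fin (n + 1) → ℝ :=
  fun α ↦ ∑ β, ∑ γ, ∑ δ, riemann g e α β γ δ y * w β * v γ * w δ

/-- `⟨v,v⟩⟨w,w⟩ - ⟨v,w⟩²`, which is nonzero exactly when `v`, `w` span a nondegenerate plane. -/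
def planeGram (g : LorentzMetric n N)
    (e : OpenPartialHomeomorph N (EuclideanSpace ℝ (Fin (n + 1))))
    (y : EuclideanSpace ℝ (Fin (n + 1))) (v w : Fin (n + 1) → ℝ) : ℝ :=
  innerCoord g e y v v * innerCoord g e y w w - innerCoord g e y v w ^ 2

/-- The sectional curvature `⟨R(v,w)w,v⟩ / (⟨v,v⟩⟨w,w⟩ - ⟨v,w⟩²)` of every nondegenerate tangent
plane, computed in any smooth chart, equals `c`. -/
def HasConstantSectionalCurvature (g : LorentzMetric n N) (c : ℝ) : Prop :=
  ∀ e ∈ IsManifold.maximalAtlas (𝓡 (n + 1)) ∞ N, ∀ y ∈ e.target, ∀ v w : Fin (n + 1) → ℝ,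
    planeGram g e y v w ≠ 0 →
      innerCoord g e y (curvatureVector g e y v w) v / planeGram g e y v w = c

variable {M : Type*} [TopologicalSpace M] [ChartedSpace (EuclideanSpace ℝ (Fin n)) M]

/-- The differential `dF : T_p M → T_{F(p)} N`. -/
abbrev differential (F : M → N) (p : M) :
    TangentSpace (𝓡 n) p →L[ℝ] TangentSpace (𝓡 (n + 1)) (F p) :=
  mfderiv (𝓡 n) (𝓡 (n + 1)) F p

/-- The derivative `V(f)` of a function `f` on `M` in the direction `V ∈ T_p M`. -/
def dirDeriv (f : M → ℝ) (p : M) (V : TangentSpace (𝓡 n) p) : ℝ :=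
  mfderiv (𝓡 n) 𝓘(ℝ, ℝ) f p V

/-- `F` is a spacelike immersion: its differential is injective and the induced metric
`F^* g` is positive definite. (Smoothness of `F` is required separately.) -/
def IsSpacelikeImmersion (g : LorentzMetric n N) (F : M → N) : Prop :=
  ∀ p : M, Function.Injective (differential (n := n) F p) ∧
    ∀ V : TangentSpace (𝓡 n) p, V ≠ 0 →
      0 < g.val (F p) (differential F p V) (differential F p V)

/-- `ν` is the future directed timelike unit normal along `F`. -/
def IsFutureUnitNormal {g : LorentzMetric n N} (τ : TimeOrientation g) (F : M → N)
    (ν : ∀ p : M, TangentSpace (𝓡 (n + 1)) (F p)) : Prop :=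
  ∀ p : M, g.val (F p) (ν p) (ν p) = -1 ∧
    (∀ V : TangentSpace (𝓡 n) p, g.val (F p) (ν p) (differential F p V) = 0) ∧
    IsFutureDirected τ (ν p)

/-- The components of the covariant derivative `∇_V X` at `p` of a vector field `X` along `F`,
for the connection induced by the Levi-Civita connection of `g`, in a chart `e` of `N` around
`F p`: `(∇_V X)^α = V(X^α) + Γ^α_{βγ} (dF V)^β X^γ`. -/
def covDerivComponents (g : LorentzMetric n N)
    (e : OpenPartialHomeomorph N (EuclideanSpace ℝ (Fin (n + 1)))) (F : M → N)
    (X : ∀ p : M, TangentSpace (𝓡 (n + 1)) (F p)) (p : M) (V : TangentSpace (𝓡 n) p)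
    (α : Fin (n + 1)) : ℝ :=
  dirDeriv (fun q : M ↦ components e (F q) (X q) α) p V
    + ∑ β, ∑ γ, christoffel g e α β γ (e (F p)) *
        components e (F p) (differential F p V) β * components e (F p) (X p) γ

/-- The covariant derivative `∇_V X ∈ T_{F(p)} N` at `p` of a vector field `X` along `F`. It does
not depend on the chart around `F p`; the preferred one is used. -/
def covDeriv (g : LorentzMetric n N) (F : M → N)
    (X : ∀ p : M, TangentSpace (𝓡 (n + 1)) (F p)) (p : M) (V : TangentSpace (𝓡 n) p) :
    TangentSpace (𝓡 (n + 1)) (F p) :=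
  mfderiv 𝓘(ℝ, EuclideanSpace ℝ (Fin (n + 1))) (𝓡 (n + 1))
    (chartAt (EuclideanSpace ℝ (Fin (n + 1))) (F p)).symm
    (chartAt (EuclideanSpace ℝ (Fin (n + 1))) (F p) (F p))
    (WithLp.toLp 2
      (covDerivComponents g (chartAt (EuclideanSpace ℝ (Fin (n + 1))) (F p)) F X p V))

/-- `W` is the Weingarten map at `p`: `W V = ∇_V ν` for all `V ∈ T_p M`, where `T_p M` is
identified with its image in `T_{F(p)} N` under `dF`. -/
def IsWeingartenMap (g : LorentzMetric n N) (F : M → N)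
    (ν : ∀ p : M, TangentSpace (𝓡 (n + 1)) (F p)) (p : M)
    (W : TangentSpace (𝓡 n) p →ₗ[ℝ] TangentSpace (𝓡 n) p) : Prop :=
  ∀ V : TangentSpace (𝓡 n) p, differential F p (W V) = covDeriv g F ν p V

open Classical in
/-- The Weingarten map at `p`. For a smooth spacelike immersion `F` with unit normal `ν` there is
exactly one linear map as required; the value `0` in the other case is irrelevant. -/
def weingarten (g : LorentzMetric n N) (F : M → N)
    (ν : ∀ p : M, TangentSpace (𝓡 (n + 1)) (F p)) (p : M) :
    TangentSpace (𝓡 n) p →ₗ[ℝ] TangentSpace (𝓡 n) p :=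
  if h : ∃ W, IsWeingartenMap g F ν p W then h.choose else 0

/-- The principal curvatures at `p`: the eigenvalues of the Weingarten map, with multiplicity.
(The Weingarten map is self-adjoint for `F^* g`, so there are `n` real ones.) -/
def principalCurvatures (g : LorentzMetric n N) (F : M → N)
    (ν : ∀ p : M, TangentSpace (𝓡 (n + 1)) (F p)) (p : M) : Multiset ℝ :=
  (weingarten g F ν p).charpoly.roots

/-- The Lagrangian angle `φ = κ^{-1/2} ∑ arctan (λ_i / κ^{1/2})`. -/
def lagrangianAngle (g : LorentzMetric n N) (κ : ℝ) (F : M → N)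
    (ν : ∀ p : M, TangentSpace (𝓡 (n + 1)) (F p)) (p : M) : ℝ :=
  1 / √κ * ((principalCurvatures g F ν p).map fun l ↦ Real.arctan (l / √κ)).sum

/-- The time interval `[0,T)`, where `T = ∞` is allowed. -/
def timeInterval (T : EReal) : Set ℝ := {t : ℝ | 0 ≤ t ∧ (t : EReal) < T}

/-- `F : M × [0,T) → N` is a smooth family of spacelike immersions with future directed timelike
unit normals `ν` which solves `∂F/∂t = φ ν` on `M × [0,T)`, where `φ(·,t)` is the Lagrangian angle
of `F(·,t)`. (At `t = 0` the derivative is one-sided.) -/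
structure IsLagrangianAngleFlow {g : LorentzMetric n N} (τ : TimeOrientation g) (κ : ℝ)
    (T : EReal) (F : M → ℝ → N)
    (ν : ∀ (p : M) (t : ℝ), TangentSpace (𝓡 (n + 1)) (F p t)) : Prop where
  smooth : ContMDiffOn ((𝓡 n).prod 𝓘(ℝ, ℝ)) (𝓡 (n + 1)) ∞
    (fun x : M × ℝ ↦ F x.1 x.2) (univ ×ˢ timeInterval T)
  spacelike : ∀ t ∈ timeInterval T, IsSpacelikeImmersion g (fun p ↦ F p t)
  normal : ∀ t ∈ timeInterval T, IsFutureUnitNormal τ (fun p ↦ F p t) (fun p ↦ ν p t)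
  evolution : ∀ p : M, ∀ t ∈ timeInterval T,
    HasMFDerivWithinAt 𝓘(ℝ, ℝ) (𝓡 (n + 1)) (fun s : ℝ ↦ F p s) (timeInterval T) t
      (ContinuousLinearMap.toSpanSingleton ℝ
        (lagrangianAngle g κ (fun q ↦ F q t) (fun q ↦ ν q t) p • ν p t))

end Lorentz

end AdSFlow

end

/-! The bounds come from the maximum principle. In a principal frame the flow gives `∂φ/∂t = ∑ φ_ii
/ (κ + λ_i²) - n φ`. At a spatial maximum the sum is nonpositive, so `∂φ/∂t + n φ ≤ 0`, and `φ
e^{nt}` cannot rise above its initial supremum. The lower bound is the same statement for `-φ`.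

The evolution equation is needed, and proved, only at spatial critical points of `φ`
(`IsNormalFlowAt.exists_fderiv_angle_eq`). There `∇_t ν`, which is the gradient of `φ`, vanishes,
and second derivatives of `φ` in coordinates serve as its Hessian, so no connection on `M` is
required.

Eigenvalues are never differentiated. With `g_ij` the induced metric and `h_ij` the second
fundamental form, `√κ φ` is an argument of `det (g_ij + i h_ij / √κ)`, because this determinant is a
positive number times `∏ (1 + i λ_k / √κ)` (`det_add_I_mul_eq`). In an orthonormal eigenbasis the
matrix is diagonal at the point, so the derivative of the argument is the sum of the imaginary parts
of `(∂_t g_ii + i ∂_t h_ii / √κ) / (1 + i λ_i / √κ)`. Here `∂_t g_ii = 2 φ λ_i` and `∂_t h_ii = φ_ii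
- κ φ + φ λ_i²`, where `-κ φ` is the curvature term. Each imaginary part is then `√κ (φ_ii / (κ +
λ_i²) - φ)`, and the `n` copies of `-φ` produce the exponent `n t`.

Two points need care. Neither `ν` nor `φ` is assumed smooth. The normal is smooth because metric,
tangent space and time orientation determine it (`contDiffWithinAt_normal`), and then `φ = -g(∂F/∂t,
ν)` is smooth by the flow equation itself. Moreover, `covDeriv` uses a chart that changes with the
point, so covariant derivatives must be shown independent of the chart (`components_covDeriv`)
before one fixed chart can be used near a given point. -/

noncomputable section

set_option linter.unusedSectionVars false

namespace AdSFlow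

/-! ### Covariant differentiation along maps between vector spaces. -/

section LocalCalculus

open Filter Topology

variable {E : Type*} [NormedAddCommGroup E] [NormedSpace ℝ E]
  {P : Type*} [NormedAddCommGroup P] [NormedSpace ℝ P]

/-- `Γ` is at `y` the connection form of a torsion free connection compatible with `G`. -/
structure IsLeviCivitaAt (G : E → E →L[ℝ] E →L[ℝ] ℝ) (Γ : E → E →L[ℝ] E →L[ℝ] E) (y : E) :
    Prop where
  symm : ∀ u v, Γ y u v = Γ y v u
  compat : ∀ u v w, fderiv ℝ G y u v w = G y (Γ y u v) w + G y v (Γ y u w)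

/-- The covariant derivative along `f` of the vector field `X` in the direction `a`. -/
def covAlong (Γ : E → E →L[ℝ] E →L[ℝ] E) (f X : P → E) (a : P) (z : P) : E :=
  fderiv ℝ X z a + Γ (f z) (fderiv ℝ f z a) (X z)

/-- The curvature `R(u,v)w` of the connection `Γ`. -/
def curvForm (Γ : E → E →L[ℝ] E →L[ℝ] E) (y u v w : E) : E :=
  fderiv ℝ Γ y u v w - fderiv ℝ Γ y v u w + (Γ y u (Γ y v w) - Γ y v (Γ y u w))

theorem hasFDerivAt_bilin_comp {F : Type*} [NormedAddCommGroup F] [NormedSpace ℝ F]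
    {B : E → E →L[ℝ] E →L[ℝ] F} {f X Y : P → E} {z : P}
    (hB : DifferentiableAt ℝ B (f z)) (hf : DifferentiableAt ℝ f z)
    (hX : DifferentiableAt ℝ X z) (hY : DifferentiableAt ℝ Y z) :
    DifferentiableAt ℝ (fun x ↦ B (f x) (X x) (Y x)) z ∧
    ∀ a, fderiv ℝ (fun x ↦ B (f x) (X x) (Y x)) z a =
      fderiv ℝ B (f z) (fderiv ℝ f z a) (X z) (Y z) + B (f z) (fderiv ℝ X z a) (Y z)
        + B (f z) (X z) (fderiv ℝ Y z a) := by
  have h1 : HasFDerivAt (fun x ↦ B (f x)) ((fderiv ℝ B (f z)).comp (fderiv ℝ f z)) z :=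
    HasFDerivAt.comp (g := B) z hB.hasFDerivAt hf.hasFDerivAt
  have h2 := (h1.clm_apply hX.hasFDerivAt).clm_apply hY.hasFDerivAt
  refine ⟨h2.differentiableAt, fun a ↦ ?_⟩
  have h3 : fderiv ℝ (fun x ↦ B (f x) (X x) (Y x)) z = _ := h2.fderiv
  rw [h3]
  simp
  abel

theorem fderiv_metric_comp {G : E → E →L[ℝ] E →L[ℝ] ℝ} {Γ : E → E →L[ℝ] E →L[ℝ] E}
    {f X Y : P → E} {z : P} (hLC : IsLeviCivitaAt G Γ (f z))
    (hG : DifferentiableAt ℝ G (f z)) (hf : DifferentiableAt ℝ f z)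
    (hX : DifferentiableAt ℝ X z) (hY : DifferentiableAt ℝ Y z) (a : P) :
    fderiv ℝ (fun x ↦ G (f x) (X x) (Y x)) z a =
      G (f z) (covAlong Γ f X a z) (Y z) + G (f z) (X z) (covAlong Γ f Y a z) := by
  rw [(hasFDerivAt_bilin_comp hG hf hX hY).2 a, hLC.compat]
  simp only [covAlong, map_add, add_apply]
  ring

theorem differentiableAt_fderiv_apply {f : P → E} {z : P} (hf : ContDiffAt ℝ 2 f z) (a : P) :
    DifferentiableAt ℝ (fun x ↦ fderiv ℝ f x a) z ∧
      ∀ b, fderiv ℝ (fun x ↦ fderiv ℝ f x a) z b = fderiv ℝ (fderiv ℝ f) z b a := by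
  have h : DifferentiableAt ℝ (fderiv ℝ f) z :=
    (hf.fderiv_right (m := 1) (by norm_num)).differentiableAt (by norm_num)
  have h2 := h.hasFDerivAt.clm_apply (hasFDerivAt_const a z)
  refine ⟨h2.differentiableAt, fun b ↦ ?_⟩
  rw [h2.fderiv]
  simp

theorem fderiv_fderiv_comm {f : P → E} {z : P} (hf : ContDiffAt ℝ 2 f z) (a b : P) :
    fderiv ℝ (fderiv ℝ f) z a b = fderiv ℝ (fderiv ℝ f) z b a :=
  (hf.isSymmSndFDerivAt (by simp)) a b

/-- Torsion-freeness: ordinary second derivatives commute and `Γ` is symmetric. -/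
theorem covAlong_fderiv_comm {G : E → E →L[ℝ] E →L[ℝ] ℝ} {Γ : E → E →L[ℝ] E →L[ℝ] E}
    {f : P → E} {z : P} (hLC : IsLeviCivitaAt G Γ (f z)) (hf : ContDiffAt ℝ 2 f z) (a b : P) :
    covAlong Γ f (fun x ↦ fderiv ℝ f x b) a z = covAlong Γ f (fun x ↦ fderiv ℝ f x a) b z := by
  simp only [covAlong]
  rw [(differentiableAt_fderiv_apply hf a).2, (differentiableAt_fderiv_apply hf b).2,
    fderiv_fderiv_comm hf a b, hLC.symm]

theorem differentiableAt_covAlong {Γ : E → E →L[ℝ] E →L[ℝ] E} {f X : P → E} {z : P}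
    (hΓ : DifferentiableAt ℝ Γ (f z)) (hf : ContDiffAt ℝ 2 f z) (hX : ContDiffAt ℝ 2 X z)
    (a : P) : DifferentiableAt ℝ (covAlong Γ f X a) z :=
  (differentiableAt_fderiv_apply hX a).1.add
    (hasFDerivAt_bilin_comp hΓ (hf.differentiableAt (by norm_num))
      (differentiableAt_fderiv_apply hf a).1 (hX.differentiableAt (by norm_num))).1

/-- The second derivatives of `f` and `X` cancel by symmetry; what survives is the derivative of `Γ`
and the quadratic terms in `Γ`, that is, the curvature. -/
theorem covAlong_comm {Γ : E → E →L[ℝ] E →L[ℝ] E} {f X : P → E} {z : P}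
    (hΓ : DifferentiableAt ℝ Γ (f z)) (hf : ContDiffAt ℝ 2 f z) (hX : ContDiffAt ℝ 2 X z)
    (a b : P) :
    covAlong Γ f (covAlong Γ f X b) a z - covAlong Γ f (covAlong Γ f X a) b z =
      curvForm Γ (f z) (fderiv ℝ f z a) (fderiv ℝ f z b) (X z) := by
  have key : ∀ a b, fderiv ℝ (covAlong Γ f X b) z a = fderiv ℝ (fderiv ℝ X) z a b +
      (fderiv ℝ Γ (f z) (fderiv ℝ f z a) (fderiv ℝ f z b) (X z)
        + Γ (f z) (fderiv ℝ (fderiv ℝ f) z a b) (X z)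
        + Γ (f z) (fderiv ℝ f z b) (fderiv ℝ X z a)) := by
    intro a b
    have hf1 := hf.differentiableAt (by norm_num)
    have hX1 := hX.differentiableAt (by norm_num)
    have h1 := hasFDerivAt_bilin_comp hΓ hf1 (differentiableAt_fderiv_apply hf b).1 hX1
    have h2 := (differentiableAt_fderiv_apply hX b).1.hasFDerivAt.add h1.1.hasFDerivAt
    have h3 : fderiv ℝ (covAlong Γ f X b) z = _ := h2.fderiv
    rw [h3, add_apply, h1.2, (differentiableAt_fderiv_apply hX b).2,
      (differentiableAt_fderiv_apply hf b).2]
  have e1 : ∀ a b, covAlong Γ f (covAlong Γ f X b) a z = fderiv ℝ (covAlong Γ f X b) z a +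
      Γ (f z) (fderiv ℝ f z a) (fderiv ℝ X z b + Γ (f z) (fderiv ℝ f z b) (X z)) :=
    fun a b ↦ rfl
  rw [e1, e1, key, key, fderiv_fderiv_comm hf a b, fderiv_fderiv_comm hX a b, curvForm,
    map_add, map_add]
  abel

theorem covAlong_congr {Γ : E → E →L[ℝ] E →L[ℝ] E} {f X Y : P → E} {z : P}
    (h : X =ᶠ[𝓝 z] Y) (a : P) : covAlong Γ f X a z = covAlong Γ f Y a z := by
  simp only [covAlong]
  rw [h.fderiv_eq, h.eq_of_nhds]

theorem covAlong_smul {Γ : E → E →L[ℝ] E →L[ℝ] E} {f X : P → E} {φ : P → ℝ} {z : P}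
    (hφ : DifferentiableAt ℝ φ z) (hX : DifferentiableAt ℝ X z) (a : P) :
    covAlong Γ f (fun x ↦ φ x • X x) a z = fderiv ℝ φ z a • X z + φ z • covAlong Γ f X a z := by
  simp only [covAlong]
  rw [fderiv_fun_smul hφ hX]
  simp
  abel

/-- The transformation behaviour of covariant derivatives under an isometry `Φ`. -/
theorem fderiv_covAlong {E' : Type*} [NormedAddCommGroup E'] [NormedSpace ℝ E']
    {G : E → E →L[ℝ] E →L[ℝ] ℝ} {Γ : E → E →L[ℝ] E →L[ℝ] E}
    {G' : E' → E' →L[ℝ] E' →L[ℝ] ℝ} {Γ' : E' → E' →L[ℝ] E' →L[ℝ] E'} {Φ : E → E'} {y : E}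
    (hG : DifferentiableAt ℝ G y) (hG' : DifferentiableAt ℝ G' (Φ y))
    (hGsymm : ∀ v w, G' (Φ y) v w = G' (Φ y) w v)
    (hLC : IsLeviCivitaAt G Γ y) (hLC' : IsLeviCivitaAt G' Γ' (Φ y)) (hΦ : ContDiffAt ℝ 2 Φ y)
    (hiso : ∀ᶠ x in 𝓝 y, ∀ v w, G' (Φ x) (fderiv ℝ Φ x v) (fderiv ℝ Φ x w) = G x v w)
    (hsurj : Function.Surjective (fderiv ℝ Φ y))
    (hnd : ∀ v, (∀ w, G' (Φ y) v w = 0) → v = 0)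
    (v w : E) :
    fderiv ℝ Φ y (Γ y v w) =
      fderiv ℝ (fderiv ℝ Φ) y v w + Γ' (Φ y) (fderiv ℝ Φ y v) (fderiv ℝ Φ y w) := by
  have hΦ1 := hΦ.differentiableAt (by norm_num)
  have key : ∀ u v w, G y (Γ y u v) w + G y v (Γ y u w) =
      G' (Φ y) (Γ' (Φ y) (fderiv ℝ Φ y u) (fderiv ℝ Φ y v)) (fderiv ℝ Φ y w) +
      G' (Φ y) (fderiv ℝ Φ y v) (Γ' (Φ y) (fderiv ℝ Φ y u) (fderiv ℝ Φ y w)) +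
      G' (Φ y) (fderiv ℝ (fderiv ℝ Φ) y u v) (fderiv ℝ Φ y w) +
      G' (Φ y) (fderiv ℝ Φ y v) (fderiv ℝ (fderiv ℝ Φ) y u w) := by
    intro u v w
    have h1 : fderiv ℝ (fun x ↦ G' (Φ x) (fderiv ℝ Φ x v) (fderiv ℝ Φ x w)) y u =
        fderiv ℝ (fun x ↦ G x v w) y u := by
      have : (fun x ↦ G' (Φ x) (fderiv ℝ Φ x v) (fderiv ℝ Φ x w)) =ᶠ[𝓝 y] fun x ↦ G x v w :=
        hiso.mono fun x hx ↦ hx v w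
      rw [this.fderiv_eq]
    rw [(hasFDerivAt_bilin_comp hG' hΦ1 (differentiableAt_fderiv_apply hΦ v).1
      (differentiableAt_fderiv_apply hΦ w).1).2 u, (differentiableAt_fderiv_apply hΦ v).2,
      (differentiableAt_fderiv_apply hΦ w).2, hLC'.compat,
      (hasFDerivAt_bilin_comp (f := fun x ↦ x) (X := fun _ ↦ v) (Y := fun _ ↦ w) hG
      differentiableAt_fun_id (differentiableAt_const v) (differentiableAt_const w)).2 u] at h1
    simp [hLC.compat] at h1
    linarith
  have hiso0 : ∀ v w, G' (Φ y) (fderiv ℝ Φ y v) (fderiv ℝ Φ y w) = G y v w := hiso.self_of_nhds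
  have hGs : ∀ v w, G y v w = G y w v := fun v w ↦ by rw [← hiso0, ← hiso0, hGsymm]
  rw [← sub_eq_zero]
  refine hnd _ fun u' ↦ ?_
  obtain ⟨u, rfl⟩ := hsurj u'
  -- The Koszul argument: `k1 + k2 - k3` leaves twice the pairing of `Γ y v w` with `u`, since all
  -- other connection terms and all other second derivatives of `Φ` cancel by symmetry.
  have k1 := key v w u
  have k2 := key w v u
  have k3 := key u v w
  rw [map_sub, map_add, sub_apply, add_apply, hiso0]
  rw [hLC.symm w v, hLC.symm w u, hLC'.symm _ (fderiv ℝ Φ y v), fderiv_fderiv_comm hΦ w v,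
    fderiv_fderiv_comm hΦ w u, hLC'.symm (fderiv ℝ Φ y w)] at k2
  rw [hLC.symm v u, fderiv_fderiv_comm hΦ v u, hLC'.symm _ (fderiv ℝ Φ y u)] at k1
  have a1 := hGs w (Γ y u v)
  have a2 := hGs v (Γ y u w)
  have b1 := hGsymm (fderiv ℝ Φ y w) (fderiv ℝ (fderiv ℝ Φ) y u v)
  have c1 := hGsymm (fderiv ℝ Φ y w) (Γ' (Φ y) (fderiv ℝ Φ y u) (fderiv ℝ Φ y v))
  linarith

/-! ### Evolution of normal, metric and second fundamental form under a normal flow. -/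

section NormalFlow

variable {X : Type*} [NormedAddCommGroup X] [NormedSpace ℝ X]
  {G : E → E →L[ℝ] E →L[ℝ] ℝ} {Γ : E → E →L[ℝ] E →L[ℝ] E}
  {f ν : X × ℝ → E} {φ : X × ℝ → ℝ} {z : X × ℝ}

/-- `f` moves at `z` with speed `φ` in the direction of the timelike unit normal `ν`. -/
structure IsNormalFlowAt (G : E → E →L[ℝ] E →L[ℝ] ℝ) (Γ : E → E →L[ℝ] E →L[ℝ] E)
    (f ν : X × ℝ → E) (φ : X × ℝ → ℝ) (z : X × ℝ) : Prop where
  smooth : ContDiffAt ℝ ∞ f z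
  smooth_normal : ContDiffAt ℝ ∞ ν z
  smooth_speed : ContDiffAt ℝ ∞ φ z
  metric : DifferentiableAt ℝ G (f z)
  connection : DifferentiableAt ℝ Γ (f z)
  leviCivita : IsLeviCivitaAt G Γ (f z)
  metric_symm : ∀ u v, G (f z) u v = G (f z) v u
  normal_self : G (f z) (ν z) (ν z) = -1
  normal_tangent : ∀ v : X, G (f z) (ν z) (fderiv ℝ f z (v, 0)) = 0
  evolution : fderiv ℝ f z (0, 1) = φ z • ν z

namespace IsNormalFlowAt

theorem diff (h : IsNormalFlowAt G Γ f ν φ z) : DifferentiableAt ℝ f z :=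
  h.smooth.differentiableAt (by simp)

theorem diff_normal (h : IsNormalFlowAt G Γ f ν φ z) : DifferentiableAt ℝ ν z :=
  h.smooth_normal.differentiableAt (by simp)

theorem diff_speed (h : IsNormalFlowAt G Γ f ν φ z) : DifferentiableAt ℝ φ z :=
  h.smooth_speed.differentiableAt (by simp)

theorem smooth_two (h : IsNormalFlowAt G Γ f ν φ z) : ContDiffAt ℝ 2 f z :=
  h.smooth.of_le (WithTop.coe_le_coe.2 (le_top : (2 : ℕ∞) ≤ ⊤))

theorem smooth_normal_two (h : IsNormalFlowAt G Γ f ν φ z) : ContDiffAt ℝ 2 ν z :=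
  h.smooth_normal.of_le (WithTop.coe_le_coe.2 (le_top : (2 : ℕ∞) ≤ ⊤))

theorem smooth_speed_two (h : IsNormalFlowAt G Γ f ν φ z) : ContDiffAt ℝ 2 φ z :=
  h.smooth_speed.of_le (WithTop.coe_le_coe.2 (le_top : (2 : ℕ∞) ≤ ⊤))

theorem fderiv_metric (h : IsNormalFlowAt G Γ f ν φ z) {Y Z : X × ℝ → E}
    (hY : DifferentiableAt ℝ Y z) (hZ : DifferentiableAt ℝ Z z) (a : X × ℝ) :
    fderiv ℝ (fun x ↦ G (f x) (Y x) (Z x)) z a =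
      G (f z) (covAlong Γ f Y a z) (Z z) + G (f z) (Y z) (covAlong Γ f Z a z) :=
  fderiv_metric_comp h.leviCivita h.metric h.diff hY hZ a

theorem normal_covAlong (h : ∀ᶠ x in 𝓝 z, IsNormalFlowAt G Γ f ν φ x) (a : X × ℝ) :
    G (f z) (ν z) (covAlong Γ f ν a z) = 0 := by
  have hz := h.self_of_nhds
  have h1 := hz.fderiv_metric hz.diff_normal hz.diff_normal a
  have h2 : (fun x ↦ G (f x) (ν x) (ν x)) =ᶠ[𝓝 z] fun _ ↦ (-1 : ℝ) :=
    h.mono fun x hx ↦ hx.normal_self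
  rw [h2.fderiv_eq, hz.metric_symm (covAlong Γ f ν a z)] at h1
  simp at h1
  linarith

/-- Torsion-freeness exchanges the time and space derivatives, and the time derivative of `f` is `φ
ν`. -/
theorem covAlong_time_tangent (h : ∀ᶠ x in 𝓝 z, IsNormalFlowAt G Γ f ν φ x) (w : X) :
    covAlong Γ f (fun x ↦ fderiv ℝ f x (w, 0)) (0, 1) z =
      fderiv ℝ φ z (w, 0) • ν z + φ z • covAlong Γ f ν (w, 0) z := by
  have hz := h.self_of_nhds
  rw [covAlong_fderiv_comm hz.leviCivita hz.smooth_two,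
    covAlong_congr (h.mono fun x hx ↦ hx.evolution),
    covAlong_smul hz.diff_speed hz.diff_normal]

/-- Differentiate the orthogonality of `ν` and the tangent vector in time; the sign comes from `ν`
being timelike. Together with `normal_covAlong` it identifies `∇_t ν` with the gradient of `φ`. -/
theorem covAlong_time_normal (h : ∀ᶠ x in 𝓝 z, IsNormalFlowAt G Γ f ν φ x) (w : X) :
    G (f z) (covAlong Γ f ν (0, 1) z) (fderiv ℝ f z (w, 0)) = fderiv ℝ φ z (w, 0) := by
  have hz := h.self_of_nhds
  have h1 := hz.fderiv_metric hz.diff_normal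
    (differentiableAt_fderiv_apply hz.smooth_two (w, 0)).1 (0, 1)
  have h2 : (fun x ↦ G (f x) (ν x) (fderiv ℝ f x (w, 0))) =ᶠ[𝓝 z] fun _ ↦ (0 : ℝ) :=
    h.mono fun x hx ↦ hx.normal_tangent w
  rw [h2.fderiv_eq, covAlong_time_tangent h] at h1
  simp [normal_covAlong h, hz.normal_self] at h1
  linarith

/-- Symmetry of the second fundamental form: by orthogonality it is minus the normal component of
`∇_v ∂_w f`, which is symmetric in `v` and `w`. This makes the Weingarten map self-adjoint. -/
theorem normal_covAlong_tangent (h : ∀ᶠ x in 𝓝 z, IsNormalFlowAt G Γ f ν φ x) (v w : X) :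
    G (f z) (covAlong Γ f ν (v, 0) z) (fderiv ℝ f z (w, 0)) =
      G (f z) (covAlong Γ f ν (w, 0) z) (fderiv ℝ f z (v, 0)) := by
  have hz := h.self_of_nhds
  have key : ∀ v w : X, G (f z) (covAlong Γ f ν (v, 0) z) (fderiv ℝ f z (w, 0)) =
      -G (f z) (ν z) (covAlong Γ f (fun x ↦ fderiv ℝ f x (w, 0)) (v, 0) z) := by
    intro v w
    have h1 := hz.fderiv_metric hz.diff_normal
      (differentiableAt_fderiv_apply hz.smooth_two (w, 0)).1 (v, 0)
    have h2 : (fun x ↦ G (f x) (ν x) (fderiv ℝ f x (w, 0))) =ᶠ[𝓝 z] fun _ ↦ (0 : ℝ) :=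
      h.mono fun x hx ↦ hx.normal_tangent w
    rw [h2.fderiv_eq] at h1
    simp at h1
    linarith
  rw [key v w, key w v, covAlong_fderiv_comm hz.leviCivita hz.smooth_two]

theorem covAlong_time_normal_eq_zero (h : ∀ᶠ x in 𝓝 z, IsNormalFlowAt G Γ f ν φ x)
    (hcrit : ∀ v : X, fderiv ℝ φ z (v, 0) = 0)
    (hnd : ∀ u, G (f z) u (ν z) = 0 → (∀ v : X, G (f z) u (fderiv ℝ f z (v, 0)) = 0) → u = 0) :
    covAlong Γ f ν (0, 1) z = 0 := by
  refine hnd _ ?_ fun v ↦ ?_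
  · rw [h.self_of_nhds.metric_symm, normal_covAlong h]
  · rw [covAlong_time_normal h, hcrit]

/-- The evolution of the induced metric at a critical point of the speed. -/
theorem fderiv_gram (h : ∀ᶠ x in 𝓝 z, IsNormalFlowAt G Γ f ν φ x)
    (hcrit : ∀ v : X, fderiv ℝ φ z (v, 0) = 0) {v : X} {l : ℝ}
    (hv : covAlong Γ f ν (v, 0) z = l • fderiv ℝ f z (v, 0)) :
    fderiv ℝ (fun x ↦ G (f x) (fderiv ℝ f x (v, 0)) (fderiv ℝ f x (v, 0))) z (0, 1) =
      2 * φ z * l * G (f z) (fderiv ℝ f z (v, 0)) (fderiv ℝ f z (v, 0)) := by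
  have hz := h.self_of_nhds
  have hd := (differentiableAt_fderiv_apply hz.smooth_two (v, 0)).1
  rw [hz.fderiv_metric hd hd, covAlong_time_tangent h, hcrit, hv]
  simp
  ring

/-- The evolution of the second fundamental form at a critical point of the speed. -/
theorem fderiv_secondForm (h : ∀ᶠ x in 𝓝 z, IsNormalFlowAt G Γ f ν φ x)
    (hcrit : ∀ v : X, fderiv ℝ φ z (v, 0) = 0)
    (hnd : ∀ u, G (f z) u (ν z) = 0 → (∀ v : X, G (f z) u (fderiv ℝ f z (v, 0)) = 0) → u = 0)
    {v : X} {l : ℝ} (hv : covAlong Γ f ν (v, 0) z = l • fderiv ℝ f z (v, 0)) :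
    fderiv ℝ (fun x ↦ G (f x) (covAlong Γ f ν (v, 0) x) (fderiv ℝ f x (v, 0))) z (0, 1) =
      fderiv ℝ (fderiv ℝ φ) z (v, 0) (v, 0)
        + φ z * G (f z) (curvForm Γ (f z) (ν z) (fderiv ℝ f z (v, 0)) (ν z))
          (fderiv ℝ f z (v, 0))
        + φ z * l ^ 2 * G (f z) (fderiv ℝ f z (v, 0)) (fderiv ℝ f z (v, 0)) := by
  have hz := h.self_of_nhds
  have hd := (differentiableAt_fderiv_apply hz.smooth_two (v, 0)).1
  have hc := fun a ↦ differentiableAt_covAlong hz.connection hz.smooth_two hz.smooth_normal_two a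
  have h0 := covAlong_time_normal_eq_zero h hcrit hnd
  have h1 := hz.fderiv_metric (hc (0, 1)) hd (v, 0)
  -- This identity holds near `z`, not only at the critical point, so it may be differentiated in
  -- space; that produces the second derivative of `φ`.
  have h2 : (fun x ↦ G (f x) (covAlong Γ f ν (0, 1) x) (fderiv ℝ f x (v, 0))) =ᶠ[𝓝 z]
      fun x ↦ fderiv ℝ φ x (v, 0) :=
    h.eventually_nhds.mono fun x hx ↦ covAlong_time_normal hx v
  rw [h2.fderiv_eq, (differentiableAt_fderiv_apply hz.smooth_speed_two (v, 0)).2, h0] at h1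
  -- Exchanging `∇_t` and `∇_v` on `ν` costs the curvature term.
  have h3 := covAlong_comm hz.connection hz.smooth_two hz.smooth_normal_two (0, 1) (v, 0)
  rw [hz.evolution, sub_eq_iff_eq_add] at h3
  have h4 : curvForm Γ (f z) (φ z • ν z) (fderiv ℝ f z (v, 0)) (ν z) =
      φ z • curvForm Γ (f z) (ν z) (fderiv ℝ f z (v, 0)) (ν z) := by
    simp [curvForm, smul_sub, smul_add]
  rw [hz.fderiv_metric (hc (v, 0)) hd, h3, h4, covAlong_time_tangent h, hcrit, hv, h1]
  simp
  ring

end IsNormalFlowAt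

end NormalFlow

end LocalCalculus

/-! ### Eigenvalues, arctangents and determinants. -/

section LinearAlgebra

open Module

/-- A self-adjoint operator has an orthonormal basis of eigenvectors. -/
theorem exists_orthonormal_eigenbasis {V : Type*} [AddCommGroup V] [Module ℝ V]
    [FiniteDimensional ℝ V] {n : ℕ} (hn : finrank ℝ V = n) (B : V →ₗ[ℝ] V →ₗ[ℝ] ℝ)
    (hsymm : ∀ v w, B v w = B w v) (hpos : ∀ v, v ≠ 0 → 0 < B v v)
    (W : V →ₗ[ℝ] V) (hW : ∀ v w, B (W v) w = B v (W w)) :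
    ∃ (b : Basis (Fin n) ℝ V) (l : Fin n → ℝ),
      (∀ i j, B (b i) (b j) = if i = j then 1 else 0) ∧ ∀ i, W (b i) = l i • b i := by
  -- The form `B` itself is made the inner product, so that the spectral theorem applies to `W`.
  let core : InnerProductSpace.Core ℝ V :=
    { inner := fun v w ↦ B v w
      conj_inner_symm := fun v w ↦ hsymm w v
      re_inner_nonneg := fun v ↦ by
        by_cases h : v = 0
        · simp [h]
        · exact (hpos v h).le
      add_left := fun u v w ↦ by simp
      smul_left := fun v w r ↦ by simp
      definite := fun v h ↦ by
        by_contra h'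
        exact (hpos v h').ne' h }
  let _ : NormedAddCommGroup V := core.toNormedAddCommGroup
  let _ : InnerProductSpace ℝ V := InnerProductSpace.ofCore core.toCore
  have hsa : W.IsSymmetric := fun v w ↦ hW v w
  refine ⟨(hsa.eigenvectorBasis hn).toBasis, hsa.eigenvalues hn, fun i j ↦ ?_, fun i ↦ ?_⟩
  · have := orthonormal_iff_ite.1 (hsa.eigenvectorBasis hn).orthonormal i j
    simp only [OrthonormalBasis.coe_toBasis]
    exact this
  · simp only [OrthonormalBasis.coe_toBasis]
    exact hsa.apply_eigenvectorBasis hn i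

theorem charpoly_roots_of_eigenbasis {V : Type*} [AddCommGroup V] [Module ℝ V]
    [FiniteDimensional ℝ V] {n : ℕ} (W : V →ₗ[ℝ] V) (b : Basis (Fin n) ℝ V) (l : Fin n → ℝ)
    (hl : ∀ i, W (b i) = l i • b i) :
    W.charpoly.roots = (Finset.univ : Finset (Fin n)).val.map l := by
  have h1 : LinearMap.toMatrix b b W = Matrix.diagonal l := by
    ext i j
    rw [LinearMap.toMatrix_apply, hl]
    by_cases h : i = j
    · subst h; simp
    · simp [Matrix.diagonal_apply_ne _ h, Ne.symm h]
  rw [← LinearMap.charpoly_toMatrix W b, h1, Matrix.charpoly_diagonal]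
  have h2 : ∏ i, (Polynomial.X - Polynomial.C (l i)) = (Multiset.map
      (fun a ↦ Polynomial.X - Polynomial.C a) ((Finset.univ : Finset (Fin n)).val.map l)).prod := by
    rw [Multiset.map_map]
    rfl
  rw [h2, Polynomial.roots_multiset_prod_X_sub_C]

/-- The polar form of a complex number with real part one. -/
theorem one_add_mul_I_eq (x : ℝ) :
    (1 + x * Complex.I : ℂ) = (√(1 + x ^ 2) : ℝ) * Complex.exp (Real.arctan x * Complex.I) := by
  have h : √(1 + x ^ 2) ≠ 0 := (Real.sqrt_pos.2 (by positivity)).ne'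
  rw [Complex.exp_mul_I, ← Complex.ofReal_cos, ← Complex.ofReal_sin, Real.cos_arctan,
    Real.sin_arctan]
  apply Complex.ext <;> simp <;> field_simp

/-- The sum of the arctangents of the eigenvalues as the argument of a determinant. -/
theorem det_add_I_mul_eq {V : Type*} [AddCommGroup V] [Module ℝ V]
    [FiniteDimensional ℝ V] {n : ℕ} (B : V →ₗ[ℝ] V →ₗ[ℝ] ℝ)
    (hsymm : ∀ v w, B v w = B w v) (hpos : ∀ v, v ≠ 0 → 0 < B v v)
    (W : V →ₗ[ℝ] V) (hW : ∀ v w, B (W v) w = B v (W w)) (b : Basis (Fin n) ℝ V) (s : ℝ) :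
    ∃ r : ℝ, 0 < r ∧
      (Matrix.of fun i j ↦ (B (b i) (b j) + (B (W (b i)) (b j) / s : ℝ) * Complex.I : ℂ)).det =
        r * Complex.exp ((W.charpoly.roots.map fun x ↦ Real.arctan (x / s)).sum * Complex.I) := by
  obtain ⟨e, l, he, hl⟩ := exists_orthonormal_eigenbasis
    (by rw [finrank_eq_card_basis b, Fintype.card_fin]) B hsymm hpos W hW
  set A : Matrix (Fin n) (Fin n) ℝ := e.toMatrix b with hA
  have hdet : A.det ≠ 0 := by
    have h1 : A * b.toMatrix e = 1 := e.toMatrix_mul_toMatrix_flip b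
    intro h0
    have := congrArg Matrix.det h1
    rw [Matrix.det_mul, h0] at this
    simp at this
  have hb : ∀ i, b i = ∑ k, A k i • e k := fun i ↦ by
    exact (e.sum_repr (b i)).symm
  have hB1 : ∀ i j, B (b i) (b j) = ∑ k, A k i * A k j := by
    intro i j
    rw [hb i, hb j]
    simp [he, mul_comm]
  have hB2 : ∀ i j, B (W (b i)) (b j) = ∑ k, l k * (A k i * A k j) := by
    intro i j
    rw [hb i, hb j]
    simp [he, hl]
    exact Finset.sum_congr rfl fun k _ ↦ by ring
  -- In the eigenbasis `e` the complex matrix is diagonal with entries `1 + i l_k / s`. Passing to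
  -- `b` is a real congruence, which multiplies the determinant by the positive number `A.det ^ 2`.
  have hfac : (Matrix.of fun i j ↦
      (B (b i) (b j) + (B (W (b i)) (b j) / s : ℝ) * Complex.I : ℂ)) =
      (A.map Complex.ofReal).transpose *
        Matrix.diagonal (fun k ↦ (1 + (l k / s : ℝ) * Complex.I : ℂ)) * A.map Complex.ofReal := by
    ext i j
    rw [Matrix.mul_apply]
    simp only [Matrix.of_apply, Matrix.mul_diagonal, Matrix.transpose_apply, Matrix.map_apply,
      hB1, hB2]
    push_cast
    rw [Finset.sum_div, Finset.sum_mul, ← Finset.sum_add_distrib]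
    exact Finset.sum_congr rfl fun k _ ↦ by ring
  have hdetA : (A.map Complex.ofReal).det = (A.det : ℂ) :=
    (RingHom.map_det Complex.ofRealHom A).symm
  refine ⟨A.det ^ 2 * ∏ k, √(1 + (l k / s) ^ 2), ?_, ?_⟩
  · have : ∀ k, 0 < √(1 + (l k / s) ^ 2) := fun k ↦ Real.sqrt_pos.2 (by positivity)
    exact mul_pos (by positivity) (Finset.prod_pos fun k _ ↦ this k)
  · rw [hfac, Matrix.det_mul, Matrix.det_mul, Matrix.det_transpose, Matrix.det_diagonal, hdetA,
      charpoly_roots_of_eigenbasis W e l hl, Multiset.map_map]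
    have : ∀ k, (1 + (l k / s : ℝ) * Complex.I : ℂ) = (√(1 + (l k / s) ^ 2) : ℝ) *
        Complex.exp (Real.arctan (l k / s) * Complex.I) := fun k ↦ one_add_mul_I_eq _
    simp only [this, Finset.prod_mul_distrib]
    rw [← Complex.exp_sum, ← Finset.sum_mul]
    have h2 : (Multiset.map ((fun x ↦ Real.arctan (x / s)) ∘ l)
        (Finset.univ : Finset (Fin n)).val).sum = ∑ k, Real.arctan (l k / s) := rfl
    rw [h2]
    push_cast
    ring

/-- In the differentiated Leibniz formula only the identity permutation contributes: for any other
one, every product with one factor removed still contains an off-diagonal entry of a diagonal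
matrix. -/
theorem hasDerivAt_det_of_eq_diagonal {n : ℕ} {A : ℝ → Matrix (Fin n) (Fin n) ℂ}
    {A' : Matrix (Fin n) (Fin n) ℂ} {t : ℝ} {d : Fin n → ℂ}
    (hA : ∀ i j, HasDerivAt (fun x ↦ A x i j) (A' i j) t) (hd : A t = Matrix.diagonal d)
    (hne : ∀ i, d i ≠ 0) :
    HasDerivAt (fun x ↦ (A x).det) ((∏ i, d i) * ∑ i, A' i i / d i) t := by
  have h1 : ∀ σ : Equiv.Perm (Fin n), HasDerivAt
      (fun x ↦ ((Equiv.Perm.sign σ : ℤ) : ℂ) * ∏ i, A x (σ i) i)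
      (((Equiv.Perm.sign σ : ℤ) : ℂ) *
        ∑ i, (∏ j ∈ Finset.univ.erase i, A t (σ j) j) • A' (σ i) i) t :=
    fun σ ↦ (HasDerivAt.fun_finsetProd fun i _ ↦ hA (σ i) i).const_mul _
  have h2 := HasDerivAt.fun_sum (u := Finset.univ) fun σ _ ↦ h1 σ
  simp only [Matrix.det_apply']
  refine h2.congr_deriv ?_
  symm
  rw [Finset.sum_eq_single (1 : Equiv.Perm (Fin n))]
  · simp only [Equiv.Perm.sign_one, Units.val_one, Int.cast_one, one_mul, Equiv.Perm.coe_one, id,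
      hd, Matrix.diagonal_apply_eq, smul_eq_mul]
    rw [Finset.mul_sum]
    refine Finset.sum_congr rfl fun i _ ↦ ?_
    rw [← Finset.mul_prod_erase _ _ (Finset.mem_univ i)]
    field_simp [hne i]
  · intro σ _ hσ
    refine mul_eq_zero_of_right _ (Finset.sum_eq_zero fun i _ ↦ ?_)
    -- A permutation other than the identity moves at least two points, hence some point other than
    -- `i`.
    have : ∃ j, j ≠ i ∧ σ j ≠ j := by
      by_contra! hall
      apply hσ
      ext j
      by_cases hj : j = i
      · subst hj
        by_contra hne'
        have hσj : σ j ≠ j := fun h ↦ hne' (by rw [h]; rfl)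
        exact hσj (σ.injective (hall _ hσj))
      · rw [hall j hj]; rfl
    obtain ⟨j, hji, hj⟩ := this
    rw [Finset.prod_eq_zero (Finset.mem_erase.2 ⟨hji, Finset.mem_univ j⟩), zero_smul]
    rw [hd, Matrix.diagonal_apply_ne _ hj]
  · simp

end LinearAlgebra

/-! ### Derivatives of arguments, extrema, and the evolution of the angle. -/

section Calculus

open Filter Topology

/-- Since `D e^{-iθ}` is real near `t`, its derivative has imaginary part zero. No logarithm is
taken, and `r` need not be continuous. -/
theorem deriv_arg_eq_im_div {D : ℝ → ℂ} {θ r : ℝ → ℝ} {D' : ℂ} {θ' t : ℝ}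
    (h : ∀ᶠ x in 𝓝 t, 0 < r x ∧ D x = r x * Complex.exp (θ x * Complex.I))
    (hD : HasDerivAt D D' t) (hθ : HasDerivAt θ θ' t) : θ' = (D' / D t).im := by
  have h1 : HasDerivAt (fun x ↦ Complex.exp (-(θ x * Complex.I)))
      (Complex.exp (-(θ t * Complex.I)) * -(θ' * Complex.I)) t :=
    ((hθ.ofReal_comp.mul_const Complex.I).neg).cexp
  have h2 := hD.mul h1
  have h3 : (fun x ↦ (D x * Complex.exp (-(θ x * Complex.I))).im) =ᶠ[𝓝 t] fun _ ↦ (0 : ℝ) := by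
    filter_upwards [h] with x hx
    rw [hx.2, mul_assoc, ← Complex.exp_add]
    simp
  have h4 := (Complex.imCLM.hasFDerivAt.comp_hasDerivAt t h2)
  have h5 := h4.unique ((hasDerivAt_const t (0 : ℝ)).congr_of_eventuallyEq h3)
  obtain ⟨hr, hDt⟩ := h.self_of_nhds
  have hexp : Complex.exp (-(θ t * Complex.I)) = r t / D t := by
    rw [hDt, Complex.exp_neg]
    field_simp [Complex.exp_ne_zero, hr.ne']
  have hDne : D t ≠ 0 := by
    rw [hDt]
    exact mul_ne_zero (by exact_mod_cast hr.ne') (Complex.exp_ne_zero _)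
  rw [hexp] at h5
  have h6 : D' * (r t / D t) + D t * (r t / D t * -(θ' * Complex.I)) =
      r t * (D' / D t - θ' * Complex.I) := by
    field_simp
    ring
  rw [h6] at h5
  simp [hr.ne'] at h5
  linarith

/-- A positive second derivative would make `t` a local minimum as well, so `q` would be locally
constant and its second derivative zero. -/
theorem deriv_deriv_nonpos_of_isLocalMax {q : ℝ → ℝ} {t : ℝ} (h : IsLocalMax q t)
    (hc : ContinuousAt q t) : deriv (deriv q) t ≤ 0 := by
  by_contra! hpos
  have h1 := isLocalMin_of_deriv_deriv_pos hpos h.deriv_eq_zero hc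
  have h2 : q =ᶠ[𝓝 t] fun _ ↦ q t := by
    filter_upwards [h, h1] with x hx hx'
    exact le_antisymm hx hx'
  have h3 : deriv q =ᶠ[𝓝 t] fun _ ↦ 0 := by
    filter_upwards [h2.eventually_nhds] with x hx
    have hx' : q =ᶠ[𝓝 x] fun _ ↦ q t := hx
    rw [hx'.deriv_eq]
    simp
  rw [h3.deriv_eq] at hpos
  simp at hpos

/-- Derivatives at a maximum in the first variable. -/
theorem fderiv_of_isLocalMax_fst {X : Type*} [NormedAddCommGroup X] [NormedSpace ℝ X]
    {φ : X × ℝ → ℝ} {z : X × ℝ} (hφ : ContDiffAt ℝ 2 φ z)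
    (hmax : ∀ᶠ x in 𝓝 z.1, φ (x, z.2) ≤ φ z) (v : X) :
    fderiv ℝ φ z (v, 0) = 0 ∧ fderiv ℝ (fderiv ℝ φ) z (v, 0) (v, 0) ≤ 0 := by
  -- Restriction to this line at fixed time reduces the claim to one variable.
  set c : ℝ → X × ℝ := fun s ↦ z + s • (v, (0 : ℝ)) with hc
  have hc0 : c 0 = z := by simp [hc]
  have hcd : ∀ s, HasDerivAt c (v, (0 : ℝ)) s := fun s ↦ by
    have := ((hasDerivAt_id s).smul_const (v, (0 : ℝ))).const_add z
    rw [one_smul] at this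
    exact this
  have hcc : Tendsto c (𝓝 0) (𝓝 z) := by
    have := (hcd 0).continuousAt.tendsto
    rwa [hc0] at this
  have hd : ∀ᶠ x in 𝓝 z, DifferentiableAt ℝ φ x := by
    filter_upwards [hφ.eventually (by simp)] with x hx using hx.differentiableAt (by norm_num)
  have h1 : ∀ᶠ s in 𝓝 (0 : ℝ), HasDerivAt (φ ∘ c) (fderiv ℝ φ (c s) (v, 0)) s := by
    filter_upwards [hcc.eventually hd] with s hs
    exact hs.hasFDerivAt.comp_hasDerivAt s (hcd s)
  have hloc : IsLocalMax (φ ∘ c) 0 := by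
    have : Tendsto (fun s ↦ (c s).1) (𝓝 0) (𝓝 z.1) :=
      (continuous_fst.tendsto z).comp hcc
    filter_upwards [this.eventually hmax] with s hs
    have hcs : c s = ((c s).1, z.2) := Prod.ext rfl (by simp [hc])
    rw [Function.comp_apply, Function.comp_apply, hc0, hcs]
    exact hs
  have h2 : deriv (φ ∘ c) =ᶠ[𝓝 0] fun s ↦ fderiv ℝ φ (c s) (v, 0) :=
    h1.mono fun s hs ↦ hs.deriv
  have h3 : HasDerivAt (fun s ↦ fderiv ℝ φ (c s) (v, 0))
      (fderiv ℝ (fderiv ℝ φ) z (v, 0) (v, 0)) 0 := by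
    have hfd := differentiableAt_fderiv_apply hφ (v, (0 : ℝ))
    rw [← hfd.2]
    have hz : HasFDerivAt (fun x ↦ fderiv ℝ φ x (v, 0))
      (fderiv ℝ (fun x ↦ fderiv ℝ φ x (v, 0)) z) (c 0) := by rw [hc0]; exact hfd.1.hasFDerivAt
    exact hz.comp_hasDerivAt 0 (hcd 0)
  constructor
  · have := hloc.deriv_eq_zero
    rw [h2.eq_of_nhds, hc0] at this
    exact this
  · have := deriv_deriv_nonpos_of_isLocalMax hloc h1.self_of_nhds.continuousAt
    rwa [h2.deriv_eq, h3.deriv] at this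

theorem im_add_mul_I_div (a c d : ℝ) :
    (((a : ℂ) + (c : ℝ) * Complex.I) / (1 + (d : ℝ) * Complex.I)).im =
      (c - a * d) / (1 + d ^ 2) := by
  rw [Complex.div_im]
  simp [Complex.normSq_apply]
  field_simp

/-- The cancellation behind the theorem: after subtracting `2 φ l²`, the reaction terms `-κ φ + φ
l²` become `-φ (κ + l²)`, an exact multiple of the denominator. Here `s = √κ`, and `q` stands for
the second derivative of the angle. -/
theorem im_div_eq_of_evolution {κ s φ l q : ℝ} (hs : 0 < s) (hκ : s ^ 2 = κ) :
    ((((2 * φ * l : ℝ) : ℂ) + ((q + φ * -κ + φ * l ^ 2) / s : ℝ) * Complex.I) /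
      (1 + (l / s : ℝ) * Complex.I)).im = s * (q / (κ + l ^ 2) - φ) := by
  have h1 : s ^ 2 + l ^ 2 ≠ 0 := by positivity
  rw [im_add_mul_I_div, ← hκ, div_pow, one_add_div (by positivity)]
  field_simp
  ring

/-- The evolution of the Lagrangian angle at a critical point. -/
theorem IsNormalFlowAt.exists_fderiv_angle_eq {E : Type*} [NormedAddCommGroup E]
    [NormedSpace ℝ E] {X : Type*} [NormedAddCommGroup X] [NormedSpace ℝ X]
    [FiniteDimensional ℝ X] {n : ℕ} (hn : Module.finrank ℝ X = n)
    {G : E → E →L[ℝ] E →L[ℝ] ℝ} {Γ : E → E →L[ℝ] E →L[ℝ] E}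
    {f ν : X × ℝ → E} {φ : X × ℝ → ℝ} {z : X × ℝ} {κ : ℝ} (hκ : 0 < κ)
    (h : ∀ᶠ x in 𝓝 z, IsNormalFlowAt G Γ f ν φ x)
    {W : X × ℝ → X →ₗ[ℝ] X}
    (hW : ∀ᶠ x in 𝓝 z, ∀ v : X, fderiv ℝ f x (W x v, 0) = covAlong Γ f ν (v, 0) x)
    (hpos : ∀ᶠ x in 𝓝 z, ∀ v : X, v ≠ 0 →
      0 < G (f x) (fderiv ℝ f x (v, 0)) (fderiv ℝ f x (v, 0)))
    (hφ : ∀ᶠ x in 𝓝 z, φ x =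
      1 / √κ * ((W x).charpoly.roots.map fun l ↦ Real.arctan (l / √κ)).sum)
    (hcrit : ∀ v : X, fderiv ℝ φ z (v, 0) = 0)
    (hnd : ∀ u, G (f z) u (ν z) = 0 → (∀ v : X, G (f z) u (fderiv ℝ f z (v, 0)) = 0) → u = 0)
    (hR : ∀ v : X, G (f z) (curvForm Γ (f z) (ν z) (fderiv ℝ f z (v, 0)) (ν z))
      (fderiv ℝ f z (v, 0)) = -κ * G (f z) (fderiv ℝ f z (v, 0)) (fderiv ℝ f z (v, 0))) :
    ∃ (b : Fin n → X) (l : Fin n → ℝ), fderiv ℝ φ z (0, 1) =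
      (∑ i, fderiv ℝ (fderiv ℝ φ) z (b i, 0) (b i, 0) / (κ + l i ^ 2)) - n * φ z := by
  have hz := h.self_of_nhds
  have hs : 0 < √κ := Real.sqrt_pos.2 hκ
  have hs2 : √κ ^ 2 = κ := Real.sq_sqrt hκ.le
  let B : X × ℝ → X →ₗ[ℝ] X →ₗ[ℝ] ℝ := fun x ↦ LinearMap.mk₂ ℝ
    (fun v w ↦ G (f x) (fderiv ℝ f x (v, 0)) (fderiv ℝ f x (w, 0)))
    (fun v v' w ↦ by
      rw [show ((v + v', 0) : X × ℝ) = (v, 0) + (v', 0) by simp, map_add, map_add, add_apply])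
    (fun c v w ↦ by
      rw [show ((c • v, 0) : X × ℝ) = c • (v, 0) by simp, map_smul, map_smul, smul_apply])
    (fun v w w' ↦ by
      rw [show ((w + w', 0) : X × ℝ) = (w, 0) + (w', 0) by simp, map_add, map_add])
    (fun c v w ↦ by
      rw [show ((c • w, 0) : X × ℝ) = c • (w, 0) by simp, map_smul, map_smul])
  have hB : ∀ x v w, B x v w = G (f x) (fderiv ℝ f x (v, 0)) (fderiv ℝ f x (w, 0)) :=
    fun _ _ _ ↦ rfl
  have hsa : ∀ᶠ x in 𝓝 z, ∀ v w, B x (W x v) w = B x v (W x w) := by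
    filter_upwards [h.eventually_nhds, hW] with x hx hWx v w
    rw [hB, hB, hWx, hWx, normal_covAlong_tangent hx, hx.self_of_nhds.metric_symm]
  have hBs : ∀ᶠ x in 𝓝 z, ∀ v w, B x v w = B x w v := by
    filter_upwards [h] with x hx v w
    exact hx.metric_symm _ _
  -- The basis diagonalises `W` at `z` only. Its vectors stay fixed in coordinates at the other
  -- points, so their metric coefficients vary.
  obtain ⟨b, l, hb, hl⟩ := exists_orthonormal_eigenbasis hn (B z) hBs.self_of_nhds
    hpos.self_of_nhds (W z) hsa.self_of_nhds
  refine ⟨b, l, ?_⟩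
  have hc : HasDerivAt (fun t : ℝ ↦ (z.1, t)) ((0, 1) : X × ℝ) z.2 :=
    (hasDerivAt_const z.2 z.1).prodMk (hasDerivAt_id z.2)
  have hct : Filter.Tendsto (fun t : ℝ ↦ (z.1, t)) (𝓝 z.2) (𝓝 z) := hc.continuousAt
  have hcd : ∀ {ψ : X × ℝ → ℝ}, DifferentiableAt ℝ ψ z →
      HasDerivAt (fun t ↦ ψ (z.1, t)) (fderiv ℝ ψ z (0, 1)) z.2 := fun {ψ} hψ ↦ by
    have : HasFDerivAt ψ (fderiv ℝ ψ z) (z.1, z.2) := hψ.hasFDerivAt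
    exact this.comp_hasDerivAt z.2 hc
  have hd := fun v : X ↦ (differentiableAt_fderiv_apply hz.smooth_two (v, 0)).1
  have hcv := fun v : X ↦
    differentiableAt_covAlong hz.connection hz.smooth_two hz.smooth_normal_two (v, (0 : ℝ))
  let gram : Fin n → Fin n → X × ℝ → ℝ := fun i j x ↦
    G (f x) (fderiv ℝ f x (b i, 0)) (fderiv ℝ f x (b j, 0))
  let sff : Fin n → Fin n → X × ℝ → ℝ := fun i j x ↦
    G (f x) (covAlong Γ f ν (b i, 0) x) (fderiv ℝ f x (b j, 0))
  have hgram : ∀ i j, DifferentiableAt ℝ (gram i j) z := fun i j ↦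
    (hasFDerivAt_bilin_comp hz.metric hz.diff (hd _) (hd _)).1
  have hsff : ∀ i j, DifferentiableAt ℝ (sff i j) z := fun i j ↦
    (hasFDerivAt_bilin_comp hz.metric hz.diff (hcv _) (hd _)).1
  let A : ℝ → Matrix (Fin n) (Fin n) ℂ := fun t ↦ Matrix.of fun i j ↦
    ((gram i j (z.1, t) : ℂ) + (sff i j (z.1, t) / √κ : ℝ) * Complex.I)
  have hA : ∀ i j, HasDerivAt (fun t ↦ A t i j)
      ((fderiv ℝ (gram i j) z (0, 1) : ℂ) +
        (fderiv ℝ (sff i j) z (0, 1) / √κ : ℝ) * Complex.I) z.2 := fun i j ↦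
    (hcd (hgram i j)).ofReal_comp.add
      (((hcd (hsff i j)).div_const _).ofReal_comp.mul_const Complex.I)
  have heig : ∀ i, covAlong Γ f ν (b i, 0) z = l i • fderiv ℝ f z (b i, 0) := fun i ↦ by
    rw [← hW.self_of_nhds, hl, ← (fderiv ℝ f z).map_smul]
    simp
  have hAd : A z.2 = Matrix.diagonal fun i ↦ (1 + (l i / √κ : ℝ) * Complex.I : ℂ) := by
    ext i j
    have h1 : gram i j z = if i = j then 1 else 0 := hb i j
    have h2 : sff i j z = if i = j then l i else 0 := by
      change G (f z) (covAlong Γ f ν (b i, 0) z) (fderiv ℝ f z (b j, 0)) = _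
      rw [heig, map_smul, smul_apply]
      change l i • gram i j z = _
      rw [h1]
      simp
    change (gram i j z : ℂ) + (sff i j z / √κ : ℝ) * Complex.I = _
    rw [h1, h2]
    by_cases hij : i = j
    · subst hij; simp
    · simp [hij]
  have hne : ∀ i, (1 + (l i / √κ : ℝ) * Complex.I : ℂ) ≠ 0 := fun i h0 ↦ by
    have := congrArg Complex.re h0
    simp at this
  have hdet := hasDerivAt_det_of_eq_diagonal (A' := Matrix.of fun i j ↦
    ((fderiv ℝ (gram i j) z (0, 1) : ℂ) +
        (fderiv ℝ (sff i j) z (0, 1) / √κ : ℝ) * Complex.I)) hA hAd hne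
  -- The determinant formula holds in any basis, hence in the fixed basis `b` at all points near
  -- `z`.
  have harg : ∀ᶠ x in 𝓝 z, ∃ r : ℝ, 0 < r ∧ (Matrix.of fun i j ↦
      ((gram i j x : ℂ) + (sff i j x / √κ : ℝ) * Complex.I)).det =
        r * Complex.exp ((√κ * φ x : ℝ) * Complex.I) := by
    filter_upwards [hW, hpos, hφ, hBs, hsa] with x h1 h2 h3 h4 h5
    obtain ⟨r, hr, h6⟩ := det_add_I_mul_eq (B x) h4 h2 (W x) h5 b (√κ)
    refine ⟨r, hr, ?_⟩
    simp only [hB, h1] at h6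
    rw [h3, ← mul_assoc, mul_one_div_cancel hs.ne', one_mul, ← h6]
  have harg' := hct.eventually harg
  classical
  -- The moduli are chosen separately at each time; their dependence on time is irrelevant.
  let r : ℝ → ℝ := fun t ↦ if h : ∃ r : ℝ, 0 < r ∧ (A t).det =
        r * Complex.exp ((√κ * φ (z.1, t) : ℝ) * Complex.I) then h.choose else 0
  have hr : ∀ᶠ t in 𝓝 z.2, 0 < r t ∧
      (A t).det = r t * Complex.exp ((√κ * φ (z.1, t) : ℝ) * Complex.I) := by
    filter_upwards [harg'] with t ht
    have : r t = Exists.choose ht := dif_pos ht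
    rw [this]
    exact ht.choose_spec
  have key := deriv_arg_eq_im_div hr hdet ((hcd hz.diff_speed).const_mul (√κ))
  rw [hAd, Matrix.det_diagonal, mul_div_cancel_left₀ _ (Finset.prod_ne_zero_iff.2 fun i _ ↦ hne i),
    Complex.im_sum] at key
  have hterm : ∀ i, ((Matrix.of fun i j ↦ ((fderiv ℝ (gram i j) z (0, 1) : ℂ) +
      (fderiv ℝ (sff i j) z (0, 1) / √κ : ℝ) * Complex.I)) i i /
      (1 + (l i / √κ : ℝ) * Complex.I)).im =
      √κ * (fderiv ℝ (fderiv ℝ φ) z (b i, 0) (b i, 0) / (κ + l i ^ 2) - φ z) := by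
    intro i
    have hbi : G (f z) (fderiv ℝ f z (b i, 0)) (fderiv ℝ f z (b i, 0)) = 1 := by
      rw [← hB, hb, if_pos rfl]
    rw [Matrix.of_apply, fderiv_gram h hcrit (heig i), fderiv_secondForm h hcrit hnd (heig i),
      hR, hbi, mul_one, mul_one, mul_one]
    exact im_div_eq_of_evolution hs hs2
  rw [Finset.sum_congr rfl fun i _ ↦ hterm i, ← Finset.mul_sum, Finset.sum_sub_distrib] at key
  have := mul_left_cancel₀ hs.ne' key
  simpa using this

end Calculus

/-! ### Differentials of charts and smoothness of coordinate fields. -/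

section Charts

open Filter Topology

variable {m : ℕ} {N : Type*} [TopologicalSpace N]
  [ChartedSpace (EuclideanSpace ℝ (Fin m)) N]

theorem mdifferentiable_of_mem_maximalAtlas
    {e : OpenPartialHomeomorph N (EuclideanSpace ℝ (Fin m))}
    (he : e ∈ IsManifold.maximalAtlas (𝓡 m) ∞ N) : e.MDifferentiable (𝓡 m) (𝓡 m) :=
  ⟨(contMDiffOn_of_mem_maximalAtlas he).mdifferentiableOn (by simp),
    (contMDiffOn_symm_of_mem_maximalAtlas he).mdifferentiableOn (by simp)⟩

variable {e : OpenPartialHomeomorph N (EuclideanSpace ℝ (Fin m))}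

theorem mfderiv_symm_mfderiv (he : e ∈ IsManifold.maximalAtlas (𝓡 m) ∞ N)
    {y : EuclideanSpace ℝ (Fin m)} (hy : y ∈ e.target) (v : TangentSpace (𝓡 m) (e.symm y)) :
    mfderiv (𝓡 m) (𝓡 m) e.symm y (mfderiv (𝓡 m) (𝓡 m) e (e.symm y) v) = v := by
  have h := (mdifferentiable_of_mem_maximalAtlas he).symm_comp_deriv (e.map_target hy)
  rw [e.right_inv hy] at h
  exact DFunLike.congr_fun h v

theorem mfderiv_mfderiv_symm (he : e ∈ IsManifold.maximalAtlas (𝓡 m) ∞ N)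
    {y : EuclideanSpace ℝ (Fin m)} (hy : y ∈ e.target) (v : EuclideanSpace ℝ (Fin m)) :
    mfderiv (𝓡 m) (𝓡 m) e (e.symm y) (mfderiv (𝓡 m) (𝓡 m) e.symm y v) = v :=
  DFunLike.congr_fun ((mdifferentiable_of_mem_maximalAtlas he).comp_symm_deriv hy) v

variable [IsManifold (𝓡 m) ∞ N]

theorem contMDiffAt_coordField (he : e ∈ IsManifold.maximalAtlas (𝓡 m) ∞ N)
    {y : EuclideanSpace ℝ (Fin m)} (hy : y ∈ e.target) (a : EuclideanSpace ℝ (Fin m)) :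
    ContMDiffAt (𝓡 m) (𝓡 m).tangent ∞ (fun x : EuclideanSpace ℝ (Fin m) ↦
      (⟨e.symm x, mfderiv (𝓡 m) (𝓡 m) e.symm x a⟩ : TangentBundle (𝓡 m) N)) y := by
  have h1 := (contMDiffOn_symm_of_mem_maximalAtlas he).contMDiffOn_tangentMapWithin
    (m := ∞) (by simp) e.open_target.uniqueMDiffOn
  have h2 : ContMDiffAt (𝓡 m) (𝓡 m).tangent ∞ (fun x : EuclideanSpace ℝ (Fin m) ↦
      (⟨x, a⟩ : TangentBundle (𝓡 m) (EuclideanSpace ℝ (Fin m)))) y := by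
    have := (contMDiffWithinAt_vectorSpace_iff_contDiffWithinAt
      (𝕜 := ℝ) (V := fun _ : EuclideanSpace ℝ (Fin m) ↦ a) (s := univ) (x := y) (n := ∞)).2
      contDiffWithinAt_const
    exact this.contMDiffAt univ_mem
  have h3 := (h1.contMDiffAt (x := (⟨y, a⟩ : TangentBundle (𝓡 m) (EuclideanSpace ℝ (Fin m))))
    ((e.open_target.preimage (FiberBundle.continuous_proj (EuclideanSpace ℝ (Fin m))
      (TangentSpace (𝓡 m)))).mem_nhds hy)).comp y h2
  refine h3.congr_of_eventuallyEq ?_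
  filter_upwards [e.open_target.mem_nhds hy] with x hx
  simp only [Function.comp, tangentMapWithin]
  rw [mfderivWithin_of_isOpen e.open_target hx]

theorem contDiffAt_fieldComponents (he : e ∈ IsManifold.maximalAtlas (𝓡 m) ∞ N)
    {X : ∀ q : N, TangentSpace (𝓡 m) q}
    (hX : ContMDiff (𝓡 m) (𝓡 m).tangent ∞ (fun q : N ↦ (⟨q, X q⟩ : TangentBundle (𝓡 m) N)))
    {y : EuclideanSpace ℝ (Fin m)} (hy : y ∈ e.target) :
    ContDiffAt ℝ ∞ (fun x : EuclideanSpace ℝ (Fin m) ↦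
      (mfderiv (𝓡 m) (𝓡 m) e (e.symm x) (X (e.symm x)) : EuclideanSpace ℝ (Fin m))) y := by
  have h1 := (contMDiffOn_of_mem_maximalAtlas he).contMDiffOn_tangentMapWithin
    (m := ∞) (by simp) e.open_source.uniqueMDiffOn
  have h2 := (hX.contMDiffAt (x := e.symm y)).comp y (contMDiffAt_symm_of_mem_maximalAtlas he hy)
  have h3 := (h1.contMDiffAt (x := (⟨e.symm y, X (e.symm y)⟩ : TangentBundle (𝓡 m) N))
    ((e.open_source.preimage (FiberBundle.continuous_proj (EuclideanSpace ℝ (Fin m))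
      (TangentSpace (𝓡 m)))).mem_nhds (e.map_target hy))).comp y h2
  have h4 := (contMDiff_snd_tangentBundle_modelSpace (EuclideanSpace ℝ (Fin m)) (𝓡 m)
    (n := ∞)).contMDiffAt.comp y h3
  refine h4.contDiffAt.congr_of_eventuallyEq ?_
  filter_upwards [e.open_target.mem_nhds hy] with x hx
  simp only [Function.comp, tangentMapWithin]
  rw [mfderivWithin_of_isOpen e.open_source (e.map_target hx)]

end Charts

/-! ### Smoothness of the metric coefficients. -/

section Metric

open Filter Topology

variable {n : ℕ} {N : Type*} [TopologicalSpace N]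
  [ChartedSpace (EuclideanSpace ℝ (Fin (n + 1))) N] [IsManifold (𝓡 (n + 1)) ∞ N]
  {g : LorentzMetric n N} {e : OpenPartialHomeomorph N (EuclideanSpace ℝ (Fin (n + 1)))}

theorem contDiffAt_metricMatrix (he : e ∈ IsManifold.maximalAtlas (𝓡 (n + 1)) ∞ N)
    {y : EuclideanSpace ℝ (Fin (n + 1))} (hy : y ∈ e.target) (α β : Fin (n + 1)) :
    ContDiffAt ℝ ∞ (fun x ↦ metricMatrix g e x α β) y := by
  have h1 := (g.contMDiff.contMDiffAt (x := e.symm y)).comp y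
    (contMDiffAt_symm_of_mem_maximalAtlas he hy)
  have h2 := ContMDiffAt.clm_bundle_apply₂ (F₃ := ℝ) (E₃ := fun _ : N ↦ ℝ)
    (b := fun x ↦ e.symm x) (ψ := fun x ↦ g.val (e.symm x)) h1
    (contMDiffAt_coordField he hy (EuclideanSpace.single α (1 : ℝ)))
    (contMDiffAt_coordField he hy (EuclideanSpace.single β (1 : ℝ)))
  have h3 := (Bundle.contMDiffAt_totalSpace.1 h2).2
  have h4 := h3.contDiffAt
  simp only at h4
  exact h4

end Metric

/-! ### Multilinear maps in the standard basis. -/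

section Coordinates

theorem sum_single_eq {k : ℕ} (v : EuclideanSpace ℝ (Fin k)) :
    ∑ α, v α • EuclideanSpace.single α (1 : ℝ) = v := by
  ext i
  simp [Pi.single_apply]

theorem bilin_comp_apply_eq_sum {k : ℕ}
    (B : EuclideanSpace ℝ (Fin k) →L[ℝ] EuclideanSpace ℝ (Fin k) →L[ℝ] ℝ)
    (A : EuclideanSpace ℝ (Fin k) →L[ℝ] EuclideanSpace ℝ (Fin k))
    (v w : EuclideanSpace ℝ (Fin k)) :
    B (A v) (A w) = ∑ α, ∑ β, B (A (EuclideanSpace.single α (1 : ℝ)))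
      (A (EuclideanSpace.single β (1 : ℝ))) * v α * w β := by
  conv_lhs => rw [← sum_single_eq v, ← sum_single_eq w]
  simp only [map_sum, map_smul, sum_apply, smul_apply, smul_eq_mul, Finset.mul_sum]
  rw [Finset.sum_comm]
  exact Finset.sum_congr rfl fun β _ ↦ Finset.sum_congr rfl fun α _ ↦ by ring

/-- A trilinear map that vanishes on the standard basis is zero. -/
theorem eq_zero_of_trilinear {k : ℕ}
    {t : EuclideanSpace ℝ (Fin k) → EuclideanSpace ℝ (Fin k) → EuclideanSpace ℝ (Fin k) → ℝ}
    (h1 : ∀ v w, IsLinearMap ℝ fun u ↦ t u v w) (h2 : ∀ u w, IsLinearMap ℝ fun v ↦ t u v w)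
    (h3 : ∀ u v, IsLinearMap ℝ fun w ↦ t u v w)
    (h : ∀ α β γ, t (EuclideanSpace.single α 1) (EuclideanSpace.single β 1)
      (EuclideanSpace.single γ 1) = 0) (u v w : EuclideanSpace ℝ (Fin k)) : t u v w = 0 := by
  have key : ∀ (l : EuclideanSpace ℝ (Fin k) → ℝ), IsLinearMap ℝ l →
      (∀ α, l (EuclideanSpace.single α 1) = 0) → ∀ u, l u = 0 := by
    intro l hl h0 u
    have h4 : hl.mk' l (∑ α, u α • EuclideanSpace.single α (1 : ℝ)) = 0 := by
      rw [map_sum]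
      refine Finset.sum_eq_zero fun α _ ↦ ?_
      rw [map_smul]
      have : hl.mk' l (EuclideanSpace.single α 1) = 0 := h0 α
      rw [this, smul_zero]
    rw [sum_single_eq] at h4
    exact h4
  exact key _ (h1 v w) (fun α ↦ key _ (h2 _ w) (fun β ↦ key _ (h3 _ _) (fun γ ↦ h α β γ) w) v) u

end Coordinates

/-! ### The metric and its Levi-Civita connection as forms on the model space. -/

section Metric

open Filter Topology

variable {n : ℕ} {N : Type*} [TopologicalSpace N]
  [ChartedSpace (EuclideanSpace ℝ (Fin (n + 1))) N] [IsManifold (𝓡 (n + 1)) ∞ N]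
  {g : LorentzMetric n N} {e : OpenPartialHomeomorph N (EuclideanSpace ℝ (Fin (n + 1)))}

/-- The metric in the chart `e` as a bilinear form on the model space. -/
def metricForm (g : LorentzMetric n N)
    (e : OpenPartialHomeomorph N (EuclideanSpace ℝ (Fin (n + 1))))
    (y : EuclideanSpace ℝ (Fin (n + 1))) :
    EuclideanSpace ℝ (Fin (n + 1)) →L[ℝ] EuclideanSpace ℝ (Fin (n + 1)) →L[ℝ] ℝ :=
  ∑ α, ∑ β, metricMatrix g e y α β •
    (EuclideanSpace.proj α : EuclideanSpace ℝ (Fin (n + 1)) →L[ℝ] ℝ).smulRight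
      (EuclideanSpace.proj β : EuclideanSpace ℝ (Fin (n + 1)) →L[ℝ] ℝ)

/-- The Levi-Civita connection in the chart `e` as a bilinear map on the model space. -/
def connectionForm (g : LorentzMetric n N)
    (e : OpenPartialHomeomorph N (EuclideanSpace ℝ (Fin (n + 1))))
    (y : EuclideanSpace ℝ (Fin (n + 1))) :
    EuclideanSpace ℝ (Fin (n + 1)) →L[ℝ] EuclideanSpace ℝ (Fin (n + 1)) →L[ℝ]
      EuclideanSpace ℝ (Fin (n + 1)) :=
  ∑ α, ∑ β, ∑ γ, christoffel g e α β γ y •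
    (EuclideanSpace.proj β : EuclideanSpace ℝ (Fin (n + 1)) →L[ℝ] ℝ).smulRight
      ((EuclideanSpace.proj γ : EuclideanSpace ℝ (Fin (n + 1)) →L[ℝ] ℝ).smulRight
        (EuclideanSpace.single α (1 : ℝ)))

theorem metricForm_apply (y v w : EuclideanSpace ℝ (Fin (n + 1))) :
    metricForm g e y v w = innerCoord g e y v w := by
  simp [metricForm, innerCoord, mul_assoc]

theorem metricForm_single (y : EuclideanSpace ℝ (Fin (n + 1))) (α β : Fin (n + 1)) :
    metricForm g e y (EuclideanSpace.single α 1) (EuclideanSpace.single β 1) =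
      metricMatrix g e y α β := by
  rw [metricForm_apply, innerCoord, Finset.sum_eq_single α, Finset.sum_eq_single β]
  · simp
  · intro b _ hb; simp [hb]
  · simp
  · intro b _ hb; simp [hb]
  · simp

theorem connectionForm_apply (y v w : EuclideanSpace ℝ (Fin (n + 1))) (α : Fin (n + 1)) :
    connectionForm g e y v w α = ∑ β, ∑ γ, christoffel g e α β γ y * v β * w γ := by
  simp only [connectionForm, sum_apply]
  simp only [WithLp.ofLp_sum, Finset.sum_apply]
  rw [Finset.sum_eq_single α]
  · simp [mul_assoc]
  · intro b _ hb
    simp [Ne.symm hb]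
  · simp

theorem connectionForm_single (y : EuclideanSpace ℝ (Fin (n + 1))) (α β γ : Fin (n + 1)) :
    connectionForm g e y (EuclideanSpace.single β 1) (EuclideanSpace.single γ 1) α =
      christoffel g e α β γ y := by
  rw [connectionForm_apply, Finset.sum_eq_single β, Finset.sum_eq_single γ]
  · simp
  · intro b _ hb; simp [hb]
  · simp
  · intro b _ hb; simp [hb]
  · simp

theorem metricForm_eq_val (y v w : EuclideanSpace ℝ (Fin (n + 1))) :
    metricForm g e y v w = g.val (e.symm y) (mfderiv (𝓡 (n + 1)) (𝓡 (n + 1)) e.symm y v)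
      (mfderiv (𝓡 (n + 1)) (𝓡 (n + 1)) e.symm y w) := by
  rw [metricForm_apply]
  exact (bilin_comp_apply_eq_sum (k := n + 1) (g.val (e.symm y))
    (mfderiv (𝓡 (n + 1)) (𝓡 (n + 1)) e.symm y) v w).symm

theorem metricForm_components (he : e ∈ IsManifold.maximalAtlas (𝓡 (n + 1)) ∞ N)
    {y : EuclideanSpace ℝ (Fin (n + 1))} (hy : y ∈ e.target)
    (v w : TangentSpace (𝓡 (n + 1)) (e.symm y)) :
    metricForm g e y (components e (e.symm y) v) (components e (e.symm y) w) =
      g.val (e.symm y) v w := by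
  rw [metricForm_eq_val]
  simp only [components]
  rw [mfderiv_symm_mfderiv he hy, mfderiv_symm_mfderiv he hy]

theorem metricForm_components_chart (he : e ∈ IsManifold.maximalAtlas (𝓡 (n + 1)) ∞ N)
    {q : N} (hq : q ∈ e.source) (v w : TangentSpace (𝓡 (n + 1)) q) :
    metricForm g e (e q) (components e q v) (components e q w) = g.val q v w := by
  obtain ⟨y, hy, rfl⟩ : ∃ y ∈ e.target, e.symm y = q := ⟨e q, e.map_source hq, e.left_inv hq⟩
  rw [e.right_inv hy]
  exact metricForm_components he hy v w

theorem metricForm_symm (y v w : EuclideanSpace ℝ (Fin (n + 1))) :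
    metricForm g e y v w = metricForm g e y w v := by
  rw [metricForm_eq_val, metricForm_eq_val, g.symm]

theorem metricMatrix_symm (y : EuclideanSpace ℝ (Fin (n + 1))) (α β : Fin (n + 1)) :
    metricMatrix g e y α β = metricMatrix g e y β α := by
  rw [← metricForm_single, ← metricForm_single, metricForm_symm]

theorem LorentzMetric.nondegenerate (g : LorentzMetric n N) {q : N}
    {v : TangentSpace (𝓡 (n + 1)) q} (h : ∀ w, g.val q v w = 0) : v = 0 := by
  obtain ⟨b, hb⟩ := g.signature q
  have h1 : ∀ j, b.repr v j = 0 := by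
    intro j
    have h2 := h (b j)
    rw [← b.sum_repr v] at h2
    simp only [map_sum, map_smul, sum_apply, smul_apply, smul_eq_mul,
      hb] at h2
    rw [Finset.sum_eq_single j] at h2
    · rcases mul_eq_zero.1 h2 with h3 | h3
      · exact h3
      · rw [if_pos rfl] at h3
        split_ifs at h3 <;> simp at h3
    · intro i _ hi
      simp [hi]
    · simp
  rw [← b.sum_repr v]
  simp [h1]

theorem metricForm_nondegenerate (he : e ∈ IsManifold.maximalAtlas (𝓡 (n + 1)) ∞ N)
    {y : EuclideanSpace ℝ (Fin (n + 1))} (hy : y ∈ e.target)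
    {v : EuclideanSpace ℝ (Fin (n + 1))} (h : ∀ w, metricForm g e y v w = 0) : v = 0 := by
  have h1 : mfderiv (𝓡 (n + 1)) (𝓡 (n + 1)) e.symm y v = 0 := by
    refine g.nondegenerate fun w ↦ ?_
    have := h (components e (e.symm y) w)
    rw [metricForm_eq_val] at this
    simp only [components] at this
    rwa [mfderiv_symm_mfderiv he hy] at this
  rw [← mfderiv_mfderiv_symm he hy v, h1, map_zero]
  rfl

theorem isUnit_det_metricMatrix (he : e ∈ IsManifold.maximalAtlas (𝓡 (n + 1)) ∞ N)
    {y : EuclideanSpace ℝ (Fin (n + 1))} (hy : y ∈ e.target) :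
    IsUnit (metricMatrix g e y).det := by
  rw [isUnit_iff_ne_zero]
  intro h0
  obtain ⟨v, hv, hv0⟩ := Matrix.exists_vecMul_eq_zero_iff.2 h0
  apply hv
  have h1 : (WithLp.toLp 2 v : EuclideanSpace ℝ (Fin (n + 1))) = 0 := by
    refine metricForm_nondegenerate (g := g) he hy fun w ↦ ?_
    rw [metricForm_apply, innerCoord, Finset.sum_comm]
    refine Finset.sum_eq_zero fun β _ ↦ ?_
    have h2 := congrFun hv0 β
    rw [Matrix.vecMul, dotProduct] at h2
    rw [← Finset.sum_mul]
    simp only [mul_comm (metricMatrix g e y _ _)]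
    rw [h2]
    simp
  simpa using congrArg WithLp.ofLp h1

theorem contDiffAt_smul_const {E F : Type*} [NormedAddCommGroup E] [NormedSpace ℝ E]
    [NormedAddCommGroup F] [NormedSpace ℝ F] {u : E → ℝ} {y : E} (h : ContDiffAt ℝ ∞ u y)
    (c : F) : ContDiffAt ℝ ∞ (fun x ↦ u x • c) y :=
  h.fun_smul contDiffAt_const

theorem contDiffAt_metricForm (he : e ∈ IsManifold.maximalAtlas (𝓡 (n + 1)) ∞ N)
    {y : EuclideanSpace ℝ (Fin (n + 1))} (hy : y ∈ e.target) :
    ContDiffAt ℝ ∞ (metricForm g e) y :=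
  ContDiffAt.sum fun α _ ↦ ContDiffAt.sum fun β _ ↦
    contDiffAt_smul_const (contDiffAt_metricMatrix he hy α β) _

theorem contDiffAt_det {k l : ℕ} {A : EuclideanSpace ℝ (Fin k) → Matrix (Fin l) (Fin l) ℝ}
    {y : EuclideanSpace ℝ (Fin k)} (h : ∀ i j, ContDiffAt ℝ ∞ (fun x ↦ A x i j) y) :
    ContDiffAt ℝ ∞ (fun x ↦ (A x).det) y := by
  simp only [Matrix.det_apply']
  exact ContDiffAt.sum fun σ _ ↦ contDiffAt_const.mul (contDiffAt_prod fun i _ ↦ h _ _)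

theorem contDiffAt_metricMatrix_inv (he : e ∈ IsManifold.maximalAtlas (𝓡 (n + 1)) ∞ N)
    {y : EuclideanSpace ℝ (Fin (n + 1))} (hy : y ∈ e.target) (α β : Fin (n + 1)) :
    ContDiffAt ℝ ∞ (fun x ↦ (metricMatrix g e x)⁻¹ α β) y := by
  -- Cramer's rule expresses the inverse through determinants, which are polynomial in the entries.
  have h1 : ∀ x, (metricMatrix g e x)⁻¹ α β =
      ((metricMatrix g e x).det)⁻¹ * ((metricMatrix g e x).updateRow β (Pi.single α 1)).det := by
    intro x
    rw [Matrix.inv_def, Matrix.smul_apply, Matrix.adjugate_apply, Ring.inverse_eq_inv',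
      smul_eq_mul]
  simp only [h1]
  refine ContDiffAt.mul ((contDiffAt_det fun i j ↦ contDiffAt_metricMatrix he hy i j).inv
    (isUnit_det_metricMatrix he hy).ne_zero) (contDiffAt_det fun i j ↦ ?_)
  by_cases hi : i = β
  · subst hi
    simp only [Matrix.updateRow_self]
    exact contDiffAt_const
  · simp only [Matrix.updateRow_ne hi]
    exact contDiffAt_metricMatrix he hy i j

theorem contDiffAt_partialDeriv {u : EuclideanSpace ℝ (Fin (n + 1)) → ℝ}
    {y : EuclideanSpace ℝ (Fin (n + 1))} (h : ContDiffAt ℝ ∞ u y) (α : Fin (n + 1)) :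
    ContDiffAt ℝ ∞ (partialDeriv α u) y :=
  (h.fderiv_right (m := ∞) (by simp)).clm_apply contDiffAt_const

theorem contDiffAt_christoffel (he : e ∈ IsManifold.maximalAtlas (𝓡 (n + 1)) ∞ N)
    {y : EuclideanSpace ℝ (Fin (n + 1))} (hy : y ∈ e.target) (α β γ : Fin (n + 1)) :
    ContDiffAt ℝ ∞ (christoffel g e α β γ) y := by
  have h := fun i j ↦ contDiffAt_metricMatrix (g := g) he hy i j
  exact contDiffAt_const.mul (ContDiffAt.sum fun δ _ ↦
    (contDiffAt_metricMatrix_inv he hy α δ).mul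
      (((contDiffAt_partialDeriv (h γ δ) β).add (contDiffAt_partialDeriv (h β δ) γ)).sub
        (contDiffAt_partialDeriv (h β γ) δ)))

theorem contDiffAt_connectionForm (he : e ∈ IsManifold.maximalAtlas (𝓡 (n + 1)) ∞ N)
    {y : EuclideanSpace ℝ (Fin (n + 1))} (hy : y ∈ e.target) :
    ContDiffAt ℝ ∞ (connectionForm g e) y :=
  ContDiffAt.sum fun α _ ↦ ContDiffAt.sum fun β _ ↦ ContDiffAt.sum fun γ _ ↦
    contDiffAt_smul_const (contDiffAt_christoffel he hy α β γ) _

theorem differentiableAt_metricForm (he : e ∈ IsManifold.maximalAtlas (𝓡 (n + 1)) ∞ N)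
    {y : EuclideanSpace ℝ (Fin (n + 1))} (hy : y ∈ e.target) :
    DifferentiableAt ℝ (metricForm g e) y :=
  (contDiffAt_metricForm he hy).differentiableAt (by simp)

theorem differentiableAt_connectionForm (he : e ∈ IsManifold.maximalAtlas (𝓡 (n + 1)) ∞ N)
    {y : EuclideanSpace ℝ (Fin (n + 1))} (hy : y ∈ e.target) :
    DifferentiableAt ℝ (connectionForm g e) y :=
  (contDiffAt_connectionForm he hy).differentiableAt (by simp)

theorem fderiv_bilin_apply {E F : Type*} [NormedAddCommGroup E] [NormedSpace ℝ E]
    [NormedAddCommGroup F] [NormedSpace ℝ F] {B : E → E →L[ℝ] E →L[ℝ] F} {y : E}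
    (h : DifferentiableAt ℝ B y) (u v w : E) :
    fderiv ℝ B y u v w = fderiv ℝ (fun x ↦ B x v w) y u := by
  rw [(hasFDerivAt_bilin_comp (f := fun x ↦ x) (X := fun _ ↦ v) (Y := fun _ ↦ w) h
      differentiableAt_fun_id (differentiableAt_const v) (differentiableAt_const w)).2 u]
  simp

theorem fderiv_metricForm_single (he : e ∈ IsManifold.maximalAtlas (𝓡 (n + 1)) ∞ N)
    {y : EuclideanSpace ℝ (Fin (n + 1))} (hy : y ∈ e.target) (α β γ : Fin (n + 1)) :
    fderiv ℝ (metricForm g e) y (EuclideanSpace.single α 1) (EuclideanSpace.single β 1)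
      (EuclideanSpace.single γ 1) = partialDeriv α (fun x ↦ metricMatrix g e x β γ) y := by
  rw [fderiv_bilin_apply (differentiableAt_metricForm he hy)]
  simp only [metricForm_single, partialDeriv]

theorem christoffel_symm (α β γ : Fin (n + 1)) (y : EuclideanSpace ℝ (Fin (n + 1))) :
    christoffel g e α β γ y = christoffel g e α γ β y := by
  simp only [christoffel]
  congr 1
  refine Finset.sum_congr rfl fun δ _ ↦ ?_
  rw [show (fun z ↦ metricMatrix g e z β γ) = fun z ↦ metricMatrix g e z γ β from
    funext fun z ↦ metricMatrix_symm z β γ]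
  ring

/-- Lowering the index cancels the inverse metric in `christoffel`, leaving the Christoffel symbols
of the first kind. -/
theorem metricForm_connectionForm_single (he : e ∈ IsManifold.maximalAtlas (𝓡 (n + 1)) ∞ N)
    {y : EuclideanSpace ℝ (Fin (n + 1))} (hy : y ∈ e.target) (β γ δ : Fin (n + 1)) :
    metricForm g e y (connectionForm g e y (EuclideanSpace.single β 1)
      (EuclideanSpace.single γ 1)) (EuclideanSpace.single δ 1) =
      1 / 2 * (partialDeriv β (fun z ↦ metricMatrix g e z γ δ) y
        + partialDeriv γ (fun z ↦ metricMatrix g e z β δ) y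
        - partialDeriv δ (fun z ↦ metricMatrix g e z β γ) y) := by
  set c : Fin (n + 1) → ℝ := fun δ ↦ partialDeriv β (fun z ↦ metricMatrix g e z γ δ) y
        + partialDeriv γ (fun z ↦ metricMatrix g e z β δ) y
        - partialDeriv δ (fun z ↦ metricMatrix g e z β γ) y with hc
  have h1 : ∀ α, connectionForm g e y (EuclideanSpace.single β 1) (EuclideanSpace.single γ 1) α =
      1 / 2 * ((metricMatrix g e y)⁻¹.mulVec c) α := fun α ↦ by
    rw [connectionForm_single]
    rfl
  rw [metricForm_symm, metricForm_apply, innerCoord, Finset.sum_eq_single δ]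
  · simp only [h1, PiLp.single_apply, if_true, mul_one]
    have h2 : (metricMatrix g e y).mulVec ((metricMatrix g e y)⁻¹.mulVec c) δ = c δ := by
      rw [Matrix.mulVec_mulVec, Matrix.mul_nonsing_inv _ (isUnit_det_metricMatrix he hy),
        Matrix.one_mulVec]
    rw [Matrix.mulVec, dotProduct] at h2
    change _ = 1 / 2 * c δ
    rw [← h2, Finset.mul_sum]
    exact Finset.sum_congr rfl fun α _ ↦ by ring
  · intro b _ hb; simp [hb]
  · simp

/-- Compatibility is trilinear, so basis vectors suffice. There two Christoffel symbols of the first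
kind are added, and all but one derivative of the metric cancel. -/
theorem isLeviCivitaAt_connectionForm (he : e ∈ IsManifold.maximalAtlas (𝓡 (n + 1)) ∞ N)
    {y : EuclideanSpace ℝ (Fin (n + 1))} (hy : y ∈ e.target) :
    IsLeviCivitaAt (metricForm g e) (connectionForm g e) y where
  symm u v := by
    ext α
    rw [connectionForm_apply, connectionForm_apply, Finset.sum_comm]
    refine Finset.sum_congr rfl fun β _ ↦ Finset.sum_congr rfl fun γ _ ↦ ?_
    rw [christoffel_symm]
    ring
  compat u v w := by
    rw [← sub_eq_zero]
    refine eq_zero_of_trilinear (t := fun u v w ↦ fderiv ℝ (metricForm g e) y u v w -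
      (metricForm g e y (connectionForm g e y u v) w +
        metricForm g e y v (connectionForm g e y u w)))
      (fun v w ↦ ⟨fun _ _ ↦ by simp; ring, fun _ _ ↦ by simp; ring⟩)
      (fun v w ↦ ⟨fun _ _ ↦ by simp; ring, fun _ _ ↦ by simp; ring⟩)
      (fun v w ↦ ⟨fun _ _ ↦ by simp; ring, fun _ _ ↦ by simp; ring⟩) (fun α β γ ↦ ?_) u v w
    rw [metricForm_symm y (EuclideanSpace.single β 1), metricForm_connectionForm_single he hy,
      metricForm_connectionForm_single he hy, fderiv_metricForm_single he hy]
    rw [show (fun z ↦ metricMatrix g e z γ β) = fun z ↦ metricMatrix g e z β γ from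
      funext fun z ↦ metricMatrix_symm z γ β]
    ring

end Metric

/-! ### The curvature form and constant sectional curvature. -/

section Curvature

open Filter Topology

variable {n : ℕ} {N : Type*} [TopologicalSpace N]
  [ChartedSpace (EuclideanSpace ℝ (Fin (n + 1))) N] [IsManifold (𝓡 (n + 1)) ∞ N]
  {g : LorentzMetric n N} {e : OpenPartialHomeomorph N (EuclideanSpace ℝ (Fin (n + 1)))}

theorem fderiv_connectionForm_single (he : e ∈ IsManifold.maximalAtlas (𝓡 (n + 1)) ∞ N)
    {y : EuclideanSpace ℝ (Fin (n + 1))} (hy : y ∈ e.target) (α β γ δ : Fin (n + 1)) :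
    fderiv ℝ (connectionForm g e) y (EuclideanSpace.single δ 1) (EuclideanSpace.single β 1)
      (EuclideanSpace.single γ 1) α = partialDeriv δ (christoffel g e α β γ) y := by
  have hd := differentiableAt_connectionForm (g := g) he hy
  rw [fderiv_bilin_apply hd]
  have h1 : DifferentiableAt ℝ (fun x ↦ connectionForm g e x (EuclideanSpace.single β 1)
      (EuclideanSpace.single γ 1)) y :=
    (hasFDerivAt_bilin_comp (f := fun x ↦ x) (X := fun _ ↦ EuclideanSpace.single β 1)
      (Y := fun _ ↦ EuclideanSpace.single γ 1) hd differentiableAt_fun_id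
      (differentiableAt_const _) (differentiableAt_const _)).1
  have h2 := ((EuclideanSpace.proj α : EuclideanSpace ℝ (Fin (n + 1)) →L[ℝ] ℝ).hasFDerivAt.comp y
    h1.hasFDerivAt).fderiv
  have h3 : (EuclideanSpace.proj α : EuclideanSpace ℝ (Fin (n + 1)) →L[ℝ] ℝ) ∘
      (fun x ↦ connectionForm g e x (EuclideanSpace.single β 1) (EuclideanSpace.single γ 1)) =
      christoffel g e α β γ := funext fun x ↦ connectionForm_single x α β γ
  rw [h3] at h2
  rw [partialDeriv, h2]
  rfl

theorem curvForm_single (he : e ∈ IsManifold.maximalAtlas (𝓡 (n + 1)) ∞ N)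
    {y : EuclideanSpace ℝ (Fin (n + 1))} (hy : y ∈ e.target) (α β γ δ : Fin (n + 1)) :
    curvForm (connectionForm g e) y (EuclideanSpace.single γ 1) (EuclideanSpace.single δ 1)
      (EuclideanSpace.single β 1) α = riemann g e α β γ δ y := by
  have h1 : ∀ β γ δ, connectionForm g e y (EuclideanSpace.single γ 1) (connectionForm g e y
      (EuclideanSpace.single δ 1) (EuclideanSpace.single β 1)) α =
      ∑ μ, christoffel g e α γ μ y * christoffel g e μ δ β y := by
    intro β γ δ
    rw [connectionForm_apply, Finset.sum_eq_single γ]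
    · simp [connectionForm_single]
    · intro b _ hb; simp [hb]
    · simp
  simp only [curvForm, riemann, PiLp.add_apply, PiLp.sub_apply,
    fderiv_connectionForm_single he hy, h1, Finset.sum_sub_distrib]

/-- Links the coordinate-free curvature with the components used in `HasConstantSectionalCurvature`.
Both sides are trilinear, so it is enough to compare them on basis vectors. -/
theorem curvForm_apply (he : e ∈ IsManifold.maximalAtlas (𝓡 (n + 1)) ∞ N)
    {y : EuclideanSpace ℝ (Fin (n + 1))} (hy : y ∈ e.target)
    (u v w : EuclideanSpace ℝ (Fin (n + 1))) (α : Fin (n + 1)) :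
    curvForm (connectionForm g e) y u v w α =
      ∑ β, ∑ γ, ∑ δ, riemann g e α β γ δ y * w β * u γ * v δ := by
  rw [← sub_eq_zero]
  refine eq_zero_of_trilinear (t := fun u v w ↦ curvForm (connectionForm g e) y u v w α -
    ∑ β, ∑ γ, ∑ δ, riemann g e α β γ δ y * w β * u γ * v δ)
    (fun v w ↦ ⟨fun a b ↦ ?_, fun a b ↦ ?_⟩) (fun v w ↦ ⟨fun a b ↦ ?_, fun a b ↦ ?_⟩)
    (fun v w ↦ ⟨fun a b ↦ ?_, fun a b ↦ ?_⟩) (fun γ δ β ↦ ?_) u v w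
  · simp only [curvForm, map_add, add_apply, PiLp.add_apply, PiLp.sub_apply, mul_add, add_mul,
      Finset.sum_add_distrib]
    ring
  · simp only [curvForm, map_smul, smul_apply, PiLp.add_apply, PiLp.sub_apply, PiLp.smul_apply,
      smul_eq_mul, mul_sub, mul_add, Finset.mul_sum]
    congr 1
    exact Finset.sum_congr rfl fun _ _ ↦ Finset.sum_congr rfl fun _ _ ↦
      Finset.sum_congr rfl fun _ _ ↦ by ring
  · simp only [curvForm, map_add, add_apply, PiLp.add_apply, PiLp.sub_apply, mul_add,
      Finset.sum_add_distrib]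
    ring
  · simp only [curvForm, map_smul, smul_apply, PiLp.add_apply, PiLp.sub_apply, PiLp.smul_apply,
      smul_eq_mul, mul_sub, mul_add, Finset.mul_sum]
    congr 1
    exact Finset.sum_congr rfl fun _ _ ↦ Finset.sum_congr rfl fun _ _ ↦
      Finset.sum_congr rfl fun _ _ ↦ by ring
  · simp only [curvForm, map_add, PiLp.add_apply, PiLp.sub_apply, mul_add, add_mul,
      Finset.sum_add_distrib]
    ring
  · simp only [curvForm, map_smul, PiLp.add_apply, PiLp.sub_apply, PiLp.smul_apply,
      smul_eq_mul, mul_sub, mul_add, Finset.mul_sum]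
    congr 1
    exact Finset.sum_congr rfl fun _ _ ↦ Finset.sum_congr rfl fun _ _ ↦
      Finset.sum_congr rfl fun _ _ ↦ by ring
  · rw [curvForm_single he hy, sub_eq_zero, Finset.sum_eq_single β, Finset.sum_eq_single γ,
      Finset.sum_eq_single δ]
    · simp
    · intro b _ hb; simp [hb]
    · simp
    · intro b _ hb; simp [hb]
    · simp
    · intro b _ hb; simp [hb]
    · simp

theorem curvForm_antisymm {E : Type*} [NormedAddCommGroup E] [NormedSpace ℝ E]
    (Γ : E → E →L[ℝ] E →L[ℝ] E) (y u v w : E) : curvForm Γ y u v w = -curvForm Γ y v u w := by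
  simp only [curvForm]
  abel

/-- The curvature of planes that contain a timelike unit vector. -/
theorem HasConstantSectionalCurvature.metricForm_curvForm {κ : ℝ}
    (hg : HasConstantSectionalCurvature g (-κ))
    (he : e ∈ IsManifold.maximalAtlas (𝓡 (n + 1)) ∞ N)
    {y : EuclideanSpace ℝ (Fin (n + 1))} (hy : y ∈ e.target)
    {u a : EuclideanSpace ℝ (Fin (n + 1))} (hu : metricForm g e y u u = -1)
    (hua : metricForm g e y u a = 0) (ha : metricForm g e y a a ≠ 0) :
    metricForm g e y (curvForm (connectionForm g e) y u a u) a = -κ * metricForm g e y a a := by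
  have hau : metricForm g e y a u = 0 := by rw [metricForm_symm, hua]
  -- The Gram determinant is negative when `a` is spacelike; in any case it is nonzero. Its sign
  -- turns the curvature `-κ` into `+κ` for `R(a,u)u`, and antisymmetry turns this back into `-κ`
  -- for `R(u,a)u`.
  have h1 : planeGram g e y a u = -metricForm g e y a a := by
    simp only [planeGram, ← metricForm_apply, hu, hau]
    ring
  have h2 := hg e he y hy a u (by rw [h1]; exact neg_ne_zero.2 ha)
  have h3 : curvatureVector g e y a u = curvForm (connectionForm g e) y a u u :=
    funext fun α ↦ (curvForm_apply he hy a u u α).symm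
  rw [h1, h3, ← metricForm_apply, div_eq_iff (neg_ne_zero.2 ha)] at h2
  rw [curvForm_antisymm, map_neg, neg_apply, h2]
  ring

end Curvature

/-! ### Transition maps between charts. -/

section Transition

open Filter Topology

theorem eventually_mem_transition {X Y : Type*} [TopologicalSpace X] [TopologicalSpace Y]
    {e e' : OpenPartialHomeomorph X Y} {y₀ : Y} (hy : y₀ ∈ e.target) 
    (hy' : e.symm y₀ ∈ e'.source) :
    ∀ᶠ y in 𝓝 y₀, y ∈ e.target ∧ e.symm y ∈ e'.source := by
  filter_upwards [e.open_target.mem_nhds hy,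
    (e.symm.continuousAt hy).eventually (e'.open_source.mem_nhds hy')] with y h1 h2 using ⟨h1, h2⟩

variable {m : ℕ} {N : Type*} [TopologicalSpace N]
  [ChartedSpace (EuclideanSpace ℝ (Fin m)) N]
  {e e' : OpenPartialHomeomorph N (EuclideanSpace ℝ (Fin m))}

theorem contDiffAt_transition (he : e ∈ IsManifold.maximalAtlas (𝓡 m) ∞ N)
    (he' : e' ∈ IsManifold.maximalAtlas (𝓡 m) ∞ N)
    {y : EuclideanSpace ℝ (Fin m)} (hy : y ∈ e.target) (hy' : e.symm y ∈ e'.source) :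
    ContDiffAt ℝ ∞ (e' ∘ e.symm) y :=
  ((contMDiffAt_of_mem_maximalAtlas he' hy').comp y
    (contMDiffAt_symm_of_mem_maximalAtlas he hy)).contDiffAt

theorem fderiv_transition (he : e ∈ IsManifold.maximalAtlas (𝓡 m) ∞ N)
    (he' : e' ∈ IsManifold.maximalAtlas (𝓡 m) ∞ N)
    {y : EuclideanSpace ℝ (Fin m)} (hy : y ∈ e.target) (hy' : e.symm y ∈ e'.source)
    (v : EuclideanSpace ℝ (Fin m)) :
    fderiv ℝ (e' ∘ e.symm) y v =
      mfderiv (𝓡 m) (𝓡 m) e' (e.symm y) (mfderiv (𝓡 m) (𝓡 m) e.symm y v) := by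
  have h1 := mfderiv_comp y
    ((mdifferentiable_of_mem_maximalAtlas he').mdifferentiableAt hy')
    ((mdifferentiable_of_mem_maximalAtlas he).mdifferentiableAt_symm hy)
  rw [mfderiv_eq_fderiv] at h1
  rw [h1]
  rfl

theorem fderiv_transition_mfderiv (he : e ∈ IsManifold.maximalAtlas (𝓡 m) ∞ N)
    (he' : e' ∈ IsManifold.maximalAtlas (𝓡 m) ∞ N)
    {q : N} (hq : q ∈ e.source) (hq' : q ∈ e'.source) (v : TangentSpace (𝓡 m) q) :
    fderiv ℝ (e' ∘ e.symm) (e q) (mfderiv (𝓡 m) (𝓡 m) e q v) = mfderiv (𝓡 m) (𝓡 m) e' q v := by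
  obtain ⟨y, hy, rfl⟩ : ∃ y ∈ e.target, e.symm y = q := ⟨e q, e.map_source hq, e.left_inv hq⟩
  rw [e.right_inv hy]
  exact (fderiv_transition he he' hy hq' _).trans (congrArg (mfderiv (𝓡 m) (𝓡 m) e' (e.symm y))
    (mfderiv_symm_mfderiv he hy v))

theorem mfderiv_mfderiv_symm_chart (he : e ∈ IsManifold.maximalAtlas (𝓡 m) ∞ N)
    (he' : e' ∈ IsManifold.maximalAtlas (𝓡 m) ∞ N)
    {q : N} (hq : q ∈ e.source) (hq' : q ∈ e'.source) (v : EuclideanSpace ℝ (Fin m)) :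
    mfderiv (𝓡 m) (𝓡 m) e' q (mfderiv (𝓡 m) (𝓡 m) e.symm (e q) v) =
      fderiv ℝ (e' ∘ e.symm) (e q) v := by
  obtain ⟨y, hy, rfl⟩ : ∃ y ∈ e.target, e.symm y = q := ⟨e q, e.map_source hq, e.left_inv hq⟩
  rw [e.right_inv hy, fderiv_transition he he' hy hq']

theorem fderiv_transition_surjective (he : e ∈ IsManifold.maximalAtlas (𝓡 m) ∞ N)
    (he' : e' ∈ IsManifold.maximalAtlas (𝓡 m) ∞ N)
    {y : EuclideanSpace ℝ (Fin m)} (hy : y ∈ e.target) (hy' : e.symm y ∈ e'.source) :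
    Function.Surjective (fderiv ℝ (e' ∘ e.symm) y) := by
  intro w
  obtain ⟨u, hu⟩ := (mdifferentiable_of_mem_maximalAtlas he').mfderiv_surjective hy' w
  exact ⟨mfderiv (𝓡 m) (𝓡 m) e (e.symm y) u, (fderiv_transition he he' hy hy' _).trans
    ((congrArg (mfderiv (𝓡 m) (𝓡 m) e' (e.symm y)) (mfderiv_symm_mfderiv he hy u)).trans hu)⟩

end Transition

/-! ### Chart independence of the connection. -/

section TransitionConnection

open Filter Topology

variable {n : ℕ} {N : Type*} [TopologicalSpace N]
  [ChartedSpace (EuclideanSpace ℝ (Fin (n + 1))) N] [IsManifold (𝓡 (n + 1)) ∞ N]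
  {g : LorentzMetric n N} {e e' : OpenPartialHomeomorph N (EuclideanSpace ℝ (Fin (n + 1)))}

theorem metricForm_transition (he : e ∈ IsManifold.maximalAtlas (𝓡 (n + 1)) ∞ N)
    (he' : e' ∈ IsManifold.maximalAtlas (𝓡 (n + 1)) ∞ N)
    {y : EuclideanSpace ℝ (Fin (n + 1))} (hy : y ∈ e.target) (hy' : e.symm y ∈ e'.source)
    (v w : EuclideanSpace ℝ (Fin (n + 1))) :
    metricForm g e' ((e' ∘ e.symm) y) (fderiv ℝ (e' ∘ e.symm) y v)
      (fderiv ℝ (e' ∘ e.symm) y w) = metricForm g e y v w := by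
  rw [fderiv_transition he he' hy hy', fderiv_transition he he' hy hy', metricForm_eq_val y]
  exact metricForm_components_chart he' hy' _ _

/-- The transition map is an isometry of the two coordinate metrics, so the inhomogeneous
transformation law follows from uniqueness of the Levi-Civita connection, with no formula for the
Christoffel symbols. -/
theorem connectionForm_transition (he : e ∈ IsManifold.maximalAtlas (𝓡 (n + 1)) ∞ N)
    (he' : e' ∈ IsManifold.maximalAtlas (𝓡 (n + 1)) ∞ N)
    {y : EuclideanSpace ℝ (Fin (n + 1))} (hy : y ∈ e.target) (hy' : e.symm y ∈ e'.source)
    (v w : EuclideanSpace ℝ (Fin (n + 1))) :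
    fderiv ℝ (e' ∘ e.symm) y (connectionForm g e y v w) =
      fderiv ℝ (fderiv ℝ (e' ∘ e.symm)) y v w + connectionForm g e' ((e' ∘ e.symm) y)
        (fderiv ℝ (e' ∘ e.symm) y v) (fderiv ℝ (e' ∘ e.symm) y w) := by
  have hy2 : (e' ∘ e.symm) y ∈ e'.target := e'.map_source hy'
  refine fderiv_covAlong (differentiableAt_metricForm he hy) (differentiableAt_metricForm he' hy2)
    (metricForm_symm _) (isLeviCivitaAt_connectionForm he hy)
    (isLeviCivitaAt_connectionForm he' hy2)
    ((contDiffAt_transition he he' hy hy').of_le (WithTop.coe_le_coe.2 (le_top : (2 : ℕ∞) ≤ ⊤)))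
    ?_ (fderiv_transition_surjective he he' hy hy')
    (fun _ ↦ metricForm_nondegenerate he' hy2) v w
  filter_upwards [eventually_mem_transition hy hy'] with x hx v w
  exact metricForm_transition he he' hx.1 hx.2 v w

/-- Covariant derivatives do not depend on the chart. -/
theorem covAlong_transition {P : Type*} [NormedAddCommGroup P] [NormedSpace ℝ P]
    (he : e ∈ IsManifold.maximalAtlas (𝓡 (n + 1)) ∞ N)
    (he' : e' ∈ IsManifold.maximalAtlas (𝓡 (n + 1)) ∞ N)
    {f X : P → EuclideanSpace ℝ (Fin (n + 1))} {z : P} (hf : DifferentiableAt ℝ f z)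
    (hX : DifferentiableAt ℝ X z) (hz : f z ∈ e.target) (hz' : e.symm (f z) ∈ e'.source) (a : P) :
    covAlong (connectionForm g e') (fun x ↦ (e' ∘ e.symm) (f x))
      (fun x ↦ fderiv ℝ (e' ∘ e.symm) (f x) (X x)) a z =
      fderiv ℝ (e' ∘ e.symm) (f z) (covAlong (connectionForm g e) f X a z) := by
  have hΦ := contDiffAt_transition he he' hz hz'
  have h1 : HasFDerivAt (fun x ↦ (e' ∘ e.symm) (f x)) _ z :=
    HasFDerivAt.comp (g := e' ∘ e.symm) z (hΦ.differentiableAt (by simp)).hasFDerivAt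
      hf.hasFDerivAt
  have h2 : HasFDerivAt (fun x ↦ fderiv ℝ (e' ∘ e.symm) (f x)) _ z :=
    HasFDerivAt.comp (g := fderiv ℝ (e' ∘ e.symm)) z ((hΦ.fderiv_right (m := ∞) (by simp)).differentiableAt
      (by simp)).hasFDerivAt hf.hasFDerivAt
  have h3 := h2.clm_apply hX.hasFDerivAt
  simp only [covAlong]
  rw [h1.fderiv, h3.fderiv, map_add, connectionForm_transition he he' hz hz']
  simp
  abel

end TransitionConnection

/-! ### Maps, vector fields along them and covariant derivatives in charts. -/

section MapInCharts

open Filter Topology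

variable {n : ℕ} {N : Type*} [TopologicalSpace N]
  [ChartedSpace (EuclideanSpace ℝ (Fin (n + 1))) N]
  {e e' : OpenPartialHomeomorph N (EuclideanSpace ℝ (Fin (n + 1)))}
  {M : Type*} [TopologicalSpace M] [ChartedSpace (EuclideanSpace ℝ (Fin n)) M]
  {c : OpenPartialHomeomorph M (EuclideanSpace ℝ (Fin n))} {F : M → N} {p : M}

/-- The coordinate expression of a map between manifolds. -/
def chartMap (c : OpenPartialHomeomorph M (EuclideanSpace ℝ (Fin n)))
    (e : OpenPartialHomeomorph N (EuclideanSpace ℝ (Fin (n + 1)))) (F : M → N)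
    (x : EuclideanSpace ℝ (Fin n)) : EuclideanSpace ℝ (Fin (n + 1)) :=
  e (F (c.symm x))

/-- The coordinate expression of a vector field along a map. -/
def chartField (c : OpenPartialHomeomorph M (EuclideanSpace ℝ (Fin n)))
    (e : OpenPartialHomeomorph N (EuclideanSpace ℝ (Fin (n + 1)))) (F : M → N)
    (X : ∀ p : M, TangentSpace (𝓡 (n + 1)) (F p))
    (x : EuclideanSpace ℝ (Fin n)) : EuclideanSpace ℝ (Fin (n + 1)) :=
  components e (F (c.symm x)) (X (c.symm x))

theorem mfderiv_eq_fderiv_chart (hc : c ∈ IsManifold.maximalAtlas (𝓡 n) ∞ M) (hp : p ∈ c.source)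
    {H : Type*} [NormedAddCommGroup H] [NormedSpace ℝ H] {u : M → H}
    {u' : EuclideanSpace ℝ (Fin n) → H} (hu : DifferentiableAt ℝ u' (c p))
    (huu : ∀ᶠ x in 𝓝 (c p), u (c.symm x) = u' x) (V : TangentSpace (𝓡 n) p) :
    mfderiv (𝓡 n) 𝓘(ℝ, H) u p V = fderiv ℝ u' (c p) (mfderiv (𝓡 n) (𝓡 n) c p V) := by
  have h1 : u =ᶠ[𝓝 p] u' ∘ c := by
    filter_upwards [c.open_source.mem_nhds hp, (c.continuousAt hp).eventually huu] with q hq hq'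
    rw [Function.comp_apply, ← hq', c.left_inv hq]
  have h2 := mfderiv_comp p hu.mdifferentiableAt
    ((mdifferentiable_of_mem_maximalAtlas hc).mdifferentiableAt hp)
  rw [h1.mfderiv_eq, h2, mfderiv_eq_fderiv]
  rfl

theorem differentiableAt_chartMap (hc : c ∈ IsManifold.maximalAtlas (𝓡 n) ∞ M)
    (hp : p ∈ c.source) (he : e ∈ IsManifold.maximalAtlas (𝓡 (n + 1)) ∞ N)
    (hq : F p ∈ e.source) (hF : MDifferentiableAt (𝓡 n) (𝓡 (n + 1)) F p) :
    DifferentiableAt ℝ (chartMap c e F) (c p) := by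
  have h1 : MDifferentiableAt (𝓡 n) (𝓡 (n + 1)) F (c.symm (c p)) := by rwa [c.left_inv hp]
  have h2 := h1.comp (c p)
    ((mdifferentiable_of_mem_maximalAtlas hc).mdifferentiableAt_symm (c.map_source hp))
  have h3 : MDifferentiableAt (𝓡 (n + 1)) (𝓡 (n + 1)) e ((F ∘ c.symm) (c p)) := by
    rw [Function.comp_apply, c.left_inv hp]
    exact (mdifferentiable_of_mem_maximalAtlas he).mdifferentiableAt hq
  exact (h3.comp (c p) h2).differentiableAt

theorem components_differential (hc : c ∈ IsManifold.maximalAtlas (𝓡 n) ∞ M)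
    (hp : p ∈ c.source) (he : e ∈ IsManifold.maximalAtlas (𝓡 (n + 1)) ∞ N)
    (hq : F p ∈ e.source) (hF : MDifferentiableAt (𝓡 n) (𝓡 (n + 1)) F p)
    (V : TangentSpace (𝓡 n) p) :
    components e (F p) (differential F p V) =
      fderiv ℝ (chartMap c e F) (c p) (mfderiv (𝓡 n) (𝓡 n) c p V) := by
  have h1 := mfderiv_comp p
    ((mdifferentiable_of_mem_maximalAtlas he).mdifferentiableAt hq) hF
  rw [← mfderiv_eq_fderiv_chart hc hp (differentiableAt_chartMap hc hp he hq hF)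
    (u := e ∘ F) (Eventually.of_forall fun x ↦ rfl) V, h1]
  rfl

theorem eventually_chart_mem_source (hp : p ∈ c.source) (hq : F p ∈ e.source)
    (hF : ContinuousAt F p) : ∀ᶠ x in 𝓝 (c p), F (c.symm x) ∈ e.source := by
  have h1 : Tendsto c.symm (𝓝 (c p)) (𝓝 p) := by
    have := c.symm.continuousAt (c.map_source hp)
    rwa [ContinuousAt, c.left_inv hp] at this
  exact (hF.tendsto.comp h1).eventually (e.open_source.mem_nhds hq)

theorem chartMap_transition {x : EuclideanSpace ℝ (Fin n)} (hx : F (c.symm x) ∈ e.source) :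
    chartMap c e' F x = (e' ∘ e.symm) (chartMap c e F x) := by
  simp only [chartMap, Function.comp_apply]
  rw [e.left_inv hx]

theorem chartField_transition (he : e ∈ IsManifold.maximalAtlas (𝓡 (n + 1)) ∞ N)
    (he' : e' ∈ IsManifold.maximalAtlas (𝓡 (n + 1)) ∞ N)
    {X : ∀ p : M, TangentSpace (𝓡 (n + 1)) (F p)} {x : EuclideanSpace ℝ (Fin n)}
    (hx : F (c.symm x) ∈ e.source) (hx' : F (c.symm x) ∈ e'.source) :
    chartField c e' F X x = fderiv ℝ (e' ∘ e.symm) (chartMap c e F x) (chartField c e F X x) :=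
  (fderiv_transition_mfderiv he he' hx hx' _).symm

variable [IsManifold (𝓡 (n + 1)) ∞ N] {g : LorentzMetric n N}

theorem covDerivComponents_eq (hc : c ∈ IsManifold.maximalAtlas (𝓡 n) ∞ M)
    (hp : p ∈ c.source) (he : e ∈ IsManifold.maximalAtlas (𝓡 (n + 1)) ∞ N)
    (hq : F p ∈ e.source) (hF : MDifferentiableAt (𝓡 n) (𝓡 (n + 1)) F p)
    {X : ∀ p : M, TangentSpace (𝓡 (n + 1)) (F p)}
    (hX : DifferentiableAt ℝ (chartField c e F X) (c p)) (V : TangentSpace (𝓡 n) p) :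
    (WithLp.toLp 2 (covDerivComponents g e F X p V) : EuclideanSpace ℝ (Fin (n + 1))) =
      covAlong (connectionForm g e) (chartMap c e F) (chartField c e F X)
        (mfderiv (𝓡 n) (𝓡 n) c p V) (c p) := by
  ext α
  have h1 : HasFDerivAt (fun x ↦ chartField c e F X x α) _ (c p) :=
    (EuclideanSpace.proj α : EuclideanSpace ℝ (Fin (n + 1)) →L[ℝ] ℝ).hasFDerivAt.comp (c p)
      hX.hasFDerivAt
  have h2 := mfderiv_eq_fderiv_chart hc hp h1.differentiableAt
    (u := fun q : M ↦ components e (F q) (X q) α) (Eventually.of_forall fun x ↦ rfl) V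
  have h3 : chartMap c e F (c p) = e (F p) := by rw [chartMap, c.left_inv hp]
  have h4 : chartField c e F X (c p) = components e (F p) (X p) := by
    rw [chartField, c.left_inv hp]
  simp only [covAlong, covDerivComponents, dirDeriv, PiLp.add_apply]
  rw [connectionForm_apply, ← components_differential hc hp he hq hF, h3, h4]
  congr 1
  rw [h2, h1.fderiv]
  rfl

/-- `covDeriv` is computed in the preferred chart at `F p`, which may jump as `p` varies. This
expresses it in an arbitrary chart `e`, so a single chart serves a whole neighbourhood. -/
theorem components_covDeriv (hc : c ∈ IsManifold.maximalAtlas (𝓡 n) ∞ M)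
    (hp : p ∈ c.source) (he : e ∈ IsManifold.maximalAtlas (𝓡 (n + 1)) ∞ N)
    (hq : F p ∈ e.source) (hF : MDifferentiableAt (𝓡 n) (𝓡 (n + 1)) F p)
    {X : ∀ p : M, TangentSpace (𝓡 (n + 1)) (F p)}
    (hX : DifferentiableAt ℝ (chartField c e F X) (c p)) (V : TangentSpace (𝓡 n) p) :
    components e (F p) (covDeriv g F X p V) =
      covAlong (connectionForm g e) (chartMap c e F) (chartField c e F X)
        (mfderiv (𝓡 n) (𝓡 n) c p V) (c p) := by
  set e₀ := chartAt (EuclideanSpace ℝ (Fin (n + 1))) (F p) with he₀def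
  have he₀ : e₀ ∈ IsManifold.maximalAtlas (𝓡 (n + 1)) ∞ N :=
    IsManifold.chart_mem_maximalAtlas (F p)
  have hq₀ : F p ∈ e₀.source := mem_chart_source _ _
  have hev := eventually_chart_mem_source hp hq hF.continuousAt
  have hev₀ := eventually_chart_mem_source hp hq₀ hF.continuousAt
  have hcp : ∀ (a : OpenPartialHomeomorph N (EuclideanSpace ℝ (Fin (n + 1)))),
      chartMap c a F (c p) = a (F p) := fun a ↦ by rw [chartMap, c.left_inv hp]
  -- Differentiability is assumed in `e` only; it is carried over by the derivative of the
  -- transition map.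
  have hX₀ : DifferentiableAt ℝ (chartField c e₀ F X) (c p) := by
    have h1 : (chartField c e₀ F X) =ᶠ[𝓝 (c p)]
        fun x ↦ fderiv ℝ (e₀ ∘ e.symm) (chartMap c e F x) (chartField c e F X x) := by
      filter_upwards [hev, hev₀] with x h h' using chartField_transition he he₀ h h'
    refine DifferentiableAt.congr_of_eventuallyEq ?_ h1
    have hΦ := contDiffAt_transition (y := e (F p)) he he₀ (e.map_source hq)
      (by rwa [e.left_inv hq])
    rw [← hcp] at hΦ
    have h2 : HasFDerivAt (fun x ↦ fderiv ℝ (e₀ ∘ e.symm) (chartMap c e F x)) _ (c p) :=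
      HasFDerivAt.comp (g := fderiv ℝ (e₀ ∘ e.symm)) (c p)
        ((hΦ.fderiv_right (m := ∞) (by simp)).differentiableAt (by simp)).hasFDerivAt
        (differentiableAt_chartMap hc hp he hq hF).hasFDerivAt
    exact (h2.clm_apply hX.hasFDerivAt).differentiableAt
  have h1 := covDerivComponents_eq (g := g) hc hp he₀ hq₀ hF hX₀ V
  have h2 : components e (F p) (covDeriv g F X p V) = fderiv ℝ (e ∘ e₀.symm) (e₀ (F p))
      (WithLp.toLp 2 (covDerivComponents g e₀ F X p V)) :=
    mfderiv_mfderiv_symm_chart he₀ he hq₀ hq _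
  rw [h2, h1, ← hcp]
  refine (covAlong_transition he₀ he (differentiableAt_chartMap hc hp he₀ hq₀ hF) hX₀
    (by rw [hcp]; exact e₀.map_source hq₀) (by rw [hcp, e₀.left_inv hq₀]; exact hq) _).symm.trans ?_
  have h3 : (fun x ↦ (e ∘ e₀.symm) (chartMap c e₀ F x)) =ᶠ[𝓝 (c p)] chartMap c e F := by
    filter_upwards [hev₀] with x h using (chartMap_transition h).symm
  have h4 : (fun x ↦ fderiv ℝ (e ∘ e₀.symm) (chartMap c e₀ F x) (chartField c e₀ F X x))
      =ᶠ[𝓝 (c p)] chartField c e F X := by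
    filter_upwards [hev, hev₀] with x h h' using (chartField_transition he₀ he h' h).symm
  simp only [covAlong]
  rw [h3.fderiv_eq, h4.fderiv_eq, h3.eq_of_nhds, h4.eq_of_nhds]

end MapInCharts

/-! ### Smoothness of the unit normal. -/

section NormalRegularity

open Filter Topology Module

variable {E : Type*} [NormedAddCommGroup E] [NormedSpace ℝ E] [FiniteDimensional ℝ E]
  {X : Type*} [NormedAddCommGroup X] [NormedSpace ℝ X] [FiniteDimensional ℝ X]

/-- Pairing with `ν` shows that tangent space and normal line meet only in zero, and `L` is
injective because the induced form is positive. The dimension count gives the rest. -/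
theorem exists_tangent_add_normal (hdim : finrank ℝ E = finrank ℝ X + 1)
    {B : E →L[ℝ] E →L[ℝ] ℝ} {L : X →L[ℝ] E} {ν : E} (hν : B ν ν = -1)
    (hνL : ∀ v, B ν (L v) = 0) (hpos : ∀ v, v ≠ 0 → 0 < B (L v) (L v)) (u : E) :
    ∃ (v : X) (s : ℝ), u = L v + s • ν := by
  let K : X × ℝ →ₗ[ℝ] E := L.toLinearMap.coprod (LinearMap.toSpanSingleton ℝ E ν)
  have hK : ∀ v s, K (v, s) = L v + s • ν := fun v s ↦ by simp [K]
  have hinj : Function.Injective K := by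
    rw [← LinearMap.ker_eq_bot, LinearMap.ker_eq_bot']
    rintro ⟨v, s⟩ h
    rw [hK] at h
    have h1 := congrArg (B ν) h
    simp [hνL, hν] at h1
    subst h1
    have h2 : v = 0 := by
      by_contra hv
      have := hpos v hv
      simp at h
      simp [h] at this
    simp [h2]
  have hsurj := (LinearMap.injective_iff_surjective_of_finrank_eq_finrank
    (by simp [hdim] : finrank ℝ (X × ℝ) = finrank ℝ E)).1 hinj
  obtain ⟨⟨v, s⟩, h⟩ := hsurj u
  exact ⟨v, s, by rw [← h, hK]⟩

/-- The unit normal depends smoothly on the metric, the tangent space and the time orientation. -/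
theorem contDiffWithinAt_normal {P : Type*} [NormedAddCommGroup P] [NormedSpace ℝ P]
    (hdim : finrank ℝ E = finrank ℝ X + 1) {B : P → E →L[ℝ] E →L[ℝ] ℝ} {L : P → X →L[ℝ] E}
    {τ ν : P → E} {S : Set P} {z : P} (hz : z ∈ S) (hB : ContDiffWithinAt ℝ ∞ B S z)
    (hL : ∀ v, ContDiffWithinAt ℝ ∞ (fun x ↦ L x v) S z) (hτ : ContDiffWithinAt ℝ ∞ τ S z)
    (hsymm : ∀ x u v, B x u v = B x v u)
    (hν : ∀ᶠ x in 𝓝[S] z, B x (ν x) (ν x) = -1)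
    (hνL : ∀ᶠ x in 𝓝[S] z, ∀ v, B x (ν x) (L x v) = 0)
    (hντ : ∀ᶠ x in 𝓝[S] z, B x (ν x) (τ x) < 0)
    (hpos : ∀ᶠ x in 𝓝[S] z, ∀ v, v ≠ 0 → 0 < B x (L x v) (L x v)) :
    ContDiffWithinAt ℝ ∞ ν S z := by
  let b := Module.finBasis ℝ X
  -- The map records the pairings of a vector with the tangent vectors and with `-τ`. It is
  -- injective: a vector orthogonal to the tangent space is a multiple of `ν`, and `ν` does not pair
  -- to zero with `τ`.
  let A : P → E →L[ℝ] X × ℝ := fun x ↦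
    (∑ i, (B x (L x (b i))).smulRight ((b i, 0) : X × ℝ)) -
      (B x (τ x)).smulRight ((0, 1) : X × ℝ)
  have hA_apply : ∀ x u, A x u = (∑ i, B x u (L x (b i)) • b i, -B x u (τ x)) := by
    intro x u
    have h1 : ∀ w : X × ℝ, w = (w.1, w.2) := fun w ↦ rfl
    rw [h1 (A x u)]
    simp [A, Prod.fst_sum, Prod.snd_sum, hsymm x u]
  have hAinj : ∀ᶠ x in 𝓝[S] z, ∃ a : E ≃L[ℝ] X × ℝ, (a : E →L[ℝ] X × ℝ) = A x := by
    filter_upwards [hν, hνL, hντ, hpos] with x h1 h2 h3 h4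
    have hinj : Function.Injective (A x).toLinearMap := by
      rw [← LinearMap.ker_eq_bot, LinearMap.ker_eq_bot']
      intro u hu
      have hu' : A x u = 0 := hu
      rw [hA_apply, Prod.mk_eq_zero] at hu'
      have h5 : ∀ i, B x u (L x (b i)) = 0 :=
        fun i ↦ Fintype.linearIndependent_iff.1 b.linearIndependent _ hu'.1 i
      have h6 : ∀ v, B x u (L x v) = 0 := by
        intro v
        rw [← b.sum_repr v]
        simp only [map_sum, map_smul, h5, smul_zero, Finset.sum_const_zero]
      obtain ⟨v, s, rfl⟩ := exists_tangent_add_normal hdim h1 h2 h4 u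
      have h7 := h6 v
      simp only [map_add, add_apply, map_smul, smul_apply, h2, smul_zero, add_zero] at h7
      have hv : v = 0 := by
        by_contra hv
        exact (h4 v hv).ne' h7
      subst hv
      have h8 := hu'.2
      simp [h3.ne] at h8
      simp [h8]
    exact ⟨(LinearEquiv.ofInjectiveOfFinrankEq _ hinj (by simp [hdim])).toContinuousLinearEquiv,
      by ext1; rfl⟩
  have hA : ContDiffWithinAt ℝ ∞ A S z := by
    have hsm : ∀ {Y : P → E} (w : X × ℝ), ContDiffWithinAt ℝ ∞ Y S z →
        ContDiffWithinAt ℝ ∞ (fun x ↦ (B x (Y x)).smulRight w) S z := by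
      intro Y w hY
      have h1 : ContDiffWithinAt ℝ ∞ (fun x ↦ B x (Y x)) S z := hB.clm_apply hY
      exact ((ContinuousLinearMap.smulRightL ℝ E (X × ℝ)).flip w).contDiff.contDiffAt
        |>.comp_contDiffWithinAt z h1
    exact (ContDiffWithinAt.sum fun i _ ↦ hsm _ (hL _)).sub (hsm _ hτ)
  -- The normal vector scaled so that its pairing with `τ` is `-1`. Unlike `ν`, it is visibly
  -- smooth, being obtained by inverting `A`.
  let μ : P → E := fun x ↦ ContinuousLinearMap.inverse (A x) (0, 1)
  have hμ : ContDiffWithinAt ℝ ∞ μ S z := by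
    obtain ⟨a, ha⟩ := hAinj.self_of_nhdsWithin hz
    have h1 := contDiffAt_map_inverse (n := ∞) a
    rw [ha] at h1
    exact (h1.comp_contDiffWithinAt z hA).clm_apply contDiffWithinAt_const
  have hνμ : ∀ᶠ x in 𝓝[S] z, ν x = (-B x (ν x) (τ x)) • μ x := by
    filter_upwards [hAinj, hνL] with x ⟨a, ha⟩ h2
    have h3 : A x (ν x) = (-B x (ν x) (τ x)) • ((0, 1) : X × ℝ) := by
      rw [hA_apply]
      simp [h2]
    simp only [μ]
    rw [← map_smul, ← h3, ← ha, ContinuousLinearMap.inverse_equiv]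
    simp
  -- The factor `-B x (ν x) (τ x)` is positive, so it is recovered from the length of `μ` by a
  -- square root. Hence `ν` is `μ` normalised.
  have hBμ : ∀ᶠ x in 𝓝[S] z, -B x (μ x) (μ x) = ((-B x (ν x) (τ x)) ^ 2)⁻¹ := by
    filter_upwards [hνμ, hν, hντ] with x h1 h2 h3
    set k := -B x (ν x) (τ x)
    have hk : k ≠ 0 := by simp only [k]; linarith
    rw [h1] at h2
    simp at h2
    field_simp
    linarith
  have hfin : ContDiffWithinAt ℝ ∞ (fun x ↦ (√(-B x (μ x) (μ x)))⁻¹ • μ x) S z := by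
    have h1 : ContDiffWithinAt ℝ ∞ (fun x ↦ -B x (μ x) (μ x)) S z :=
      ((hB.clm_apply hμ).clm_apply hμ).neg
    have h2 : 0 < -B z (μ z) (μ z) := by
      rw [hBμ.self_of_nhdsWithin hz]
      have := hντ.self_of_nhdsWithin hz
      have h3 : -B z (ν z) (τ z) ≠ 0 := by linarith
      positivity
    exact ((h1.sqrt h2.ne').inv (Real.sqrt_pos.2 h2).ne').smul hμ
  refine hfin.congr_of_eventuallyEq_of_mem ?_ hz
  filter_upwards [hνμ, hBμ, hντ] with x h1 h2 h3
  rw [h2, Real.sqrt_inv, Real.sqrt_sq (by linarith), inv_inv]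
  exact h1

end NormalRegularity

/-! ### The time interval. -/

section TimeInterval

open Topology

theorem isOpen_preimage_Iio (T : EReal) : IsOpen ((fun t : ℝ ↦ (t : EReal)) ⁻¹' Iio T) :=
  isOpen_Iio.preimage continuous_coe_real_ereal

theorem uniqueDiffOn_timeInterval (T : EReal) : UniqueDiffOn ℝ (timeInterval T) :=
  (uniqueDiffOn_Ici 0).inter (isOpen_preimage_Iio T)

theorem timeInterval_mem_nhds {T : EReal} {t : ℝ} (ht : t ∈ timeInterval T) (h0 : 0 < t) :
    timeInterval T ∈ 𝓝 t :=
  Filter.inter_mem (Ici_mem_nhds h0) ((isOpen_preimage_Iio T).mem_nhds ht.2)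

theorem Icc_subset_timeInterval {T : EReal} {t : ℝ} (ht : t ∈ timeInterval T) :
    Icc 0 t ⊆ timeInterval T :=
  fun _ hs ↦ ⟨hs.1, (EReal.coe_le_coe_iff.2 hs.2).trans_lt ht.2⟩

end TimeInterval

/-! ### The flow in charts, up to the initial time. -/

section FlowInCharts

open Filter Topology

variable {n : ℕ} {N : Type*} [TopologicalSpace N]
  [ChartedSpace (EuclideanSpace ℝ (Fin (n + 1))) N] [IsManifold (𝓡 (n + 1)) ∞ N]
  {M : Type*} [TopologicalSpace M] [ChartedSpace (EuclideanSpace ℝ (Fin n)) M]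
  {g : LorentzMetric n N} {τ : TimeOrientation g} {κ : ℝ} {T : EReal} {F : M → ℝ → N}
  {ν : ∀ (p : M) (t : ℝ), TangentSpace (𝓡 (n + 1)) (F p t)}
  {e : OpenPartialHomeomorph N (EuclideanSpace ℝ (Fin (n + 1)))}
  {c : OpenPartialHomeomorph M (EuclideanSpace ℝ (Fin n))}

/-- The coordinate expression of a family of maps. -/
def flowMap (c : OpenPartialHomeomorph M (EuclideanSpace ℝ (Fin n)))
    (e : OpenPartialHomeomorph N (EuclideanSpace ℝ (Fin (n + 1)))) (F : M → ℝ → N)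
    (z : EuclideanSpace ℝ (Fin n) × ℝ) : EuclideanSpace ℝ (Fin (n + 1)) :=
  e (F (c.symm z.1) z.2)

/-- The coordinate expression of a family of vector fields along a family of maps. -/
def flowField (c : OpenPartialHomeomorph M (EuclideanSpace ℝ (Fin n)))
    (e : OpenPartialHomeomorph N (EuclideanSpace ℝ (Fin (n + 1)))) (F : M → ℝ → N)
    (ν : ∀ (p : M) (t : ℝ), TangentSpace (𝓡 (n + 1)) (F p t))
    (z : EuclideanSpace ℝ (Fin n) × ℝ) : EuclideanSpace ℝ (Fin (n + 1)) :=
  components e (F (c.symm z.1) z.2) (ν (c.symm z.1) z.2)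

/-- The Lagrangian angle in the chart `c`. -/
def flowAngle (g : LorentzMetric n N) (κ : ℝ)
    (c : OpenPartialHomeomorph M (EuclideanSpace ℝ (Fin n))) (F : M → ℝ → N)
    (ν : ∀ (p : M) (t : ℝ), TangentSpace (𝓡 (n + 1)) (F p t))
    (z : EuclideanSpace ℝ (Fin n) × ℝ) : ℝ :=
  lagrangianAngle g κ (fun q ↦ F q z.2) (fun q ↦ ν q z.2) (c.symm z.1)

/-- The parameter domain in coordinates. -/
def paramSet (n : ℕ) (T : EReal) : Set (EuclideanSpace ℝ (Fin n) × ℝ) := univ ×ˢ timeInterval T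

/-- The charts `c` and `e` are applicable at the parameter `z`. -/
structure InCharts (c : OpenPartialHomeomorph M (EuclideanSpace ℝ (Fin n)))
    (e : OpenPartialHomeomorph N (EuclideanSpace ℝ (Fin (n + 1)))) (T : EReal) (F : M → ℝ → N)
    (z : EuclideanSpace ℝ (Fin n) × ℝ) : Prop where
  space : z.1 ∈ c.target
  time : z.2 ∈ timeInterval T
  image : F (c.symm z.1) z.2 ∈ e.source

theorem uniqueDiffOn_paramSet (n : ℕ) (T : EReal) : UniqueDiffOn ℝ (paramSet n T) :=
  uniqueDiffOn_univ.prod (uniqueDiffOn_timeInterval T)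

theorem InCharts.mem {z : EuclideanSpace ℝ (Fin n) × ℝ} (hz : InCharts c e T F z) :
    z ∈ paramSet n T := ⟨mem_univ _, hz.time⟩

theorem InCharts.target {z : EuclideanSpace ℝ (Fin n) × ℝ} (hz : InCharts c e T F z) :
    flowMap c e F z ∈ e.target := e.map_source hz.image

theorem InCharts.source {z : EuclideanSpace ℝ (Fin n) × ℝ} (hz : InCharts c e T F z) :
    c.symm z.1 ∈ c.source := c.map_target hz.space

theorem InCharts.paramSet_mem_nhds {z : EuclideanSpace ℝ (Fin n) × ℝ} (hz : InCharts c e T F z)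
    (h0 : 0 < z.2) : paramSet n T ∈ 𝓝 z :=
  prod_mem_nhds univ_mem (timeInterval_mem_nhds hz.time h0)

namespace IsLagrangianAngleFlow

theorem contMDiffWithinAt_chart (hF : IsLagrangianAngleFlow τ κ T F ν)
    (hc : c ∈ IsManifold.maximalAtlas (𝓡 n) ∞ M) {z : EuclideanSpace ℝ (Fin n) × ℝ}
    (hz : InCharts c e T F z) :
    ContMDiffWithinAt ((𝓡 n).prod 𝓘(ℝ, ℝ)) (𝓡 (n + 1)) ∞
      (fun w : EuclideanSpace ℝ (Fin n) × ℝ ↦ F (c.symm w.1) w.2) (paramSet n T) z := by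
  have h1 := hF.smooth (c.symm z.1, z.2) ⟨mem_univ _, hz.time⟩
  have h2 : ContMDiffAt ((𝓡 n).prod 𝓘(ℝ, ℝ)) ((𝓡 n).prod 𝓘(ℝ, ℝ)) ∞
      (fun w : EuclideanSpace ℝ (Fin n) × ℝ ↦ (c.symm w.1, w.2)) z :=
    ((contMDiffAt_symm_of_mem_maximalAtlas hc hz.space).comp z contMDiffAt_fst).prodMk
      contMDiffAt_snd
  have h3 : MapsTo (fun w : EuclideanSpace ℝ (Fin n) × ℝ ↦ (c.symm w.1, w.2)) (paramSet n T)
      (univ ×ˢ timeInterval T) := fun w hw ↦ ⟨mem_univ _, hw.2⟩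
  exact h1.comp z h2.contMDiffWithinAt h3

theorem contDiffWithinAt_flowMap (hF : IsLagrangianAngleFlow τ κ T F ν)
    (hc : c ∈ IsManifold.maximalAtlas (𝓡 n) ∞ M)
    (he : e ∈ IsManifold.maximalAtlas (𝓡 (n + 1)) ∞ N) {z : EuclideanSpace ℝ (Fin n) × ℝ}
    (hz : InCharts c e T F z) : ContDiffWithinAt ℝ ∞ (flowMap c e F) (paramSet n T) z := by
  have h1 := (contMDiffAt_of_mem_maximalAtlas he hz.image).comp_contMDiffWithinAt z
    (hF.contMDiffWithinAt_chart hc hz)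
  rw [← modelWithCornersSelf_prod, chartedSpaceSelf_prod] at h1
  exact h1.contDiffWithinAt

theorem eventually_inCharts (hF : IsLagrangianAngleFlow τ κ T F ν)
    (hc : c ∈ IsManifold.maximalAtlas (𝓡 n) ∞ M) {z : EuclideanSpace ℝ (Fin n) × ℝ}
    (hz : InCharts c e T F z) : ∀ᶠ w in 𝓝[paramSet n T] z, InCharts c e T F w := by
  have h1 := (hF.contMDiffWithinAt_chart hc hz).continuousWithinAt.eventually
    (e.open_source.mem_nhds hz.image)
  have h2 : ∀ᶠ w in 𝓝[paramSet n T] z, w.1 ∈ c.target :=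
    nhdsWithin_le_nhds (continuous_fst.continuousAt.eventually (c.open_target.mem_nhds hz.space))
  filter_upwards [h1, h2, self_mem_nhdsWithin] with w hw1 hw2 hw3 using ⟨hw2, hw3.2, hw1⟩

theorem mdifferentiableAt_space (hF : IsLagrangianAngleFlow τ κ T F ν) {t : ℝ}
    (ht : t ∈ timeInterval T) (p : M) :
    MDifferentiableAt (𝓡 n) (𝓡 (n + 1)) (fun q ↦ F q t) p := by
  have h1 := hF.smooth (p, t) ⟨mem_univ _, ht⟩
  have h2 : ContMDiffAt (𝓡 n) ((𝓡 n).prod 𝓘(ℝ, ℝ)) ∞ (fun q : M ↦ (q, t)) p :=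
    contMDiffAt_id.prodMk contMDiffAt_const
  have h3 := h1.comp (s := univ) p h2.contMDiffWithinAt
    fun w hw ↦ Set.mem_prod.2 ⟨mem_univ _, ht⟩
  exact (h3.contMDiffAt univ_mem).mdifferentiableAt (by simp)

theorem hasFDerivWithinAt_flowMap (hF : IsLagrangianAngleFlow τ κ T F ν)
    (hc : c ∈ IsManifold.maximalAtlas (𝓡 n) ∞ M)
    (he : e ∈ IsManifold.maximalAtlas (𝓡 (n + 1)) ∞ N) {z : EuclideanSpace ℝ (Fin n) × ℝ}
    (hz : InCharts c e T F z) : HasFDerivWithinAt (flowMap c e F)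
      (fderivWithin ℝ (flowMap c e F) (paramSet n T) z) (paramSet n T) z :=
  ((hF.contDiffWithinAt_flowMap hc he hz).differentiableWithinAt (by simp)).hasFDerivWithinAt

/-- Restriction of a derivative on the parameter domain to the space variables. -/
theorem _root_.AdSFlow.hasFDerivAt_space {E : Type*} [NormedAddCommGroup E] [NormedSpace ℝ E]
    {f : EuclideanSpace ℝ (Fin n) × ℝ → E} {f' : EuclideanSpace ℝ (Fin n) × ℝ →L[ℝ] E}
    {z : EuclideanSpace ℝ (Fin n) × ℝ} (hz : z ∈ paramSet n T)
    (h : HasFDerivWithinAt f f' (paramSet n T) z) :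
    HasFDerivAt (fun x ↦ f (x, z.2)) (f'.comp (ContinuousLinearMap.inl ℝ _ ℝ)) z.1 := by
  have h1 : HasFDerivWithinAt (fun x : EuclideanSpace ℝ (Fin n) ↦ (x, z.2))
      (ContinuousLinearMap.inl ℝ _ ℝ) univ z.1 :=
    (hasFDerivAt_prodMk_left z.1 z.2).hasFDerivWithinAt
  have h2 : HasFDerivWithinAt f f' (paramSet n T) (z.1, z.2) := h
  exact (h2.comp z.1 h1 fun x _ ↦ Set.mem_prod.2 ⟨mem_univ _, hz.2⟩).hasFDerivAt univ_mem

theorem components_differential_eq (hF : IsLagrangianAngleFlow τ κ T F ν)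
    (hc : c ∈ IsManifold.maximalAtlas (𝓡 n) ∞ M)
    (he : e ∈ IsManifold.maximalAtlas (𝓡 (n + 1)) ∞ N) {z : EuclideanSpace ℝ (Fin n) × ℝ}
    (hz : InCharts c e T F z) (V : TangentSpace (𝓡 n) (c.symm z.1)) :
    components e (F (c.symm z.1) z.2) (differential (fun q ↦ F q z.2) (c.symm z.1) V) =
      fderivWithin ℝ (flowMap c e F) (paramSet n T) z
        (mfderiv (𝓡 n) (𝓡 n) c (c.symm z.1) V, 0) := by
  have h1 := components_differential (F := fun q ↦ F q z.2) hc hz.source he hz.image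
    (hF.mdifferentiableAt_space hz.time _) V
  have h2 := hasFDerivAt_space hz.mem (hF.hasFDerivWithinAt_flowMap hc he hz)
  rw [h1, c.right_inv hz.space]
  have h3 : fderiv ℝ (chartMap c e fun q ↦ F q z.2) z.1 = _ := h2.fderiv
  rw [h3]
  rfl

theorem fderivWithin_flowMap_eq (hF : IsLagrangianAngleFlow τ κ T F ν)
    (hc : c ∈ IsManifold.maximalAtlas (𝓡 n) ∞ M)
    (he : e ∈ IsManifold.maximalAtlas (𝓡 (n + 1)) ∞ N) {z : EuclideanSpace ℝ (Fin n) × ℝ}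
    (hz : InCharts c e T F z) (v : EuclideanSpace ℝ (Fin n)) :
    fderivWithin ℝ (flowMap c e F) (paramSet n T) z (v, 0) =
      components e (F (c.symm z.1) z.2) (differential (fun q ↦ F q z.2) (c.symm z.1)
        (mfderiv (𝓡 n) (𝓡 n) c.symm z.1 v)) := by
  rw [hF.components_differential_eq hc he hz]
  exact congrArg (fun w : EuclideanSpace ℝ (Fin n) ↦
    fderivWithin ℝ (flowMap c e F) (paramSet n T) z (w, 0))
    (mfderiv_mfderiv_symm hc hz.space v).symm

theorem metricForm_flowMap (he : e ∈ IsManifold.maximalAtlas (𝓡 (n + 1)) ∞ N)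
    {z : EuclideanSpace ℝ (Fin n) × ℝ}
    (hz : InCharts c e T F z) (v w : TangentSpace (𝓡 (n + 1)) (F (c.symm z.1) z.2)) :
    metricForm g e (flowMap c e F z) (components e (F (c.symm z.1) z.2) v)
      (components e (F (c.symm z.1) z.2) w) = g.val (F (c.symm z.1) z.2) v w :=
  metricForm_components_chart he hz.image v w

theorem normal_self (hF : IsLagrangianAngleFlow τ κ T F ν)
    (he : e ∈ IsManifold.maximalAtlas (𝓡 (n + 1)) ∞ N) {z : EuclideanSpace ℝ (Fin n) × ℝ}
    (hz : InCharts c e T F z) :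
    metricForm g e (flowMap c e F z) (flowField c e F ν z) (flowField c e F ν z) = -1 := by
  rw [flowField, metricForm_flowMap he hz]
  exact (hF.normal z.2 hz.time _).1

theorem normal_tangent (hF : IsLagrangianAngleFlow τ κ T F ν)
    (hc : c ∈ IsManifold.maximalAtlas (𝓡 n) ∞ M)
    (he : e ∈ IsManifold.maximalAtlas (𝓡 (n + 1)) ∞ N) {z : EuclideanSpace ℝ (Fin n) × ℝ}
    (hz : InCharts c e T F z) (v : EuclideanSpace ℝ (Fin n)) :
    metricForm g e (flowMap c e F z) (flowField c e F ν z)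
      (fderivWithin ℝ (flowMap c e F) (paramSet n T) z (v, 0)) = 0 := by
  rw [hF.fderivWithin_flowMap_eq hc he hz, flowField, metricForm_flowMap he hz]
  exact (hF.normal z.2 hz.time _).2.1 _

theorem mfderiv_symm_ne_zero (hc : c ∈ IsManifold.maximalAtlas (𝓡 n) ∞ M)
    {x : EuclideanSpace ℝ (Fin n)} (hx : x ∈ c.target) {v : EuclideanSpace ℝ (Fin n)}
    (hv : v ≠ 0) : mfderiv (𝓡 n) (𝓡 n) c.symm x v ≠ 0 := by
  intro h
  apply hv
  have := mfderiv_mfderiv_symm hc hx v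
  rw [h, map_zero] at this
  exact this.symm

theorem tangent_pos (hF : IsLagrangianAngleFlow τ κ T F ν)
    (hc : c ∈ IsManifold.maximalAtlas (𝓡 n) ∞ M)
    (he : e ∈ IsManifold.maximalAtlas (𝓡 (n + 1)) ∞ N) {z : EuclideanSpace ℝ (Fin n) × ℝ}
    (hz : InCharts c e T F z) {v : EuclideanSpace ℝ (Fin n)} (hv : v ≠ 0) :
    0 < metricForm g e (flowMap c e F z)
      (fderivWithin ℝ (flowMap c e F) (paramSet n T) z (v, 0))
      (fderivWithin ℝ (flowMap c e F) (paramSet n T) z (v, 0)) := by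
  rw [hF.fderivWithin_flowMap_eq hc he hz, metricForm_flowMap he hz]
  exact (hF.spacelike z.2 hz.time _).2 _ (mfderiv_symm_ne_zero hc hz.space hv)

/-- The coordinate expression of the time orientation. -/
def _root_.AdSFlow.orientationField (τ : TimeOrientation g)
    (e : OpenPartialHomeomorph N (EuclideanSpace ℝ (Fin (n + 1))))
    (y : EuclideanSpace ℝ (Fin (n + 1))) : EuclideanSpace ℝ (Fin (n + 1)) :=
  components e (e.symm y) (τ.field (e.symm y))

theorem normal_orientation (hF : IsLagrangianAngleFlow τ κ T F ν)
    (he : e ∈ IsManifold.maximalAtlas (𝓡 (n + 1)) ∞ N) {z : EuclideanSpace ℝ (Fin n) × ℝ}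
    (hz : InCharts c e T F z) :
    metricForm g e (flowMap c e F z) (flowField c e F ν z)
      (orientationField τ e (flowMap c e F z)) < 0 := by
  have h1 : orientationField τ e (flowMap c e F z) =
      components e (F (c.symm z.1) z.2) (τ.field (F (c.symm z.1) z.2)) := by
    rw [orientationField, flowMap, e.left_inv hz.image]
  rw [h1, flowField, metricForm_flowMap he hz]
  exact (hF.normal z.2 hz.time _).2.2.2

theorem contDiffWithinAt_fderiv (hF : IsLagrangianAngleFlow τ κ T F ν)
    (hc : c ∈ IsManifold.maximalAtlas (𝓡 n) ∞ M)
    (he : e ∈ IsManifold.maximalAtlas (𝓡 (n + 1)) ∞ N) {z : EuclideanSpace ℝ (Fin n) × ℝ}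
    (hz : InCharts c e T F z) (a : EuclideanSpace ℝ (Fin n) × ℝ) :
    ContDiffWithinAt ℝ ∞ (fun w ↦ fderivWithin ℝ (flowMap c e F) (paramSet n T) w a)
      (paramSet n T) z :=
  ((hF.contDiffWithinAt_flowMap hc he hz).fderivWithin_right (m := ∞)
    (uniqueDiffOn_paramSet n T) (by simp) hz.mem).clm_apply contDiffWithinAt_const

theorem contDiffWithinAt_metricForm (hF : IsLagrangianAngleFlow τ κ T F ν)
    (hc : c ∈ IsManifold.maximalAtlas (𝓡 n) ∞ M)
    (he : e ∈ IsManifold.maximalAtlas (𝓡 (n + 1)) ∞ N) {z : EuclideanSpace ℝ (Fin n) × ℝ}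
    (hz : InCharts c e T F z) :
    ContDiffWithinAt ℝ ∞ (fun w ↦ metricForm g e (flowMap c e F w)) (paramSet n T) z :=
  (contDiffAt_metricForm he hz.target).comp_contDiffWithinAt z
    (hF.contDiffWithinAt_flowMap hc he hz)

theorem contDiffWithinAt_flowField (hF : IsLagrangianAngleFlow τ κ T F ν)
    (hc : c ∈ IsManifold.maximalAtlas (𝓡 n) ∞ M)
    (he : e ∈ IsManifold.maximalAtlas (𝓡 (n + 1)) ∞ N) {z : EuclideanSpace ℝ (Fin n) × ℝ}
    (hz : InCharts c e T F z) : ContDiffWithinAt ℝ ∞ (flowField c e F ν) (paramSet n T) z := by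
  have hev := hF.eventually_inCharts hc hz
  refine contDiffWithinAt_normal (X := EuclideanSpace ℝ (Fin n)) (by simp)
    (B := fun w ↦ metricForm g e (flowMap c e F w))
    (L := fun w ↦ (fderivWithin ℝ (flowMap c e F) (paramSet n T) w).comp
      (ContinuousLinearMap.inl ℝ _ ℝ))
    (τ := fun w ↦ orientationField τ e (flowMap c e F w)) hz.mem
    (hF.contDiffWithinAt_metricForm hc he hz) (fun v ↦ hF.contDiffWithinAt_fderiv hc he hz (v, 0))
    ((contDiffAt_fieldComponents he τ.contMDiff hz.target).comp_contDiffWithinAt z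
      (hF.contDiffWithinAt_flowMap hc he hz))
    (fun x ↦ metricForm_symm _) ?_ ?_ ?_ ?_
  · filter_upwards [hev] with w hw using hF.normal_self he hw
  · filter_upwards [hev] with w hw using hF.normal_tangent hc he hw
  · filter_upwards [hev] with w hw using hF.normal_orientation he hw
  · filter_upwards [hev] with w hw v hv using hF.tangent_pos hc he hw hv

theorem evolution_flowMap (hF : IsLagrangianAngleFlow τ κ T F ν)
    (hc : c ∈ IsManifold.maximalAtlas (𝓡 n) ∞ M)
    (he : e ∈ IsManifold.maximalAtlas (𝓡 (n + 1)) ∞ N) {z : EuclideanSpace ℝ (Fin n) × ℝ}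
    (hz : InCharts c e T F z) :
    fderivWithin ℝ (flowMap c e F) (paramSet n T) z (0, 1) =
      flowAngle g κ c F ν z • flowField c e F ν z := by
  have h1 := hF.evolution (c.symm z.1) z.2 hz.time
  have h2 := ((mdifferentiable_of_mem_maximalAtlas he).mdifferentiableAt
    hz.image).hasMFDerivAt.comp_hasMFDerivWithinAt z.2 h1
  have h3 := h2.hasFDerivWithinAt
  have h4 : HasFDerivWithinAt (fun t : ℝ ↦ (z.1, t))
      (ContinuousLinearMap.inr ℝ (EuclideanSpace ℝ (Fin n)) ℝ) (timeInterval T) z.2 :=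
    (hasFDerivAt_prodMk_right z.1 z.2).hasFDerivWithinAt
  have h5 : HasFDerivWithinAt (flowMap c e F) _ (paramSet n T) (z.1, z.2) :=
    hF.hasFDerivWithinAt_flowMap hc he hz
  have h6 := h5.comp z.2 h4 fun t ht ↦ Set.mem_prod.2 ⟨mem_univ _, ht⟩
  -- The joint derivative restricted to time and the derivative in the flow equation agree because
  -- derivatives within the interval are unique, also one-sidedly at `0`.
  have h7 := DFunLike.congr_fun ((uniqueDiffOn_timeInterval T z.2 hz.time).eq h6 h3) (1 : ℝ)
  have h8 : fderivWithin ℝ (flowMap c e F) (paramSet n T) z (0, 1) =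
      components e (F (c.symm z.1) z.2)
        ((1 : ℝ) • (lagrangianAngle g κ (fun q ↦ F q z.2) (fun q ↦ ν q z.2) (c.symm z.1) •
          ν (c.symm z.1) z.2)) := h7
  rw [h8, one_smul]
  exact map_smul (mfderiv (𝓡 (n + 1)) (𝓡 (n + 1)) e (F (c.symm z.1) z.2)) _ _

/-- The source of regularity for the angle: it rewrites a sum over roots of a characteristic
polynomial as an expression in smooth quantities. -/
theorem flowAngle_eq (hF : IsLagrangianAngleFlow τ κ T F ν)
    (hc : c ∈ IsManifold.maximalAtlas (𝓡 n) ∞ M)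
    (he : e ∈ IsManifold.maximalAtlas (𝓡 (n + 1)) ∞ N) {z : EuclideanSpace ℝ (Fin n) × ℝ}
    (hz : InCharts c e T F z) :
    flowAngle g κ c F ν z = -metricForm g e (flowMap c e F z)
      (fderivWithin ℝ (flowMap c e F) (paramSet n T) z (0, 1)) (flowField c e F ν z) := by
  rw [hF.evolution_flowMap hc he hz, map_smul, smul_apply, hF.normal_self he hz]
  simp

theorem contDiffWithinAt_flowAngle (hF : IsLagrangianAngleFlow τ κ T F ν)
    (hc : c ∈ IsManifold.maximalAtlas (𝓡 n) ∞ M)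
    (he : e ∈ IsManifold.maximalAtlas (𝓡 (n + 1)) ∞ N) {z : EuclideanSpace ℝ (Fin n) × ℝ}
    (hz : InCharts c e T F z) :
    ContDiffWithinAt ℝ ∞ (flowAngle g κ c F ν) (paramSet n T) z := by
  have h1 := (((hF.contDiffWithinAt_metricForm hc he hz).clm_apply
    (hF.contDiffWithinAt_fderiv hc he hz (0, 1))).clm_apply
    (hF.contDiffWithinAt_flowField hc he hz)).neg
  refine h1.congr_of_eventuallyEq_of_mem ?_ hz.mem
  filter_upwards [hF.eventually_inCharts hc hz] with w hw using hF.flowAngle_eq hc he hw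

end IsLagrangianAngleFlow

end FlowInCharts

/-! ### Positive times: two-sided derivatives and the evolution of the angle. -/

section InteriorTimes

open Filter Topology

variable {n : ℕ} {N : Type*} [TopologicalSpace N]
  [ChartedSpace (EuclideanSpace ℝ (Fin (n + 1))) N] [IsManifold (𝓡 (n + 1)) ∞ N]
  {M : Type*} [TopologicalSpace M] [ChartedSpace (EuclideanSpace ℝ (Fin n)) M]
  {g : LorentzMetric n N} {τ : TimeOrientation g} {κ : ℝ} {T : EReal} {F : M → ℝ → N}
  {ν : ∀ (p : M) (t : ℝ), TangentSpace (𝓡 (n + 1)) (F p t)}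
  {e : OpenPartialHomeomorph N (EuclideanSpace ℝ (Fin (n + 1)))}
  {c : OpenPartialHomeomorph M (EuclideanSpace ℝ (Fin n))}

namespace IsLagrangianAngleFlow

theorem isNormalFlowAt (hF : IsLagrangianAngleFlow τ κ T F ν)
    (hc : c ∈ IsManifold.maximalAtlas (𝓡 n) ∞ M)
    (he : e ∈ IsManifold.maximalAtlas (𝓡 (n + 1)) ∞ N) {z : EuclideanSpace ℝ (Fin n) × ℝ}
    (hz : InCharts c e T F z) (h0 : 0 < z.2) :
    IsNormalFlowAt (metricForm g e) (connectionForm g e) (flowMap c e F) (flowField c e F ν)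
      (flowAngle g κ c F ν) z := by
  have hS := hz.paramSet_mem_nhds h0
  have hfd := fderivWithin_of_mem_nhds (𝕜 := ℝ) (f := flowMap c e F) hS
  exact
    { smooth := (hF.contDiffWithinAt_flowMap hc he hz).contDiffAt hS
      smooth_normal := (hF.contDiffWithinAt_flowField hc he hz).contDiffAt hS
      smooth_speed := (hF.contDiffWithinAt_flowAngle hc he hz).contDiffAt hS
      metric := differentiableAt_metricForm he hz.target
      connection := differentiableAt_connectionForm he hz.target
      leviCivita := isLeviCivitaAt_connectionForm he hz.target
      metric_symm := metricForm_symm _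
      normal_self := hF.normal_self he hz
      normal_tangent := fun v ↦ by rw [← hfd]; exact hF.normal_tangent hc he hz v
      evolution := by rw [← hfd]; exact hF.evolution_flowMap hc he hz }

theorem eventually_inCharts_pos (hF : IsLagrangianAngleFlow τ κ T F ν)
    (hc : c ∈ IsManifold.maximalAtlas (𝓡 n) ∞ M) {z : EuclideanSpace ℝ (Fin n) × ℝ}
    (hz : InCharts c e T F z) (h0 : 0 < z.2) :
    ∀ᶠ w in 𝓝 z, InCharts c e T F w ∧ 0 < w.2 := by
  have h1 := hF.eventually_inCharts hc hz
  rw [nhdsWithin_eq_nhds.2 (hz.paramSet_mem_nhds h0)] at h1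
  exact h1.and (continuous_snd.continuousAt.eventually (lt_mem_nhds h0))

theorem tangent_pos_fderiv (hF : IsLagrangianAngleFlow τ κ T F ν)
    (hc : c ∈ IsManifold.maximalAtlas (𝓡 n) ∞ M)
    (he : e ∈ IsManifold.maximalAtlas (𝓡 (n + 1)) ∞ N) {z : EuclideanSpace ℝ (Fin n) × ℝ}
    (hz : InCharts c e T F z) (h0 : 0 < z.2) {v : EuclideanSpace ℝ (Fin n)} (hv : v ≠ 0) :
    0 < metricForm g e (flowMap c e F z) (fderiv ℝ (flowMap c e F) z (v, 0))
      (fderiv ℝ (flowMap c e F) z (v, 0)) := by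
  rw [← fderivWithin_of_mem_nhds (𝕜 := ℝ) (f := flowMap c e F) (hz.paramSet_mem_nhds h0)]
  exact hF.tangent_pos hc he hz hv

theorem exists_tangent_add_normal (hF : IsLagrangianAngleFlow τ κ T F ν)
    (hc : c ∈ IsManifold.maximalAtlas (𝓡 n) ∞ M)
    (he : e ∈ IsManifold.maximalAtlas (𝓡 (n + 1)) ∞ N) {z : EuclideanSpace ℝ (Fin n) × ℝ}
    (hz : InCharts c e T F z) (h0 : 0 < z.2) (u : EuclideanSpace ℝ (Fin (n + 1))) :
    ∃ (v : EuclideanSpace ℝ (Fin n)) (s : ℝ),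
      u = fderiv ℝ (flowMap c e F) z (v, 0) + s • flowField c e F ν z :=
  AdSFlow.exists_tangent_add_normal (by simp) (hF.normal_self he hz)
    (L := (fderiv ℝ (flowMap c e F) z).comp (ContinuousLinearMap.inl ℝ _ ℝ))
    (hF.isNormalFlowAt hc he hz h0).normal_tangent
    (fun _ hv ↦ hF.tangent_pos_fderiv hc he hz h0 hv) u

theorem components_covDeriv_eq (hF : IsLagrangianAngleFlow τ κ T F ν)
    (hc : c ∈ IsManifold.maximalAtlas (𝓡 n) ∞ M)
    (he : e ∈ IsManifold.maximalAtlas (𝓡 (n + 1)) ∞ N) {z : EuclideanSpace ℝ (Fin n) × ℝ}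
    (hz : InCharts c e T F z) (h0 : 0 < z.2) (V : TangentSpace (𝓡 n) (c.symm z.1)) :
    components e (F (c.symm z.1) z.2)
      (covDeriv g (fun q ↦ F q z.2) (fun q ↦ ν q z.2) (c.symm z.1) V) =
      covAlong (connectionForm g e) (flowMap c e F) (flowField c e F ν)
        (mfderiv (𝓡 n) (𝓡 n) c (c.symm z.1) V, 0) z := by
  have hflow := hF.isNormalFlowAt hc he hz h0
  have h1 := hasFDerivAt_space hz.mem hflow.diff.hasFDerivAt.hasFDerivWithinAt
  have h2 := hasFDerivAt_space hz.mem hflow.diff_normal.hasFDerivAt.hasFDerivWithinAt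
  have h3 : DifferentiableAt ℝ (chartField c e (fun q ↦ F q z.2) (fun q ↦ ν q z.2))
      (c (c.symm z.1)) := by
    rw [c.right_inv hz.space]
    exact h2.differentiableAt
  rw [components_covDeriv (F := fun q ↦ F q z.2) hc hz.source he hz.image
    (hF.mdifferentiableAt_space hz.time _) h3 V, c.right_inv hz.space]
  have h4 : fderiv ℝ (chartMap c e fun q ↦ F q z.2) z.1 = _ := h1.fderiv
  have h5 : fderiv ℝ (chartField c e (fun q ↦ F q z.2) fun q ↦ ν q z.2) z.1 = _ := h2.fderiv
  simp only [covAlong, h4, h5]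
  rfl

/-- Since `ν` has constant length, `∇_v ν` is orthogonal to `ν` and thus tangent. Injectivity of the
differential makes its preimage unique, hence linear in `v`. -/
theorem exists_shape (hF : IsLagrangianAngleFlow τ κ T F ν)
    (hc : c ∈ IsManifold.maximalAtlas (𝓡 n) ∞ M)
    (he : e ∈ IsManifold.maximalAtlas (𝓡 (n + 1)) ∞ N) {z : EuclideanSpace ℝ (Fin n) × ℝ}
    (hz : InCharts c e T F z) (h0 : 0 < z.2) :
    ∃ W : EuclideanSpace ℝ (Fin n) →ₗ[ℝ] EuclideanSpace ℝ (Fin n), ∀ v,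
      fderiv ℝ (flowMap c e F) z (W v, 0) =
        covAlong (connectionForm g e) (flowMap c e F) (flowField c e F ν) (v, 0) z := by
  have hflow : ∀ᶠ w in 𝓝 z, IsNormalFlowAt (metricForm g e) (connectionForm g e)
      (flowMap c e F) (flowField c e F ν) (flowAngle g κ c F ν) w := by
    filter_upwards [hF.eventually_inCharts_pos hc hz h0] with w hw
    exact hF.isNormalFlowAt hc he hw.1 hw.2
  let L : EuclideanSpace ℝ (Fin n) →L[ℝ] EuclideanSpace ℝ (Fin (n + 1)) :=
    (fderiv ℝ (flowMap c e F) z).comp (ContinuousLinearMap.inl ℝ _ ℝ)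
  let K : EuclideanSpace ℝ (Fin n) →L[ℝ] EuclideanSpace ℝ (Fin (n + 1)) :=
    (fderiv ℝ (flowField c e F ν) z + ((connectionForm g e (flowMap c e F z)).flip
      (flowField c e F ν z)).comp (fderiv ℝ (flowMap c e F) z)).comp
      (ContinuousLinearMap.inl ℝ _ ℝ)
  have hK : ∀ v, K v = covAlong (connectionForm g e) (flowMap c e F) (flowField c e F ν)
      (v, 0) z := fun v ↦ rfl
  have hL : ∀ v, L v = fderiv ℝ (flowMap c e F) z (v, 0) := fun v ↦ rfl
  have hinj : Function.Injective L := by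
    rw [injective_iff_map_eq_zero]
    intro v hv
    by_contra hne
    have := hF.tangent_pos_fderiv hc he hz h0 hne
    rw [← hL, hv] at this
    simp at this
  have hrange : ∀ v, ∃ w, L w = K v := by
    intro v
    obtain ⟨w, s, hws⟩ := hF.exists_tangent_add_normal hc he hz h0 (K v)
    have h1 := IsNormalFlowAt.normal_covAlong hflow (v, 0)
    have hz' := hflow.self_of_nhds
    rw [← hK, hws, map_add, map_smul, hz'.normal_tangent, hz'.normal_self] at h1
    have hs : s = 0 := by simpa using h1
    rw [hs, zero_smul, add_zero] at hws
    exact ⟨w, hws.symm⟩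
  choose W hW using hrange
  refine ⟨{ toFun := W, map_add' := fun v w ↦ hinj ?_, map_smul' := fun a v ↦ hinj ?_ },
    fun v ↦ hW v⟩
  · rw [hW, map_add, map_add, hW, hW]
  · rw [hW, map_smul, RingHom.id_apply, map_smul, hW]

/-- The chart differential conjugates the coordinate map `W` to a Weingarten map on `M`, which is
unique because the differential of the immersion is injective. In particular `weingarten` is not its
default value `0` here. -/
theorem weingarten_charpoly (hF : IsLagrangianAngleFlow τ κ T F ν)
    (hc : c ∈ IsManifold.maximalAtlas (𝓡 n) ∞ M)
    (he : e ∈ IsManifold.maximalAtlas (𝓡 (n + 1)) ∞ N) {z : EuclideanSpace ℝ (Fin n) × ℝ}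
    (hz : InCharts c e T F z) (h0 : 0 < z.2)
    {W : EuclideanSpace ℝ (Fin n) →ₗ[ℝ] EuclideanSpace ℝ (Fin n)}
    (hW : ∀ v, fderiv ℝ (flowMap c e F) z (W v, 0) =
      covAlong (connectionForm g e) (flowMap c e F) (flowField c e F ν) (v, 0) z) :
    (weingarten g (fun q ↦ F q z.2) (fun q ↦ ν q z.2) (c.symm z.1)).charpoly = W.charpoly := by
  let A : TangentSpace (𝓡 n) (c.symm z.1) ≃ₗ[ℝ] EuclideanSpace ℝ (Fin n) :=
    ((mdifferentiable_of_mem_maximalAtlas hc).mfderiv hz.source).toLinearEquiv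
  have hA : ∀ V, A V = mfderiv (𝓡 n) (𝓡 n) c (c.symm z.1) V := fun V ↦ rfl
  have hcomp : Function.Injective (components e (F (c.symm z.1) z.2)) :=
    (mdifferentiable_of_mem_maximalAtlas he).mfderiv_injective hz.image
  have h1 : IsWeingartenMap g (fun q ↦ F q z.2) (fun q ↦ ν q z.2) (c.symm z.1)
      (A.symm.conj W) := by
    intro V
    apply hcomp
    rw [hF.components_covDeriv_eq hc he hz h0]
    refine (hF.components_differential_eq hc he hz _).trans ?_
    rw [fderivWithin_of_mem_nhds (hz.paramSet_mem_nhds h0), ← hA, ← hA, ← hW]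
    simp [LinearEquiv.conj_apply]
  have hex : ∃ W', IsWeingartenMap g (fun q ↦ F q z.2) (fun q ↦ ν q z.2) (c.symm z.1) W' :=
    ⟨_, h1⟩
  have h2 : IsWeingartenMap g (fun q ↦ F q z.2) (fun q ↦ ν q z.2) (c.symm z.1)
      (weingarten g (fun q ↦ F q z.2) (fun q ↦ ν q z.2) (c.symm z.1)) := by
    rw [weingarten, dif_pos hex]
    exact hex.choose_spec
  have h3 : weingarten g (fun q ↦ F q z.2) (fun q ↦ ν q z.2) (c.symm z.1) = A.symm.conj W := by
    ext1 V
    exact (hF.spacelike z.2 hz.time (c.symm z.1)).1 ((h2 V).trans (h1 V).symm)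
  rw [h3, LinearEquiv.charpoly_conj]

/-- The evolution equation of the Lagrangian angle at a critical point. -/
theorem exists_fderiv_flowAngle_eq (hF : IsLagrangianAngleFlow τ κ T F ν) (hκ : 0 < κ)
    (hg : HasConstantSectionalCurvature g (-κ))
    (hc : c ∈ IsManifold.maximalAtlas (𝓡 n) ∞ M)
    (he : e ∈ IsManifold.maximalAtlas (𝓡 (n + 1)) ∞ N) {z : EuclideanSpace ℝ (Fin n) × ℝ}
    (hz : InCharts c e T F z) (h0 : 0 < z.2)
    (hcrit : ∀ v, fderiv ℝ (flowAngle g κ c F ν) z (v, 0) = 0) :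
    ∃ (b : Fin n → EuclideanSpace ℝ (Fin n)) (l : Fin n → ℝ),
      fderiv ℝ (flowAngle g κ c F ν) z (0, 1) =
        (∑ i, fderiv ℝ (fderiv ℝ (flowAngle g κ c F ν)) z (b i, 0) (b i, 0) / (κ + l i ^ 2))
          - n * flowAngle g κ c F ν z := by
  have hev := hF.eventually_inCharts_pos hc hz h0
  have hflow : ∀ᶠ w in 𝓝 z, IsNormalFlowAt (metricForm g e) (connectionForm g e)
      (flowMap c e F) (flowField c e F ν) (flowAngle g κ c F ν) w := by
    filter_upwards [hev] with w hw using hF.isNormalFlowAt hc he hw.1 hw.2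
  have hW : ∀ᶠ w in 𝓝 z, ∃ W : EuclideanSpace ℝ (Fin n) →ₗ[ℝ] EuclideanSpace ℝ (Fin n),
      ∀ v, fderiv ℝ (flowMap c e F) w (W v, 0) =
        covAlong (connectionForm g e) (flowMap c e F) (flowField c e F ν) (v, 0) w := by
    filter_upwards [hev] with w hw using hF.exists_shape hc he hw.1 hw.2
  -- A choice at each nearby point is enough: no regularity of `W` in the point is used.
  obtain ⟨W, hW⟩ := Filter.skolem.1 hW
  have hzero : fderiv ℝ (flowMap c e F) z ((0 : EuclideanSpace ℝ (Fin n)), (0 : ℝ)) = 0 :=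
    map_zero (fderiv ℝ (flowMap c e F) z)
  have hz' := hflow.self_of_nhds
  refine IsNormalFlowAt.exists_fderiv_angle_eq (by simp) hκ hflow hW ?_ ?_ hcrit ?_ ?_
  · filter_upwards [hev] with w hw v hv using hF.tangent_pos_fderiv hc he hw.1 hw.2 hv
  · filter_upwards [hev, hW] with w hw hWw
    rw [flowAngle, lagrangianAngle, principalCurvatures,
      hF.weingarten_charpoly hc he hw.1 hw.2 hWw]
  · intro u hu hu'
    obtain ⟨v, s, rfl⟩ := hF.exists_tangent_add_normal hc he hz h0 u
    have hs : s = 0 := by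
      rw [hz'.metric_symm, map_add, map_smul, hz'.normal_tangent, hz'.normal_self] at hu
      simpa using hu
    subst hs
    have hv : v = 0 := by
      by_contra hv
      have h1 := hu' v
      rw [zero_smul, add_zero] at h1
      exact (hF.tangent_pos_fderiv hc he hz h0 hv).ne' h1
    subst hv
    rw [hzero, zero_smul, add_zero]
  · intro v
    by_cases hv : v = 0
    · subst hv
      rw [hzero, map_zero, map_zero, mul_zero]
    · exact hg.metricForm_curvForm he hz.target hz'.normal_self (hz'.normal_tangent v)
        (hF.tangent_pos_fderiv hc he hz h0 hv).ne'

end IsLagrangianAngleFlow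

end InteriorTimes

/-! ### The parabolic maximum principle. -/

section MaximumPrinciple

open Filter Topology

/-- Only earlier times are compared, because the maximum may sit at the end of the time interval
considered. -/
theorem nonneg_of_hasDerivAt_of_le {w : ℝ → ℝ} {w' a s : ℝ} (has : a < s)
    (hw : HasDerivAt w w' s) (h : ∀ r ∈ Icc a s, w r ≤ w s) : 0 ≤ w' := by
  have h1 := (hasDerivAt_iff_tendsto_slope.1 hw).mono_left
    (nhdsWithin_mono s (fun r (hr : r < s) ↦ hr.ne) : 𝓝[<] s ≤ 𝓝[≠] s)
  refine ge_of_tendsto h1 ?_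
  filter_upwards [Ioo_mem_nhdsLT has] with r hr
  rw [slope_def_field]
  exact div_nonneg_of_nonpos (sub_nonpos.2 (h r ⟨hr.1.le, hr.2.le⟩)) (sub_nonpos.2 hr.2.le)

/-- A maximum principle for functions whose time derivative is controlled at spatial maxima. -/
theorem mul_exp_le_of_maximum_principle {M : Type*} [TopologicalSpace M] [CompactSpace M]
    {T : EReal} {u : M → ℝ → ℝ} {a C : ℝ}
    (hu : ContinuousOn (fun x : M × ℝ ↦ u x.1 x.2) (univ ×ˢ timeInterval T))
    (hmax : ∀ p, ∀ t ∈ timeInterval T, 0 < t → (∀ q, u q t ≤ u p t) →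
      ∃ u', HasDerivAt (u p) u' t ∧ u' + a * u p t ≤ 0)
    (hC : ∀ q, u q 0 ≤ C) (p : M) {t : ℝ} (ht : t ∈ timeInterval T) :
    u p t * Real.exp (a * t) ≤ C := by
  by_contra! hlt
  set δ := u p t * Real.exp (a * t) - C with hδ
  have hδ0 : 0 < δ := sub_pos.2 hlt
  have ht0 : 0 ≤ t := ht.1
  -- The penalty `ε s` makes the final inequality strict. It is small enough, `ε t < δ`, for the
  -- penalised function still to exceed `C` somewhere; `t + 1` avoids division by zero.
  set ε := δ / (2 * (t + 1)) with hε
  have hε0 : 0 < ε := by positivity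
  have hεt : ε * t < δ := by
    rw [hε, div_mul_eq_mul_div, div_lt_iff₀ (by positivity)]
    nlinarith
  have hcont : ContinuousOn (fun x : M × ℝ ↦ u x.1 x.2 * Real.exp (a * x.2) - ε * x.2)
      (univ ×ˢ Icc 0 t) :=
    ((hu.mono (prod_mono_right (Icc_subset_timeInterval ht))).mul (by fun_prop)).sub (by fun_prop)
  obtain ⟨⟨q, s⟩, hqs, hqmax⟩ := (isCompact_univ.prod isCompact_Icc).exists_isMaxOn
    ⟨(p, t), ⟨mem_univ _, ht0, le_rfl⟩⟩ hcont
  have hsI : s ∈ Icc 0 t := hqs.2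
  have hle : ∀ q' s', s' ∈ Icc 0 t → u q' s' * Real.exp (a * s') - ε * s' ≤
      u q s * Real.exp (a * s) - ε * s := fun q' s' hs' ↦ hqmax (a := (q', s')) ⟨mem_univ _, hs'⟩
  have hbig : C < u q s * Real.exp (a * s) - ε * s := by
    have := hle p t ⟨ht0, le_rfl⟩
    linarith
  -- At time zero the penalised function is at most `C`, so its maximum is attained later, where
  -- `hmax` applies.
  have hs0 : 0 < s := by
    rcases hsI.1.eq_or_lt with h | h
    · rw [← h] at hbig
      have := hC q
      simp at hbig
      linarith
    · exact h
  have hsp : ∀ q', u q' s ≤ u q s := fun q' ↦ by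
    have := hle q' s hsI
    exact le_of_mul_le_mul_right (by linarith) (Real.exp_pos (a * s))
  obtain ⟨u', hu', hneg⟩ := hmax q s (Icc_subset_timeInterval ht hsI) hs0 hsp
  have hexp : HasDerivAt (fun r ↦ Real.exp (a * r)) (Real.exp (a * s) * a) s := by
    simpa using ((hasDerivAt_id s).const_mul a).exp
  have hder : HasDerivAt (fun r ↦ u q r * Real.exp (a * r) - ε * r)
      (u' * Real.exp (a * s) + u q s * (Real.exp (a * s) * a) - ε) s := by
    simpa using (hu'.fun_mul hexp).fun_sub ((hasDerivAt_id s).const_mul ε)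
  -- The derivative is nonnegative at the maximum, yet by `hmax` it is at most `-ε`.
  have h1 := nonneg_of_hasDerivAt_of_le hs0 hder
    fun r hr ↦ hle q r ⟨hr.1, hr.2.trans hsI.2⟩
  have h2 : (u' + a * u q s) * Real.exp (a * s) ≤ 0 :=
    mul_nonpos_of_nonpos_of_nonneg hneg (Real.exp_pos _).le
  linarith

end MaximumPrinciple

/-! ### The angle on the manifold: continuity and the inequality at extrema. -/

section Conclusion

open Filter Topology

variable {n : ℕ} {N : Type*} [TopologicalSpace N]
  [ChartedSpace (EuclideanSpace ℝ (Fin (n + 1))) N] [IsManifold (𝓡 (n + 1)) ∞ N]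
  {M : Type*} [TopologicalSpace M] [ChartedSpace (EuclideanSpace ℝ (Fin n)) M]
  [IsManifold (𝓡 n) ∞ M]
  {g : LorentzMetric n N} {τ : TimeOrientation g} {κ : ℝ} {T : EReal} {F : M → ℝ → N}
  {ν : ∀ (p : M) (t : ℝ), TangentSpace (𝓡 (n + 1)) (F p t)}

namespace IsLagrangianAngleFlow

theorem inCharts_chartAt (p : M) {t : ℝ} (ht : t ∈ timeInterval T) :
    InCharts (chartAt (EuclideanSpace ℝ (Fin n)) p)
      (chartAt (EuclideanSpace ℝ (Fin (n + 1))) (F p t)) T F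
      (chartAt (EuclideanSpace ℝ (Fin n)) p p, t) where
  space := mem_chart_target _ _
  time := ht
  image := by
    rw [OpenPartialHomeomorph.left_inv _ (mem_chart_source _ _)]
    exact mem_chart_source _ _

theorem continuousOn_angle (hF : IsLagrangianAngleFlow τ κ T F ν) :
    ContinuousOn (fun x : M × ℝ ↦
      lagrangianAngle g κ (fun q ↦ F q x.2) (fun q ↦ ν q x.2) x.1) (univ ×ˢ timeInterval T) := by
  rintro ⟨p, t⟩ ⟨-, ht⟩
  set c := chartAt (EuclideanSpace ℝ (Fin n)) p
  have h1 := (hF.contDiffWithinAt_flowAngle (IsManifold.chart_mem_maximalAtlas p)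
    (IsManifold.chart_mem_maximalAtlas (F p t)) (inCharts_chartAt p ht)).continuousWithinAt
  have h2 : ContinuousAt (fun x : M × ℝ ↦ (c x.1, x.2)) (p, t) :=
    ((c.continuousAt (mem_chart_source _ p)).comp' continuous_fst.continuousAt).prodMk
      continuous_snd.continuousAt
  have h3 : MapsTo (fun x : M × ℝ ↦ (c x.1, x.2)) (univ ×ˢ timeInterval T) (paramSet n T) :=
    fun x hx ↦ ⟨mem_univ _, hx.2⟩
  have h4 := ContinuousWithinAt.comp (f := fun x : M × ℝ ↦ (c x.1, x.2)) (x := (p, t)) h1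
    h2.continuousWithinAt h3
  have h5 : ∀ᶠ x : M × ℝ in 𝓝 (p, t), x.1 ∈ c.source :=
    continuous_fst.continuousAt.eventually (c.open_source.mem_nhds (mem_chart_source _ p))
  refine h4.congr_of_eventuallyEq ?_ ?_
  · filter_upwards [nhdsWithin_le_nhds h5] with x hx
    simp only [Function.comp, flowAngle]
    rw [c.left_inv hx]
  · simp only [Function.comp, flowAngle]
    rw [c.left_inv (mem_chart_source _ p)]

/-- The time derivative of the Lagrangian angle at a spatial extremum; the sign `σ = ±1`
distinguishes maxima from minima. -/
theorem exists_hasDerivAt_angle (hF : IsLagrangianAngleFlow τ κ T F ν) (hκ : 0 < κ)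
    (hg : HasConstantSectionalCurvature g (-κ)) {σ : ℝ} (hσ : σ ≠ 0) (p : M) {t : ℝ}
    (ht : t ∈ timeInterval T) (h0 : 0 < t)
    (hmax : ∀ q, σ * lagrangianAngle g κ (fun q ↦ F q t) (fun q ↦ ν q t) q ≤
      σ * lagrangianAngle g κ (fun q ↦ F q t) (fun q ↦ ν q t) p) :
    ∃ u', HasDerivAt
      (fun s ↦ σ * lagrangianAngle g κ (fun q ↦ F q s) (fun q ↦ ν q s) p) u' t ∧
      u' + n * (σ * lagrangianAngle g κ (fun q ↦ F q t) (fun q ↦ ν q t) p) ≤ 0 := by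
  set c := chartAt (EuclideanSpace ℝ (Fin n)) p with hcdef
  set e := chartAt (EuclideanSpace ℝ (Fin (n + 1))) (F p t) with hedef
  have hc : c ∈ IsManifold.maximalAtlas (𝓡 n) ∞ M := IsManifold.chart_mem_maximalAtlas p
  have he : e ∈ IsManifold.maximalAtlas (𝓡 (n + 1)) ∞ N :=
    IsManifold.chart_mem_maximalAtlas (F p t)
  have hz : InCharts c e T F (c p, t) := inCharts_chartAt p ht
  have hcp : c.symm (c p) = p := c.left_inv (mem_chart_source _ p)
  have hflow := hF.isNormalFlowAt hc he hz h0
  have hφ := hflow.smooth_speed_two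
  set φ := flowAngle g κ c F ν with hφdef
  have hφp : ∀ s, φ (c p, s) = lagrangianAngle g κ (fun q ↦ F q s) (fun q ↦ ν q s) p :=
    fun s ↦ by rw [hφdef, flowAngle, hcp]
  have hσφ : ContDiffAt ℝ 2 (fun w ↦ σ • φ w) (c p, t) := contDiffAt_const.fun_smul hφ
  have hfd : ∀ᶠ w in 𝓝 (c p, t), fderiv ℝ (fun w ↦ σ • φ w) w = σ • fderiv ℝ φ w := by
    filter_upwards [hφ.eventually (by simp)] with w hw
    exact fderiv_fun_const_smul (hw.differentiableAt (by norm_num)) σ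
  -- The maximum is global on `M`, and every coordinate point is sent into `M` by `c.symm`, so no
  -- neighbourhood has to be chosen.
  have hlocal := fun v ↦ fderiv_of_isLocalMax_fst hσφ (Eventually.of_forall fun x ↦ by
    simp only [smul_eq_mul, hφp]
    exact hmax (c.symm x)) v
  have hcrit : ∀ v, fderiv ℝ φ (c p, t) (v, 0) = 0 := fun v ↦ by
    have := (hlocal v).1
    rw [hfd.self_of_nhds, smul_apply, smul_eq_mul] at this
    exact (mul_eq_zero.1 this).resolve_left hσ
  have hhess : ∀ v, σ * fderiv ℝ (fderiv ℝ φ) (c p, t) (v, 0) (v, 0) ≤ 0 := fun v ↦ by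
    have := (hlocal v).2
    rw [Filter.EventuallyEq.fderiv_eq hfd, fderiv_fun_const_smul
      ((hφ.fderiv_right (m := 1) (by norm_num)).differentiableAt (by norm_num))] at this
    simpa using this
  obtain ⟨b, l, hbl⟩ := hF.exists_fderiv_flowAngle_eq hκ hg hc he hz h0 hcrit
  refine ⟨σ * fderiv ℝ φ (c p, t) (0, 1), ?_, ?_⟩
  · have h1 : HasDerivAt (fun s : ℝ ↦ (c p, s)) ((0, 1) : EuclideanSpace ℝ (Fin n) × ℝ) t :=
      (hasDerivAt_const t (c p)).prodMk (hasDerivAt_id t)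
    have h2 := (hflow.diff_speed.hasFDerivAt.comp_hasDerivAt t h1).const_mul σ
    refine h2.congr_of_eventuallyEq (Eventually.of_forall fun s ↦ ?_)
    simp only [Function.comp]
    rw [← hφp]
  · rw [hbl, ← hφp, ← hφdef]
    have h3 : σ * ∑ i, fderiv ℝ (fderiv ℝ φ) (c p, t) (b i, 0) (b i, 0) / (κ + l i ^ 2) ≤ 0 := by
      rw [Finset.mul_sum]
      refine Finset.sum_nonpos fun i _ ↦ ?_
      rw [← mul_div_assoc]
      exact div_nonpos_of_nonpos_of_nonneg (hhess (b i)) (by positivity)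
    linarith

theorem continuousOn_const_mul_angle (hF : IsLagrangianAngleFlow τ κ T F ν) (σ : ℝ) :
    ContinuousOn (fun x : M × ℝ ↦
      σ * lagrangianAngle g κ (fun q ↦ F q x.2) (fun q ↦ ν q x.2) x.1) (univ ×ˢ timeInterval T) :=
  continuousOn_const.mul hF.continuousOn_angle

theorem continuous_angle_zero (hF : IsLagrangianAngleFlow τ κ T F ν) (hT : 0 < T) :
    Continuous fun p : M ↦ lagrangianAngle g κ (fun q ↦ F q 0) (fun q ↦ ν q 0) p :=
  hF.continuousOn_angle.comp_continuous (f := fun p : M ↦ (p, (0 : ℝ))) (by fun_prop)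
    fun p ↦ ⟨mem_univ _, le_rfl, by exact_mod_cast hT⟩

end IsLagrangianAngleFlow

end Conclusion

end AdSFlow

end

theorem lemma3p6 {n : ℕ}
    {N : Type*} [TopologicalSpace N] [T2Space N] [SecondCountableTopology N]
    [ChartedSpace (EuclideanSpace ℝ (Fin (n + 1))) N] [IsManifold (𝓡 (n + 1)) ∞ N]
    {M : Type*} [TopologicalSpace M] [T2Space M] [CompactSpace M]
    [ChartedSpace (EuclideanSpace ℝ (Fin n)) M] [IsManifold (𝓡 n) ∞ M]
    (g : AdSFlow.LorentzMetric n N) (τ : AdSFlow.TimeOrientation g)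
    (κ : ℝ) (hκ : 0 < κ) (hg : AdSFlow.HasConstantSectionalCurvature g (-κ))
    (T : EReal) (hT : 0 < T) (F : M → ℝ → N)
    (ν : ∀ (p : M) (t : ℝ), TangentSpace (𝓡 (n + 1)) (F p t))
    (hF : AdSFlow.IsLagrangianAngleFlow τ κ T F ν) :
    let φ : M → ℝ → ℝ := fun p t ↦
      AdSFlow.lagrangianAngle g κ (fun q ↦ F q t) (fun q ↦ ν q t) p
    ∀ p : M, ∀ t ∈ AdSFlow.timeInterval T,
      (⨅ q : M, φ q 0) ≤ φ p t * Real.exp (n * t) ∧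
        φ p t * Real.exp (n * t) ≤ ⨆ q : M, φ q 0 := by
  intro φ p t ht
  have hcont : Continuous fun q ↦ φ q 0 := hF.continuous_angle_zero hT
  -- One application of the maximum principle to `σ φ` covers both bounds: `σ = -1` gives the lower,
  -- `σ = 1` the upper.
  have key : ∀ σ : ℝ, σ ≠ 0 → ∀ C, (∀ q, σ * φ q 0 ≤ C) →
      σ * φ p t * Real.exp (n * t) ≤ C := fun σ hσ C hC ↦
    AdSFlow.mul_exp_le_of_maximum_principle (u := fun q s ↦ σ * φ q s)
      (hF.continuousOn_const_mul_angle σ)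
      (fun q s hs hs0 hq ↦ hF.exists_hasDerivAt_angle hκ hg hσ q hs hs0 hq) hC p ht
  constructor
  · have h1 := key (-1) (by norm_num) (-⨅ q : M, φ q 0) fun q ↦ by
      -- Compactness of `M` and continuity of the initial angle make the real infimum genuine.
      have := ciInf_le (isCompact_range hcont).bddBelow q
      linarith
    linarith
  · have h1 := key 1 one_ne_zero (⨆ q : M, φ q 0) fun q ↦ by
      rw [one_mul]
      exact le_ciSup (isCompact_range hcont).bddAbove q
    rwa [one_mul] at h1
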